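/- **Setting.** Let $n\ge 2$ and let $p=\sum_{k=0}^n p_kT_k$ be a complex polynomial that is monic in the Chebyshev basis ($p_n=1$); $\|p\|$ is the Euclidean norm of its coefficient vector in this basis. Its colleague matrix is $C=F+uv^*$, where $F$ is the $n\times n$ real symmetric tridiagonal matrix with zero diagonal and off-diagonal entries $\tfrac12,\dots,\tfrac12,\tfrac{\sqrt2}{2}$, $u=e_1$ and $v^*=-\tfrac12[p_{n-1},\dots,p_1,\sqrt2\,p_0]$. **Algorithm.** The structured QR iteration stores an upper Hessenberg Hermitian-plus-rank-one matrix $A$ by its diagonal $d$, its subdiagonal $\beta$ and the vectors $u,v$; the other entries are recovered from $A_{i,i+1}=\bar\beta_i-\bar u_{i+1}v_i+u_i\bar v_{i+1}$ and $A_{ij}=u_i\bar v_j-\bar u_jv_i$ for $j>i+1$. It starts from the generators of $C$, rounded with relative error at most $\epsilon_m$. Each iteration sets to zero some of the negligible subdiagonal entries ($|\beta_i|\le\epsilon_m(|d_i|+|d_{i+1}|)$) and then performs an implicit QR sweep (bulge chasing by Givens rotations), with an arbitrary shift, on a diagonal block that is decoupled from its neighbours. The Givens rotations of a sweep are applied to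 $u$, $v$ and to the small near-diagonal block of $A$ that determines the new $d$, $\beta$ and bulge entries. The shift polynomial is $z-\sigma$ (single shift) or $z^2-2\operatorname{Re}(\sigma)z+|\sigma|^2$ (double shift; here $2\times2$ blocks are processed by one Givens rotation). All operations obey the standard model of real floating point arithmetic: $\mathrm{fl}(x\mathbin{\mathrm{op}}y)=(x\mathbin{\mathrm{op}}y)(1+\delta)$ with $|\delta|\le\epsilon_m$ for $+,-,\times,/$, and likewise for the square root; complex operations are carried out through real ones. When, after a last deflation, all the subdiagonal entries are zero, the computed eigenvalues are $d_1,\dots,d_n$. **Amplification factor.** Put $j=1$ in the single-shift case and $j=2$ in the double-shift case, and let $n>j$. Let $u^{(k)},v^{(k)}$ be the computed vectors after $k$ rotations, and $$\hat\gamma_j(p)=\max_k\ \max_{1\le i\le n-j}\left\|\begin{bmatrix}u^{(k)}_i\\ \vdots\\ u^{(k)}_{\min\{i+j+1,n\}}\end{bmatrix}\right\|_2\left\|\begin{bmatrix}v^{(k)}_{\max\{1,i-1\}}\\ \vdots\\ v^{(k)}_{i+j}\end{bmatrix}\right\|_2 ,$$ where $k$ runs from $0$ to the total number of rotations performed. **Theorem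 3.4.** For every real polynomial $N$ there is a real polynomial $P$, depending on $N$ only, such that the following holds for all $n$, $p$ and $\epsilon_m$, for every floating point arithmetic as above and for every choice of the shifts, in the single- and in the double-shift case. If the iteration converges after at most $N(n)$ rotations, and if $P(n)\max\{1,\hat\gamma_j(p)\}\,\epsilon_m\le1$, then the computed eigenvalues are, counted with multiplicity, exactly the roots of a polynomial $p+\delta p$ that is monic of degree $n$ in the Chebyshev basis (so that $\delta p\in\operatorname{span}\{T_0,\dots,T_{n-1}\}$) and satisfies $$\|\delta p\|\le P(n)\cdot\max\{1,\hat\gamma_j(p)\}\cdot\|p\|\cdot\epsilon_m .$$ -/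

import Mathlib

/-! ## Floating point arithmetic -/

/-- The standard model of real floating point arithmetic with unit roundoff `ε`: every elementary
operation returns the exact result up to a relative error at most `ε`. -/
structure FloatArith (ε : ℝ) where
  add : ℝ → ℝ → ℝ
  sub : ℝ → ℝ → ℝ
  mul : ℝ → ℝ → ℝ
  div : ℝ → ℝ → ℝ
  sqrt : ℝ → ℝ
  add_err : ∀ x y, |add x y - (x + y)| ≤ ε * |x + y|
  sub_err : ∀ x y, |sub x y - (x - y)| ≤ ε * |x - y|
  mul_err : ∀ x y, |mul x y - x * y| ≤ ε * |x * y|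
  div_err : ∀ x y, y ≠ 0 → |div x y - x / y| ≤ ε * |x / y|
  sqrt_err : ∀ x, 0 ≤ x → |sqrt x - Real.sqrt x| ≤ ε * Real.sqrt x

namespace FloatArith

variable {ε : ℝ} (fl : FloatArith ε)

/-- Complex addition, carried out with real floating point operations. -/
def cadd (z w : ℂ) : ℂ := ⟨fl.add z.re w.re, fl.add z.im w.im⟩

/-- Complex subtraction, carried out with real floating point operations. -/
def csub (z w : ℂ) : ℂ := ⟨fl.sub z.re w.re, fl.sub z.im w.im⟩

/-- Complex multiplication, carried out with real floating point operations. -/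
def cmul (z w : ℂ) : ℂ :=
  ⟨fl.sub (fl.mul z.re w.re) (fl.mul z.im w.im), fl.add (fl.mul z.re w.im) (fl.mul z.im w.re)⟩

/-- Division of a complex number by a real one. -/
def cdivr (z : ℂ) (r : ℝ) : ℂ := ⟨fl.div z.re r, fl.div z.im r⟩

/-- Computed `|z| ^ 2`. -/
def cabsSq (z : ℂ) : ℝ := fl.add (fl.mul z.re z.re) (fl.mul z.im z.im)

/-- Computed `|z|`. -/
def cabs (z : ℂ) : ℝ := fl.sqrt (fl.cabsSq z)

/-- Computed Euclidean norm of the vector `(a, b)`. -/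
def hypot (a b : ℂ) : ℝ := fl.sqrt (fl.add (fl.cabsSq a) (fl.cabsSq b))

end FloatArith

/-! ## Givens rotations -/

/-- The rotation `G = [c, -conj s; s, conj c]`, so that `G* = [conj c, conj s; -s, c]`. -/
structure Rot where
  c : ℂ
  s : ℂ

namespace FloatArith

variable {ε : ℝ} (fl : FloatArith ε)

open Classical in
/-- Computed Givens rotation `G` with `G* (a, b) = (r, 0)`, `r = ‖(a, b)‖`, together with `r`;
it is the identity if `r = 0`. -/
noncomputable def givens (a b : ℂ) : Rot × ℝ :=
  let r := fl.hypot a b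
  if r = 0 then (⟨1, 0⟩, r) else (⟨fl.cdivr a r, fl.cdivr b r⟩, r)

/-- Computed product `G* w`, with `G` acting on the entries `k, k + 1`. -/
def rotVec (G : Rot) (k : ℕ) (w : ℕ → ℂ) : ℕ → ℂ := fun i =>
  if i = k then fl.cadd (fl.cmul (star G.c) (w k)) (fl.cmul (star G.s) (w (k + 1)))
  else if i = k + 1 then fl.csub (fl.cmul G.c (w (k + 1))) (fl.cmul G.s (w k))
  else w i

/-- Computed product `G* M`, with `G` acting on the rows `k, k + 1` of a small block `M`. -/
def rotRows (G : Rot) (k : ℕ) (M : ℕ → ℕ → ℂ) : ℕ → ℕ → ℂ := fun i j =>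
  fl.rotVec G k (fun a => M a j) i

/-- Computed product `M G`, with `G` acting on the columns `k, k + 1` of a small block `M`. -/
def rotCols (G : Rot) (k : ℕ) (M : ℕ → ℕ → ℂ) : ℕ → ℕ → ℂ := fun i j =>
  if j = k then fl.cadd (fl.cmul (M i k) G.c) (fl.cmul (M i (k + 1)) G.s)
  else if j = k + 1 then
    fl.csub (fl.cmul (M i (k + 1)) (star G.c)) (fl.cmul (M i k) (star G.s))
  else M i j

end FloatArith

/-! ## The structured QR iteration -/

/-- The generators of an upper Hessenberg Hermitian-plus-rank-one matrix `A = F + u v*`, with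
indices starting from `0`: `d i = A i i`, `β i = A (i + 1) i`, and the vectors `u`, `v`. The
remaining entries of `A` on and above the diagonal are
`A i (i + 1) = conj (β i) - conj (u (i + 1)) * v i + u i * conj (v (i + 1))` and
`A i j = u i * conj (v j) - conj (u j) * v i` for `j > i + 1`. -/
structure Gen where
  d : ℕ → ℂ
  β : ℕ → ℂ
  u : ℕ → ℂ
  v : ℕ → ℂ

namespace FloatArith

variable {ε : ℝ} (fl : FloatArith ε)

/-- Computed superdiagonal entry `A i (i + 1)`. -/
def superdiag (g : Gen) (i : ℕ) : ℂ :=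
  fl.cadd (fl.csub (star (g.β i)) (fl.cmul (star (g.u (i + 1))) (g.v i)))
    (fl.cmul (g.u i) (star (g.v (i + 1))))

/-- Computed entry `A i (i + 2)`, if `b` is the entry `A (i + 2) i` of the bulge. -/
def superdiag₂ (g : Gen) (i : ℕ) (b : ℂ) : ℂ :=
  fl.cadd (fl.csub (star b) (fl.cmul (star (g.u (i + 2))) (g.v i)))
    (fl.cmul (g.u i) (star (g.v (i + 2))))

/-- The `3 × 2` block of rows `i, …, i + 2` and columns `i, i + 1`. -/
def block₁ (g : Gen) (i : ℕ) : ℕ → ℕ → ℂ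
  | 0, 0 => g.d i
  | 0, 1 => fl.superdiag g i
  | 1, 0 => g.β i
  | 1, 1 => g.d (i + 1)
  | 2, 1 => g.β (i + 1)
  | _, _ => 0

/-- The `4 × 3` block of rows `i, …, i + 3` and columns `i, …, i + 2`, where `b` is the entry
`A (i + 2) i` of the bulge. -/
def block₂ (g : Gen) (i : ℕ) (b : ℂ) : ℕ → ℕ → ℂ
  | 0, 0 => g.d i
  | 0, 1 => fl.superdiag g i
  | 0, 2 => fl.superdiag₂ g i b
  | 1, 0 => g.β i
  | 1, 1 => g.d (i + 1)
  | 1, 2 => fl.superdiag g (i + 1)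
  | 2, 0 => b
  | 2, 1 => g.β (i + 1)
  | 2, 2 => g.d (i + 2)
  | 3, 2 => g.β (i + 2)
  | _, _ => 0

/-- One step of the single-shift iteration: the similarity `G* A G` with a rotation `G` acting on
the indices `i, i + 1`. The second component of the result is the new bulge `A (i + 2) i`. -/
def chase₁ (G : Rot) (i : ℕ) (g : Gen) : Gen × ℂ :=
  let M := fl.rotCols G 0 (fl.rotRows G 0 (fl.block₁ g i))
  ({ d := Function.update (Function.update g.d i (M 0 0)) (i + 1) (M 1 1)
     β := Function.update (Function.update g.β i (M 1 0)) (i + 1) (M 2 1)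
     u := fl.rotVec G i g.u
     v := fl.rotVec G i g.v }, M 2 0)

/-- The bulge of the double-shift iteration after the step with index `i`:
`b₁ = A (i + 2) i`, `b₂ = A (i + 3) i`, `b₃ = A (i + 3) (i + 1)`. -/
structure Bulge₂ where
  b₁ : ℂ
  b₂ : ℂ
  b₃ : ℂ

/-- One step of the double-shift iteration: the similarity `G₁* G₂* A G₂ G₁`, where `G₂` acts on
the indices `i + 1, i + 2` and `G₁` on the indices `i, i + 1`; here `b` is the entry `A (i + 2) i`
before the step. The result holds the new generators, the new bulge, and the list of the pairs
`(u, v)` after each of the two rotations. -/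
def chase₂ (G₂ G₁ : Rot) (i : ℕ) (b : ℂ) (g : Gen) :
    Gen × Bulge₂ × List ((ℕ → ℂ) × (ℕ → ℂ)) :=
  let M := fl.rotCols G₁ 0 (fl.rotCols G₂ 1 (fl.rotRows G₁ 0 (fl.rotRows G₂ 1 (fl.block₂ g i b))))
  let u' := fl.rotVec G₂ (i + 1) g.u
  let v' := fl.rotVec G₂ (i + 1) g.v
  let u'' := fl.rotVec G₁ i u'
  let v'' := fl.rotVec G₁ i v'
  ({ d := Function.update (Function.update (Function.update g.d i (M 0 0)) (i + 1) (M 1 1))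
        (i + 2) (M 2 2)
     β := Function.update (Function.update (Function.update g.β i (M 1 0)) (i + 1) (M 2 1))
        (i + 2) (M 3 2)
     u := u''
     v := v'' }, ⟨M 2 0, M 3 0, M 3 1⟩, [(u', v'), (u'', v'')])

/-- The steps `i, …, i + k - 1` of the chasing of a bulge `b = A (i + 1) (i - 1)` in a single-shift
sweep, with the list of the pairs `(u, v)` after each rotation. -/
noncomputable def loop₁ : (k i : ℕ) → Gen → ℂ → Gen × List ((ℕ → ℂ) × (ℕ → ℂ))
  | 0, _, g, _ => (g, [])
  | k + 1, i, g, b =>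
    let Gr := fl.givens (g.β (i - 1)) b
    let s := fl.chase₁ Gr.1 i { g with β := Function.update g.β (i - 1) (Gr.2 : ℂ) }
    let e := loop₁ k (i + 1) s.1 s.2
    (e.1, (s.1.u, s.1.v) :: e.2)

/-- A single-shift sweep with shift `σ` on the diagonal block with indices `lo, …, hi`, together
with the list of the pairs `(u, v)` after each rotation. -/
noncomputable def sweep₁ (lo hi : ℕ) (σ : ℂ) (g : Gen) : Gen × List ((ℕ → ℂ) × (ℕ → ℂ)) :=
  let G := (fl.givens (fl.csub (g.d lo) σ) (g.β lo)).1
  let s := fl.chase₁ G lo g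
  let e := fl.loop₁ (hi - lo - 1) (lo + 1) s.1 s.2
  (e.1, (s.1.u, s.1.v) :: e.2)

/-- The steps `i, …, i + k - 1` of the chasing of a bulge in a double-shift sweep, followed by the
rotation of the last two indices `i + k, i + k + 1` that removes the bulge at the bottom of the
block. -/
noncomputable def loop₂ : (k i : ℕ) → Gen → Bulge₂ → Gen × List ((ℕ → ℂ) × (ℕ → ℂ))
  | 0, i, g, b => fl.loop₁ 1 i g b.b₁
  | k + 1, i, g, b =>
    let Gr₂ := fl.givens b.b₁ b.b₂
    let Gr₁ := fl.givens (g.β (i - 1)) (Gr₂.2 : ℂ)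
    let s := fl.chase₂ Gr₂.1 Gr₁.1 i b.b₃ { g with β := Function.update g.β (i - 1) (Gr₁.2 : ℂ) }
    let e := loop₂ k (i + 1) s.1 s.2.1
    (e.1, s.2.2 ++ e.2)

/-- A double-shift sweep with shift polynomial `z ^ 2 - 2 Re(σ) z + |σ| ^ 2` on the diagonal block
with indices `lo, …, hi` (at least three), together with the list of the pairs `(u, v)` after each
rotation. The numbers `x₀, x₁, x₂` are the nonzero entries of the first column of the shift
polynomial evaluated at the block. -/
noncomputable def sweep₂ (lo hi : ℕ) (σ : ℂ) (g : Gen) : Gen × List ((ℕ → ℂ) × (ℕ → ℂ)) :=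
  let t : ℂ := (fl.mul 2 σ.re : ℝ)
  let x₀ := fl.cadd
    (fl.csub (fl.cadd (fl.cmul (g.d lo) (g.d lo)) (fl.cmul (fl.superdiag g lo) (g.β lo)))
      (fl.cmul t (g.d lo))) (fl.cabsSq σ : ℝ)
  let x₁ := fl.cmul (g.β lo) (fl.csub (fl.cadd (g.d lo) (g.d (lo + 1))) t)
  let x₂ := fl.cmul (g.β lo) (g.β (lo + 1))
  let Gr₂ := fl.givens x₁ x₂
  let Gr₁ := fl.givens x₀ (Gr₂.2 : ℂ)
  let s := fl.chase₂ Gr₂.1 Gr₁.1 lo 0 g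
  let e := fl.loop₂ (hi - lo - 2) (lo + 1) s.1 s.2.1
  (e.1, s.2.2 ++ e.2)

/-- `g'` arises from `g` by deflation: some of the subdiagonal entries that are negligible with
respect to the two neighbouring diagonal entries, `|β i| ≤ ε (|d i| + |d (i + 1)|)` in floating
point arithmetic, are set to zero. -/
def Deflation (g g' : Gen) : Prop :=
  g'.d = g.d ∧ g'.u = g.u ∧ g'.v = g.v ∧
  ∀ i, g'.β i = g.β i ∨
    (g'.β i = 0 ∧ fl.cabs (g.β i) ≤ fl.mul ε (fl.add (fl.cabs (g.d i)) (fl.cabs (g.d (i + 1)))))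

end FloatArith

/-- The two variants of the iteration. -/
inductive ShiftKind where
  | single
  | double

/-- The index `j` that goes with each variant. -/
def ShiftKind.index : ShiftKind → ℕ
  | .single => 1
  | .double => 2

/-- The diagonal block with indices `lo, …, hi` has at least two rows and is decoupled from its
neighbours. (The entry `β (n - 1)`, which lies outside the matrix, is zero by convention.) -/
def IsActive (n : ℕ) (g : Gen) (lo hi : ℕ) : Prop :=
  lo < hi ∧ hi < n ∧ (lo = 0 ∨ g.β (lo - 1) = 0) ∧ g.β hi = 0

namespace FloatArith

variable {ε : ℝ} (fl : FloatArith ε)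

/-- One QR sweep on some decoupled diagonal block of an `n × n` matrix, with some shift. In the
double-shift variant a block with only two rows is processed by a single rotation. The pair `e`
holds the new generators and the list of the pairs `(u, v)` after each rotation. -/
def QRSweep (n : ℕ) (g : Gen) (e : Gen × List ((ℕ → ℂ) × (ℕ → ℂ))) : ShiftKind → Prop
  | .single => ∃ (lo hi : ℕ) (σ : ℂ), IsActive n g lo hi ∧ e = fl.sweep₁ lo hi σ g
  | .double => ∃ (lo hi : ℕ) (σ : ℂ), IsActive n g lo hi ∧
      ((hi = lo + 1 ∧ e = fl.sweep₁ lo hi σ g) ∨ (lo + 2 ≤ hi ∧ e = fl.sweep₂ lo hi σ g))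

/-- `fl.QRRun kind n g₀ g t`: starting from the generators `g₀`, finitely many iterations, each
consisting of a deflation and a sweep, with arbitrary shifts, lead to the generators `g`; the list
`t` holds the pairs `(u, v)` at the beginning and after each rotation. -/
inductive QRRun (kind : ShiftKind) (n : ℕ) (g₀ : Gen) :
    Gen → List ((ℕ → ℂ) × (ℕ → ℂ)) → Prop
  | start : QRRun kind n g₀ g₀ [(g₀.u, g₀.v)]
  | step {g g' : Gen} {t : List ((ℕ → ℂ) × (ℕ → ℂ))} {e : Gen × List ((ℕ → ℂ) × (ℕ → ℂ))} :
      QRRun kind n g₀ g t → fl.Deflation g g' → fl.QRSweep n g' e kind →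
      QRRun kind n g₀ e.1 (t ++ e.2)

/-- The structured QR iteration, started from the generators `g₀`, has converged: after a run
that produces the list `t` of pairs `(u, v)` and a last deflation, the matrix is upper triangular,
and its generators are `g`. The computed eigenvalues are `g.d 0, …, g.d (n - 1)`, and the number
of rotations is `t.length - 1`. -/
def QRConverged (kind : ShiftKind) (n : ℕ) (g₀ g : Gen) (t : List ((ℕ → ℂ) × (ℕ → ℂ))) : Prop :=
  ∃ g', fl.QRRun kind n g₀ g' t ∧ fl.Deflation g' g ∧ ∀ i, i + 1 < n → g.β i = 0

end FloatArith

/-! ## The amplification factor -/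

/-- Euclidean norm of the subvector of `w` with indices `a, …, b`. -/
noncomputable def segNorm (w : ℕ → ℂ) (a b : ℕ) : ℝ :=
  Real.sqrt (∑ i ∈ Finset.Icc a b, ‖w i‖ ^ 2)

/-- `γ_j(u, v)` for vectors of length `n`, with indices starting from `0`: the supremum over
`0 ≤ i < n - j` of `‖(u_i, …, u_min(i+j+1, n-1))‖ * ‖(v_max(0, i-1), …, v_(i+j))‖`. -/
noncomputable def gammaFactor (n j : ℕ) (u v : ℕ → ℂ) : ℝ :=
  ⨆ i : Fin (n - j), segNorm u (i : ℕ) (min ((i : ℕ) + j + 1) (n - 1)) *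
    segNorm v ((i : ℕ) - 1) ((i : ℕ) + j)

/-- The supremum of `γ_j` over all the pairs `(u, v)` met during the iteration. -/
noncomputable def gammaHat (n j : ℕ) (t : List ((ℕ → ℂ) × (ℕ → ℂ))) : ℝ :=
  ⨆ k : Fin t.length, gammaFactor n j (t.get k).1 (t.get k).2

/-! ## Polynomials in the Chebyshev basis and colleague matrices -/

/-- The polynomial `∑ c_k T_k`. -/
noncomputable def chebPoly {n : ℕ} (c : EuclideanSpace ℂ (Fin (n + 1))) : Polynomial ℂ :=
  ∑ k : Fin (n + 1), Polynomial.C (c k) * Polynomial.Chebyshev.T ℂ (k : ℕ)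

/-- The real symmetric part of the colleague matrix: it is tridiagonal with zero diagonal, and its
off-diagonal entries are `1 / 2`, except for the last one, which is `√2 / 2`. -/
noncomputable def colleagueF (n : ℕ) : Matrix (Fin n) (Fin n) ℂ := fun i j =>
  if (i : ℕ) + 1 = j ∨ (j : ℕ) + 1 = i then
    (if (i : ℕ) + 1 = n ∨ (j : ℕ) + 1 = n then (Real.sqrt 2 : ℂ) / 2 else 1 / 2)
  else 0

/-- The first vector of the canonical basis. -/
def colleagueU (n : ℕ) : Fin n → ℂ := fun i => if (i : ℕ) = 0 then 1 else 0

/-- The vector `v` with `v* = -(1 / 2) [c_{n-1}, c_{n-2}, …, c_1, √2 c_0]`, for a polynomial that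
is monic in the Chebyshev basis. -/
noncomputable def colleagueV {n : ℕ} (c : EuclideanSpace ℂ (Fin (n + 1))) : Fin n → ℂ := fun i =>
  -(if (i : ℕ) + 1 = n then (Real.sqrt 2 : ℂ) else 1) / 2 *
    star (c ⟨n - 1 - i, by omega⟩)

/-- The colleague matrix `C = F + u v*` of a polynomial that is monic in the Chebyshev basis. -/
noncomputable def colleague {n : ℕ} (c : EuclideanSpace ℂ (Fin (n + 1))) :
    Matrix (Fin n) (Fin n) ℂ :=
  colleagueF n + Matrix.vecMulVec (colleagueU n) (star (colleagueV c))

/-- `g` holds the generators of the colleague matrix of `∑ c_k T_k`, each of them rounded with a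
relative error at most `ε`. -/
def IsRoundedColleague (ε : ℝ) {n : ℕ} (c : EuclideanSpace ℂ (Fin (n + 1))) (g : Gen) : Prop :=
  (∀ i : Fin n, ‖g.d i - colleague c i i‖ ≤ ε * ‖colleague c i i‖) ∧
  (∀ i j : Fin n, (j : ℕ) + 1 = i → ‖g.β j - colleague c i j‖ ≤ ε * ‖colleague c i j‖) ∧
  (∀ i, n ≤ i + 1 → g.β i = 0) ∧
  (∀ i : Fin n, ‖g.u i - colleagueU n i‖ ≤ ε * ‖colleagueU n i‖) ∧
  (∀ i : Fin n, ‖g.v i - colleagueV c i‖ ≤ ε * ‖colleagueV c i‖)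

/-!
# Backward stability of the structured QR iteration for colleague matrices

The computed matrix is represented as `A = F + u v*`, where `F` is determined by the entries of `A`
on and below the diagonal together with `u` and `v`, and is Hermitian off the diagonal by
construction (`repF`, `repA`). The argument has two halves.

*The errors of the iteration.* One rotation is an exact unitary similarity, followed by relative
errors `O(ε)` in `u` and `v` and by errors in `F` of size `O(ε) ‖u a‖ ‖v b‖` (`Tracks.rotate`).
Close to the diagonal such a product is bounded by the amplification factor; far below the
diagonal `A` vanishes, so that `u a * conj (v b)` is up to its sign an entry of `F`, and these
entries are bounded because `F` is unitarily similar to the initial `F₀` up to small errors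
(`StateTracks.bdd`). Far above the diagonal nothing is computed: there `F` is the mirror image of
its lower part, and the mirroring is harmless because an exact similarity preserves the defect
`F - F*`, which consists of the imaginary parts of the diagonal. These grow only linearly with the
number of operations (`Tracks.step`). Hence no term of size `‖u‖ ‖v‖` ever occurs, and after the
whole run the matrix is unitarily similar to `(F₀ + E) + u' v'*` with `E` small in norm and `u'`,
`v'` close to the initial vectors in the relative sense (`FloatArith.QRConverged.tracks`).

*From the matrix to the polynomial.* By Cramer's rule `p(z) = 2 ^ (n - 1) det (z - C)`
(`det_sub_colleague`), and the matrix determinant lemma shows that the determinant of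
`z - F₀ - E - u' v'*` depends on `v'` in an affine way. On the ellipse `z = cos (φ + i / n)` the
polynomial `T_n = 2 ^ (n - 1) det (z - F₀)` is bounded and `(z - F₀)⁻¹` is at most `2 n²`, since the
eigenvalues of `F₀` are the zeros of `T_n`. So the change of the polynomial is bounded there by
`‖p‖` times the errors (`norm_eval_charpoly_sub_le`), with only one factor `‖v‖ ≤ n ‖p‖`, and its
Chebyshev coefficients are Fourier coefficients of its values on the ellipse
(`norm_chebyshev_coeff_le`).
-/

/-! ### Complex arithmetic in the standard model -/

namespace FloatArith

theorem eps_nonneg {ε : ℝ} (fl : FloatArith ε) : 0 ≤ ε := by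
  have h := (abs_nonneg _).trans (fl.add_err 1 0)
  norm_num at h
  exact h

variable {ε : ℝ} (fl : FloatArith ε)

theorem add_zero_zero : fl.add 0 0 = 0 := by
  simpa using fl.add_err 0 0

theorem sub_zero_zero : fl.sub 0 0 = 0 := by
  simpa using fl.sub_err 0 0

theorem zero_mul' (x : ℝ) : fl.mul 0 x = 0 := by
  simpa using fl.mul_err 0 x

theorem cmul_zero_left (z : ℂ) : fl.cmul 0 z = 0 := by
  apply Complex.ext <;> simp [cmul, zero_mul', add_zero_zero, sub_zero_zero]

theorem cadd_zero_zero : fl.cadd 0 0 = 0 := by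
  apply Complex.ext <;> simp [cadd, add_zero_zero]

theorem csub_zero_zero : fl.csub 0 0 = 0 := by
  apply Complex.ext <;> simp [csub, sub_zero_zero]

theorem cadd_err (z w : ℂ) : ‖fl.cadd z w - (z + w)‖ ≤ 2 * ε * ‖z + w‖ := by
  have h0 := fl.eps_nonneg
  refine (Complex.norm_le_abs_re_add_abs_im _).trans ?_
  have h1 := fl.add_err z.re w.re
  have h2 := fl.add_err z.im w.im
  have h3 := Complex.abs_re_le_norm (z + w)
  have h4 := Complex.abs_im_le_norm (z + w)
  simp only [cadd, Complex.sub_re, Complex.add_re, Complex.sub_im, Complex.add_im] at *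
  nlinarith

theorem csub_err (z w : ℂ) : ‖fl.csub z w - (z - w)‖ ≤ 2 * ε * ‖z - w‖ := by
  have h0 := fl.eps_nonneg
  refine (Complex.norm_le_abs_re_add_abs_im _).trans ?_
  have h1 := fl.sub_err z.re w.re
  have h2 := fl.sub_err z.im w.im
  have h3 := Complex.abs_re_le_norm (z - w)
  have h4 := Complex.abs_im_le_norm (z - w)
  simp only [csub, Complex.sub_re, Complex.sub_im] at *
  nlinarith

theorem abs_mul_le_norm (a b : ℝ) (z w : ℂ) (ha : |a| ≤ ‖z‖) (hb : |b| ≤ ‖w‖) :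
    |a * b| ≤ ‖z‖ * ‖w‖ := by
  rw [abs_mul]
  exact mul_le_mul ha hb (abs_nonneg _) (norm_nonneg _)

theorem sub_mul_err (h1 : ε ≤ 1) {a b c d p q m : ℝ} (hm : |a * b| ≤ m) (hm' : |c * d| ≤ m)
    (hp : |p - a * b| ≤ ε * |a * b|) (hq : |q - c * d| ≤ ε * |c * d|) :
    |fl.sub p q - (a * b - c * d)| ≤ 6 * ε * m := by
  have h0 := fl.eps_nonneg
  have h2 := fl.sub_err p q
  have hp' : |p - a * b| ≤ ε * m := hp.trans (mul_le_mul_of_nonneg_left hm h0)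
  have hq' : |q - c * d| ≤ ε * m := hq.trans (mul_le_mul_of_nonneg_left hm' h0)
  have hm0 : 0 ≤ m := (abs_nonneg _).trans hm
  have h3 : |p - q| ≤ 4 * m := by
    have : ε * m ≤ m := mul_le_of_le_one_left hm0 h1
    rw [abs_le] at *
    constructor <;> linarith
  have h4 : |fl.sub p q - (p - q)| ≤ ε * (4 * m) := h2.trans (mul_le_mul_of_nonneg_left h3 h0)
  rw [abs_le] at *
  constructor <;> linarith

theorem add_mul_err (h1 : ε ≤ 1) {a b c d p q m : ℝ} (hm : |a * b| ≤ m) (hm' : |c * d| ≤ m)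
    (hp : |p - a * b| ≤ ε * |a * b|) (hq : |q - c * d| ≤ ε * |c * d|) :
    |fl.add p q - (a * b + c * d)| ≤ 6 * ε * m := by
  have h0 := fl.eps_nonneg
  have h2 := fl.add_err p q
  have hp' : |p - a * b| ≤ ε * m := hp.trans (mul_le_mul_of_nonneg_left hm h0)
  have hq' : |q - c * d| ≤ ε * m := hq.trans (mul_le_mul_of_nonneg_left hm' h0)
  have hm0 : 0 ≤ m := (abs_nonneg _).trans hm
  have h3 : |p + q| ≤ 4 * m := by
    have : ε * m ≤ m := mul_le_of_le_one_left hm0 h1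
    rw [abs_le] at *
    constructor <;> linarith
  have h4 : |fl.add p q - (p + q)| ≤ ε * (4 * m) := h2.trans (mul_le_mul_of_nonneg_left h3 h0)
  rw [abs_le] at *
  constructor <;> linarith

theorem cmul_err (h1 : ε ≤ 1) (z w : ℂ) : ‖fl.cmul z w - z * w‖ ≤ 12 * ε * (‖z‖ * ‖w‖) := by
  refine (Complex.norm_le_abs_re_add_abs_im _).trans ?_
  have hz := Complex.abs_re_le_norm z
  have hz' := Complex.abs_im_le_norm z
  have hw := Complex.abs_re_le_norm w
  have hw' := Complex.abs_im_le_norm w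
  have e1 := fl.sub_mul_err h1 (abs_mul_le_norm _ _ z w hz hw) (abs_mul_le_norm _ _ z w hz' hw')
    (fl.mul_err _ _) (fl.mul_err _ _)
  have e2 := fl.add_mul_err h1 (abs_mul_le_norm _ _ z w hz hw') (abs_mul_le_norm _ _ z w hz' hw)
    (fl.mul_err _ _) (fl.mul_err _ _)
  simp only [cmul, Complex.sub_re, Complex.mul_re, Complex.sub_im, Complex.mul_im]
  linarith

/-- A computed sum of two computed products. -/
theorem cadd_cmul_err (h1 : ε ≤ 1 / 100) (z₁ w₁ z₂ w₂ : ℂ) :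
    ‖fl.cadd (fl.cmul z₁ w₁) (fl.cmul z₂ w₂) - (z₁ * w₁ + z₂ * w₂)‖ ≤
      15 * ε * (‖z₁‖ * ‖w₁‖ + ‖z₂‖ * ‖w₂‖) := by
  have h0 := fl.eps_nonneg
  have e1 := fl.cmul_err (by linarith) z₁ w₁
  have e2 := fl.cmul_err (by linarith) z₂ w₂
  have e3 := fl.cadd_err (fl.cmul z₁ w₁) (fl.cmul z₂ w₂)
  set p := fl.cmul z₁ w₁
  set q := fl.cmul z₂ w₂
  set S := ‖z₁‖ * ‖w₁‖ + ‖z₂‖ * ‖w₂‖ with hS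
  have hS0 : 0 ≤ S := by positivity
  have e4 : ‖(p + q) - (z₁ * w₁ + z₂ * w₂)‖ ≤ 12 * ε * S := by
    have : (p + q) - (z₁ * w₁ + z₂ * w₂) = (p - z₁ * w₁) + (q - z₂ * w₂) := by ring
    rw [this]
    refine (norm_add_le _ _).trans ?_
    rw [hS]
    linarith
  have e5 : ‖z₁ * w₁ + z₂ * w₂‖ ≤ S := (norm_add_le _ _).trans (by rw [norm_mul, norm_mul])
  have e6 : ‖p + q‖ ≤ (1 + 12 * ε) * S := by
    have := norm_le_norm_add_norm_sub' (p + q) (z₁ * w₁ + z₂ * w₂)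
    linarith
  have e7 : 2 * ε * ‖p + q‖ ≤ 3 * ε * S := by
    have : 2 * ε * ‖p + q‖ ≤ 2 * ε * ((1 + 12 * ε) * S) :=
      mul_le_mul_of_nonneg_left e6 (by linarith)
    nlinarith [mul_nonneg h0 hS0]
  have := norm_sub_le_norm_sub_add_norm_sub (fl.cadd p q) (p + q) (z₁ * w₁ + z₂ * w₂)
  linarith

/-- A computed difference of two computed products. -/
theorem csub_cmul_err (h1 : ε ≤ 1 / 100) (z₁ w₁ z₂ w₂ : ℂ) :
    ‖fl.csub (fl.cmul z₁ w₁) (fl.cmul z₂ w₂) - (z₁ * w₁ - z₂ * w₂)‖ ≤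
      15 * ε * (‖z₁‖ * ‖w₁‖ + ‖z₂‖ * ‖w₂‖) := by
  have h0 := fl.eps_nonneg
  have e1 := fl.cmul_err (by linarith) z₁ w₁
  have e2 := fl.cmul_err (by linarith) z₂ w₂
  have e3 := fl.csub_err (fl.cmul z₁ w₁) (fl.cmul z₂ w₂)
  set p := fl.cmul z₁ w₁
  set q := fl.cmul z₂ w₂
  set S := ‖z₁‖ * ‖w₁‖ + ‖z₂‖ * ‖w₂‖ with hS
  have hS0 : 0 ≤ S := by positivity
  have e4 : ‖(p - q) - (z₁ * w₁ - z₂ * w₂)‖ ≤ 12 * ε * S := by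
    have : (p - q) - (z₁ * w₁ - z₂ * w₂) = (p - z₁ * w₁) - (q - z₂ * w₂) := by ring
    rw [this]
    refine (norm_sub_le _ _).trans ?_
    rw [hS]
    linarith
  have e5 : ‖z₁ * w₁ - z₂ * w₂‖ ≤ S := (norm_sub_le _ _).trans (by rw [norm_mul, norm_mul])
  have e6 : ‖p - q‖ ≤ (1 + 12 * ε) * S := by
    have := norm_le_norm_add_norm_sub' (p - q) (z₁ * w₁ - z₂ * w₂)
    linarith
  have e7 : 2 * ε * ‖p - q‖ ≤ 3 * ε * S := by
    have : 2 * ε * ‖p - q‖ ≤ 2 * ε * ((1 + 12 * ε) * S) :=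
      mul_le_mul_of_nonneg_left e6 (by linarith)
    nlinarith [mul_nonneg h0 hS0]
  have := norm_sub_le_norm_sub_add_norm_sub (fl.csub p q) (p - q) (z₁ * w₁ - z₂ * w₂)
  linarith

/-- The computed entry `conj b - conj u₁ * v₀ + u₀ * conj v₁` above the diagonal. -/
theorem upper_entry_err (h1 : ε ≤ 1 / 100) (b x y z w : ℂ) :
    ‖fl.cadd (fl.csub b (fl.cmul x y)) (fl.cmul z w) - (b - x * y + z * w)‖ ≤
      20 * ε * (‖b‖ + ‖x‖ * ‖y‖ + ‖z‖ * ‖w‖) := by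
  have h0 := fl.eps_nonneg
  have e1 := fl.cmul_err (by linarith) x y
  have e2 := fl.cmul_err (by linarith) z w
  have e3 := fl.csub_err b (fl.cmul x y)
  have e4 := fl.cadd_err (fl.csub b (fl.cmul x y)) (fl.cmul z w)
  set p := fl.cmul x y
  set q := fl.cmul z w
  set r := fl.csub b p
  set s := fl.cadd r q
  set X := ‖x‖ * ‖y‖ with hX
  set Z := ‖z‖ * ‖w‖ with hZ
  have hX0 : 0 ≤ X := by positivity
  have hZ0 : 0 ≤ Z := by positivity
  have hb0 := norm_nonneg b
  have hp : ‖p‖ ≤ (1 + 12 * ε) * X := by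
    have := norm_le_norm_add_norm_sub' p (x * y)
    rw [norm_mul] at this
    linarith
  have hq : ‖q‖ ≤ (1 + 12 * ε) * Z := by
    have := norm_le_norm_add_norm_sub' q (z * w)
    rw [norm_mul] at this
    linarith
  have hbp : ‖b - p‖ ≤ ‖b‖ + 1.12 * X := by
    have := norm_sub_le b p
    nlinarith
  have e3' : ‖r - (b - p)‖ ≤ 2 * ε * (‖b‖ + 1.12 * X) :=
    e3.trans (mul_le_mul_of_nonneg_left hbp (by linarith))
  have hr : ‖r‖ ≤ 1.02 * (‖b‖ + 1.12 * X) := by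
    have := norm_le_norm_add_norm_sub' r (b - p)
    nlinarith
  have hrq : ‖r + q‖ ≤ 1.02 * (‖b‖ + 1.12 * X) + 1.12 * Z := by
    have := norm_add_le r q
    nlinarith
  have e4' : ‖s - (r + q)‖ ≤ 2 * ε * (1.02 * (‖b‖ + 1.12 * X) + 1.12 * Z) :=
    e4.trans (mul_le_mul_of_nonneg_left hrq (by linarith))
  have : s - (b - x * y + z * w) = (s - (r + q)) + (r - (b - p)) - (p - x * y) + (q - z * w) := by
    ring
  rw [this]
  refine (norm_add_le _ _).trans ?_
  have t1 := norm_sub_le (s - (r + q) + (r - (b - p))) (p - x * y)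
  have t2 := norm_add_le (s - (r + q)) (r - (b - p))
  have := mul_nonneg h0 hX0
  have := mul_nonneg h0 hZ0
  have := mul_nonneg h0 hb0
  nlinarith

/-! ### Computed moduli and Givens rotations -/

theorem cabsSq_err (h1 : ε ≤ 1 / 100) (z : ℂ) : |fl.cabsSq z - ‖z‖ ^ 2| ≤ 3 * ε * ‖z‖ ^ 2 := by
  have h0 := fl.eps_nonneg
  have e1 := fl.mul_err z.re z.re
  have e2 := fl.mul_err z.im z.im
  have e3 := fl.add_err (fl.mul z.re z.re) (fl.mul z.im z.im)
  rw [cabsSq, Complex.sq_norm, Complex.normSq_apply]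
  rw [abs_mul_self] at e1 e2
  have hx := mul_self_nonneg z.re
  have hy := mul_self_nonneg z.im
  set x := z.re * z.re
  set y := z.im * z.im
  set p := fl.mul z.re z.re
  set q := fl.mul z.im z.im
  have e4 : |p + q| ≤ 1.01 * (x + y) := by
    rw [abs_le] at *
    constructor <;> nlinarith
  have e5 : |fl.add p q - (p + q)| ≤ ε * (1.01 * (x + y)) :=
    e3.trans (mul_le_mul_of_nonneg_left e4 h0)
  have := mul_nonneg h0 hx
  have := mul_nonneg h0 hy
  rw [abs_le] at *
  constructor <;> nlinarith

/-- The computed square root of a number close to `ρ ^ 2`. -/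
theorem sqrt_sq_err (h1 : ε ≤ 1 / 100) {ρ x : ℝ} (hρ : 0 ≤ ρ) (hx : |x - ρ ^ 2| ≤ 5 * ε * ρ ^ 2) :
    |fl.sqrt x - ρ| ≤ 7 * ε * ρ := by
  have h0 := fl.eps_nonneg
  have hx0 : 0 ≤ x := by
    rw [abs_le] at hx
    nlinarith [sq_nonneg ρ]
  have e1 := fl.sqrt_err x hx0
  have hs0 := Real.sqrt_nonneg x
  have hs := Real.sq_sqrt hx0
  set s := Real.sqrt x
  have e2 : |s - ρ| ≤ 5 * ε * ρ := by
    rcases hρ.eq_or_lt with rfl | hpos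
    · have : s = 0 := by
        have : x = 0 := by simpa using hx
        rw [this] at hs
        simpa using hs
      simp [this]
    · have : |s - ρ| * ρ ≤ 5 * ε * ρ * ρ := by
        calc |s - ρ| * ρ ≤ |s - ρ| * (s + ρ) :=
              mul_le_mul_of_nonneg_left (by linarith) (abs_nonneg _)
          _ = |x - ρ ^ 2| := by
              rw [← hs, ← abs_of_nonneg (show 0 ≤ s + ρ by linarith), ← abs_mul]
              congr 1
              ring
          _ ≤ _ := by linarith
      exact le_of_mul_le_mul_right this hpos
  have e3 : s ≤ 1.05 * ρ := by
    rw [abs_le] at e2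
    nlinarith
  have : ε * s ≤ ε * (1.05 * ρ) := mul_le_mul_of_nonneg_left e3 h0
  have := mul_nonneg h0 hρ
  rw [abs_le] at *
  constructor <;> linarith

theorem cabs_err (h1 : ε ≤ 1 / 100) (z : ℂ) : |fl.cabs z - ‖z‖| ≤ 7 * ε * ‖z‖ := by
  refine fl.sqrt_sq_err h1 (norm_nonneg _) ((fl.cabsSq_err h1 z).trans ?_)
  have := mul_nonneg fl.eps_nonneg (sq_nonneg ‖z‖)
  linarith

theorem hypot_err (h1 : ε ≤ 1 / 100) (a b : ℂ) :
    |fl.hypot a b - Real.sqrt (‖a‖ ^ 2 + ‖b‖ ^ 2)| ≤ 7 * ε * Real.sqrt (‖a‖ ^ 2 + ‖b‖ ^ 2) := by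
  have h0 := fl.eps_nonneg
  refine fl.sqrt_sq_err h1 (Real.sqrt_nonneg _) ?_
  rw [Real.sq_sqrt (by positivity)]
  have e1 := fl.cabsSq_err h1 a
  have e2 := fl.cabsSq_err h1 b
  have e3 := fl.add_err (fl.cabsSq a) (fl.cabsSq b)
  have hx := sq_nonneg ‖a‖
  have hy := sq_nonneg ‖b‖
  set x := ‖a‖ ^ 2
  set y := ‖b‖ ^ 2
  set p := fl.cabsSq a
  set q := fl.cabsSq b
  have e4 : |p + q| ≤ 1.03 * (x + y) := by
    rw [abs_le] at *
    constructor <;> nlinarith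
  have e5 : |fl.add p q - (p + q)| ≤ ε * (1.03 * (x + y)) :=
    e3.trans (mul_le_mul_of_nonneg_left e4 h0)
  have := mul_nonneg h0 hx
  have := mul_nonneg h0 hy
  rw [abs_le] at *
  constructor <;> nlinarith

theorem cdivr_err (z : ℂ) {r : ℝ} (hr : r ≠ 0) : ‖fl.cdivr z r - z / r‖ ≤ 2 * ε * ‖z / r‖ := by
  have h0 := fl.eps_nonneg
  refine (Complex.norm_le_abs_re_add_abs_im _).trans ?_
  have h1 := fl.div_err z.re r hr
  have h2 := fl.div_err z.im r hr
  have h3 := Complex.abs_re_le_norm (z / r)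
  have h4 := Complex.abs_im_le_norm (z / r)
  simp only [cdivr, Complex.sub_re, Complex.sub_im, Complex.div_ofReal_re,
    Complex.div_ofReal_im] at *
  nlinarith

end FloatArith

/-- `G` is an exact Givens rotation, that is, a unitary one. -/
def Rot.IsUnitary (G : Rot) : Prop := G.c * star G.c + G.s * star G.s = 1

/-- The entries of the rotations `G` and `H` differ by at most `η`. -/
def Rot.Near (η : ℝ) (G H : Rot) : Prop := ‖G.c - H.c‖ ≤ η ∧ ‖G.s - H.s‖ ≤ η

theorem Rot.IsUnitary.norm_sq {G : Rot} (h : G.IsUnitary) : ‖G.c‖ ^ 2 + ‖G.s‖ ^ 2 = 1 := by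
  have h' : G.c * star G.c + G.s * star G.s = 1 := h
  rw [Complex.star_def, Complex.mul_conj, Complex.mul_conj] at h'
  rw [Complex.sq_norm, Complex.sq_norm]
  exact_mod_cast h'

theorem Rot.IsUnitary.norm_c_le {G : Rot} (h : G.IsUnitary) : ‖G.c‖ ≤ 1 := by
  nlinarith [h.norm_sq, norm_nonneg G.c, sq_nonneg ‖G.s‖]

theorem Rot.IsUnitary.norm_s_le {G : Rot} (h : G.IsUnitary) : ‖G.s‖ ≤ 1 := by
  nlinarith [h.norm_sq, norm_nonneg G.s, sq_nonneg ‖G.c‖]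

theorem norm_div_sub_div_le {z : ℂ} {r ρ δ : ℝ} (hρ : 0 < ρ) (hz : ‖z‖ ≤ ρ)
    (h : |r - ρ| ≤ δ * ρ) (hδ : δ ≤ 1 / 2) : ‖z / r - z / ρ‖ ≤ 2 * δ ∧ ‖z / (r : ℂ)‖ ≤ 2 := by
  have hr : ρ / 2 ≤ r := by
    rw [abs_le] at h
    nlinarith
  have hr0 : 0 < r := by linarith
  have hz' : ‖z‖ / r ≤ 2 := by
    rw [div_le_iff₀ hr0]
    linarith
  constructor
  · have : z / (r : ℂ) - z / ρ = (z / r) * ((ρ - r : ℝ) / ρ) := by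
      have : (r : ℂ) ≠ 0 := by exact_mod_cast hr0.ne'
      have : (ρ : ℂ) ≠ 0 := by exact_mod_cast hρ.ne'
      push_cast
      field_simp
    rw [this, norm_mul, norm_div, norm_div, Complex.norm_real, Complex.norm_real,
      Complex.norm_real, Real.norm_eq_abs, Real.norm_eq_abs, Real.norm_eq_abs, abs_of_pos hρ,
      abs_of_pos hr0, abs_sub_comm]
    refine mul_le_mul hz' ?_ (by positivity) (by norm_num)
    rw [div_le_iff₀ hρ]
    exact h
  · rwa [norm_div, Complex.norm_real, Real.norm_eq_abs, abs_of_pos hr0]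

/-- A computed Givens rotation is close to an exact one that maps `(a, b)` to `(ρ, 0)`, where `ρ`
is close to the computed `r`. -/
theorem FloatArith.givens_spec {ε : ℝ} (fl : FloatArith ε) (h1 : ε ≤ 1 / 100) (a b : ℂ) :
    ∃ (H : Rot) (ρ : ℝ), H.IsUnitary ∧ Rot.Near (20 * ε) (fl.givens a b).1 H ∧
      star H.c * a + star H.s * b = ρ ∧ H.c * b - H.s * a = 0 ∧
      |(fl.givens a b).2 - ρ| ≤ 7 * ε * ρ ∧ 0 ≤ ρ ∧ ρ ≤ ‖a‖ + ‖b‖ := by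
  have h0 := fl.eps_nonneg
  have hr := fl.hypot_err h1 a b
  have hρ0 := Real.sqrt_nonneg (‖a‖ ^ 2 + ‖b‖ ^ 2)
  have hρ2 := Real.sq_sqrt (show 0 ≤ ‖a‖ ^ 2 + ‖b‖ ^ 2 by positivity)
  set ρ := Real.sqrt (‖a‖ ^ 2 + ‖b‖ ^ 2)
  have hρab : ρ ≤ ‖a‖ + ‖b‖ := by
    nlinarith [norm_nonneg a, norm_nonneg b, mul_nonneg (norm_nonneg a) (norm_nonneg b)]
  unfold FloatArith.givens
  set r := fl.hypot a b
  by_cases hr0 : r = 0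
  · have hρ : ρ = 0 := by
      rw [hr0, zero_sub, abs_neg, abs_of_nonneg hρ0] at hr
      nlinarith
    have ha : a = 0 := by
      rw [hρ] at hρ2
      exact norm_eq_zero.mp (by nlinarith [sq_nonneg ‖a‖, sq_nonneg ‖b‖])
    have hb : b = 0 := by
      rw [hρ] at hρ2
      exact norm_eq_zero.mp (by nlinarith [sq_nonneg ‖a‖, sq_nonneg ‖b‖])
    refine ⟨⟨1, 0⟩, ρ, by simp [Rot.IsUnitary], ?_, ?_, ?_, ?_, hρ0, hρab⟩
    · simp [hr0, Rot.Near, h0]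
    · simp [ha, hρ]
    · simp [ha, hb]
    · simpa [hr0] using hr
  · have hρ : 0 < ρ := by
      rcases hρ0.eq_or_lt with h | h
      · rw [← h] at hr
        exact absurd (by simpa using hr) hr0
      · exact h
    have hρc : (ρ : ℂ) ≠ 0 := by exact_mod_cast hρ.ne'
    have ha : ‖a‖ ≤ ρ := by nlinarith [sq_nonneg ‖b‖, norm_nonneg a]
    have hb : ‖b‖ ≤ ρ := by nlinarith [sq_nonneg ‖a‖, norm_nonneg b]
    have hab : a * star a + b * star b = (ρ : ℂ) ^ 2 := by
      rw [Complex.star_def, Complex.mul_conj, Complex.mul_conj,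
        ← Complex.sq_norm, ← Complex.sq_norm]
      exact_mod_cast hρ2.symm
    have near : ∀ z : ℂ, ‖z‖ ≤ ρ → ‖fl.cdivr z r - z / ρ‖ ≤ 20 * ε := by
      intro z hz
      obtain ⟨e1, e2⟩ := norm_div_sub_div_le hρ hz hr (by linarith)
      have e3 := fl.cdivr_err z hr0
      have e4 := norm_sub_le_norm_sub_add_norm_sub (fl.cdivr z r) (z / r) (z / ρ)
      nlinarith
    have hst : ∀ z : ℂ, star (z / (ρ : ℂ)) = star z / ρ := fun z => by
      simp
    refine ⟨⟨a / ρ, b / ρ⟩, ρ, ?_, ?_, ?_, ?_, ?_, hρ0, hρab⟩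
    · simp only [Rot.IsUnitary, hst]
      field_simp
      exact hab
    · simp only [hr0, if_false]
      exact ⟨near a ha, near b hb⟩
    · simp only [hst]
      field_simp
      linear_combination hab
    · field_simp
      ring
    · simpa [hr0] using hr

/-! ### Operator norms of matrices -/

section MatrixNorm

open scoped Matrix Matrix.Norms.L2Operator

variable {n : ℕ}

/-- The Euclidean norm of a vector. -/
noncomputable def vnorm (w : Fin n → ℂ) : ℝ := ‖WithLp.toLp 2 w‖

theorem vnorm_nonneg (w : Fin n → ℂ) : 0 ≤ vnorm w := norm_nonneg _

theorem vnorm_add_le (w z : Fin n → ℂ) : vnorm (w + z) ≤ vnorm w + vnorm z := norm_add_le _ _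

theorem vnorm_mulVec_le (A : Matrix (Fin n) (Fin n) ℂ) (w : Fin n → ℂ) :
    vnorm (A *ᵥ w) ≤ ‖A‖ * vnorm w :=
  Matrix.l2_opNorm_mulVec A (WithLp.toLp 2 w)

theorem norm_apply_le_vnorm (w : Fin n → ℂ) (i : Fin n) : ‖w i‖ ≤ vnorm w :=
  PiLp.norm_apply_le (p := 2) (WithLp.toLp 2 w) i

theorem vnorm_le_sum (w : Fin n → ℂ) : vnorm w ≤ ∑ i, ‖w i‖ := by
  unfold vnorm
  rw [EuclideanSpace.norm_eq]
  refine Real.sqrt_le_iff.mpr ⟨Finset.sum_nonneg fun i _ => norm_nonneg _, ?_⟩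
  exact Finset.sum_sq_le_sq_sum_of_nonneg fun i _ => norm_nonneg _

theorem vnorm_single (j : Fin n) : vnorm (Pi.single j 1 : Fin n → ℂ) = 1 := by
  simp [vnorm]

theorem norm_entry_le (A : Matrix (Fin n) (Fin n) ℂ) (i j : Fin n) : ‖A i j‖ ≤ ‖A‖ := by
  have h := (norm_apply_le_vnorm (A *ᵥ Pi.single j 1) i).trans (vnorm_mulVec_le A _)
  rw [vnorm_single, mul_one] at h
  simpa using h

theorem opNorm_le_of_vnorm {A : Matrix (Fin n) (Fin n) ℂ} {C : ℝ} (hC : 0 ≤ C)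
    (h : ∀ w, vnorm (A *ᵥ w) ≤ C * vnorm w) : ‖A‖ ≤ C := by
  rw [Matrix.cstar_norm_def]
  refine ContinuousLinearMap.opNorm_le_bound _ hC fun w => ?_
  exact h w.ofLp

theorem opNorm_le_of_entries {A : Matrix (Fin n) (Fin n) ℂ} {a : ℝ} (ha : 0 ≤ a)
    (h : ∀ i j, ‖A i j‖ ≤ a) : ‖A‖ ≤ n ^ 2 * a := by
  refine opNorm_le_of_vnorm (by positivity) fun w => ?_
  refine (vnorm_le_sum _).trans ?_
  have : ∀ i, ‖(A *ᵥ w) i‖ ≤ n * (a * vnorm w) := by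
    intro i
    refine (norm_sum_le Finset.univ fun j => A i j * w j).trans ?_
    refine (Finset.sum_le_sum (g := fun _ => a * vnorm w) fun j _ => ?_).trans ?_
    · rw [norm_mul]
      exact mul_le_mul (h i j) (norm_apply_le_vnorm w j) (norm_nonneg _) ha
    · simp
  refine (Finset.sum_le_sum fun i _ => this i).trans ?_
  simp only [Finset.sum_const, Finset.card_univ, Fintype.card_fin, nsmul_eq_mul]
  linarith

theorem vnorm_unitary_mulVec_le {V : Matrix (Fin n) (Fin n) ℂ}
    (hV : V ∈ Matrix.unitaryGroup (Fin n) ℂ) (w : Fin n → ℂ) : vnorm (V *ᵥ w) ≤ vnorm w := by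
  rcases Nat.eq_zero_or_pos n with rfl | hn
  · exact le_of_eq (congrArg _ (Subsingleton.elim _ _))
  · have : Nonempty (Fin n) := ⟨⟨0, hn⟩⟩
    have h := vnorm_mulVec_le V w
    rwa [CStarRing.norm_of_mem_unitary hV, one_mul] at h

theorem norm_unitary_conj {V : Matrix (Fin n) (Fin n) ℂ}
    (hV : V ∈ Matrix.unitaryGroup (Fin n) ℂ) (A : Matrix (Fin n) (Fin n) ℂ) :
    ‖V * A * Vᴴ‖ = ‖A‖ := by
  have h' : Vᴴ ∈ unitary (Matrix (Fin n) (Fin n) ℂ) := Unitary.star_mem hV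
  rw [CStarRing.norm_mul_mem_unitary _ h', CStarRing.norm_mem_unitary_mul _ hV]

/-! ### Accumulated backward errors -/

/-- The matrix `F` and the vectors `u`, `v` are, up to the errors that `m` operations with local
error `ω` can cause, images of `F₀`, `u₀`, `v₀` under one unitary similarity. Off the diagonal
`F` is Hermitian; the imaginary parts of its diagonal entries are controlled separately, because
each operation moves them into the error of `F`. The number `M` bounds the number of all
operations. -/
structure Tracks (F₀ : Matrix (Fin n) (Fin n) ℂ) (u₀ v₀ : Fin n → ℂ) (M : ℕ) (ω : ℝ) (m : ℕ)
    (F : Matrix (Fin n) (Fin n) ℂ) (u v : Fin n → ℂ) : Prop where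
  herm : ∀ i j, i ≠ j → F j i = star (F i j)
  im_le : ∀ i, |(F i i).im| ≤ m * ω
  near : ∃ V ∈ Matrix.unitaryGroup (Fin n) ℂ,
    ‖F - V * F₀ * Vᴴ‖ ≤ m * (n ^ 2 * (3 * M * ω)) ∧
    vnorm (u - V *ᵥ u₀) ≤ m * ω * vnorm u₀ ∧ vnorm (v - V *ᵥ v₀) ≤ m * ω * vnorm v₀

theorem vnorm_near_trans {V W : Matrix (Fin n) (Fin n) ℂ}
    (hW : W ∈ Matrix.unitaryGroup (Fin n) ℂ) {u₀ u u' : Fin n → ℂ} {e ω : ℝ}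
    (hV : V ∈ Matrix.unitaryGroup (Fin n) ℂ)
    (he : e ≤ 1) (hω : 0 ≤ ω) (h : vnorm (u - V *ᵥ u₀) ≤ e * vnorm u₀)
    (h' : vnorm (u' - W *ᵥ u) ≤ ω / 2 * vnorm u) :
    vnorm (u' - (W * V) *ᵥ u₀) ≤ (e + ω) * vnorm u₀ := by
  have h1 : vnorm u ≤ 2 * vnorm u₀ := by
    have e1 : u = (u - V *ᵥ u₀) + V *ᵥ u₀ := by simp
    have e2 := vnorm_add_le (u - V *ᵥ u₀) (V *ᵥ u₀)
    rw [← e1] at e2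
    have e3 := vnorm_unitary_mulVec_le hV u₀
    nlinarith [vnorm_nonneg u₀]
  have h2 : u' - (W * V) *ᵥ u₀ = (u' - W *ᵥ u) + W *ᵥ (u - V *ᵥ u₀) := by
    rw [Matrix.mulVec_sub, Matrix.mulVec_mulVec]
    abel
  rw [h2]
  refine (vnorm_add_le _ _).trans ?_
  have h3 := vnorm_unitary_mulVec_le hW (u - V *ᵥ u₀)
  nlinarith [vnorm_nonneg u₀]

/-- The anti-Hermitian part of a unitary conjugate of a matrix that is Hermitian off the
diagonal. -/
theorem norm_conj_entry_sub_le {F W : Matrix (Fin n) (Fin n) ℂ} {δ : ℝ}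
    (hW : W ∈ Matrix.unitaryGroup (Fin n) ℂ) (hF : ∀ i j, i ≠ j → F j i = star (F i j))
    (hδ : 0 ≤ δ) (him : ∀ i, |(F i i).im| ≤ δ) (i j : Fin n) :
    ‖(W * F * Wᴴ) i j - star ((W * F * Wᴴ) j i)‖ ≤ 2 * δ := by
  have h1 : F - Fᴴ = Matrix.diagonal fun i => F i i - star (F i i) := by
    ext a b
    rw [Matrix.diagonal_apply, Matrix.sub_apply, Matrix.conjTranspose_apply]
    split_ifs with hab
    · rw [hab]
    · rw [hF a b hab, star_star, sub_self]
  have h2 : (W * F * Wᴴ) i j - star ((W * F * Wᴴ) j i) = (W * (F - Fᴴ) * Wᴴ) i j := by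
    rw [← Matrix.conjTranspose_apply, ← Matrix.sub_apply]
    simp only [Matrix.conjTranspose_mul, Matrix.conjTranspose_conjTranspose, Matrix.mul_sub,
      Matrix.sub_mul, Matrix.mul_assoc]
  rw [h2]
  refine (norm_entry_le _ _ _).trans ?_
  rw [norm_unitary_conj hW, h1, Matrix.l2_opNorm_diagonal]
  refine (pi_norm_le_iff_of_nonneg (by linarith)).mpr fun k => ?_
  have : F k k - star (F k k) = ((2 * (F k k).im : ℝ) : ℂ) * Complex.I := by
    rw [Complex.star_def, Complex.sub_conj]
  rw [this, norm_mul, Complex.norm_I, mul_one, Complex.norm_real, Real.norm_eq_abs, abs_mul,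
    abs_two]
  linarith [him k]

/-- One operation: an exact unitary similarity `W`, followed by an error of size `ω` in the entries
of `F` on and below the diagonal and by relative errors in `u` and `v`. -/
theorem Tracks.step {F₀ : Matrix (Fin n) (Fin n) ℂ} {u₀ v₀ : Fin n → ℂ} {M : ℕ} {ω : ℝ} {m : ℕ}
    {F F' : Matrix (Fin n) (Fin n) ℂ} {u v u' v' : Fin n → ℂ}
    (h : Tracks F₀ u₀ v₀ M ω m F u v) (hm : m + 1 ≤ M) (hω : 0 ≤ ω) (hMω : M * ω ≤ 1)
    {W : Matrix (Fin n) (Fin n) ℂ} (hW : W ∈ Matrix.unitaryGroup (Fin n) ℂ)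
    (herm : ∀ i j, i ≠ j → F' j i = star (F' i j))
    (hF : ∀ i j, j ≤ i → ‖F' i j - (W * F * Wᴴ) i j‖ ≤ ω)
    (hu : vnorm (u' - W *ᵥ u) ≤ ω / 2 * vnorm u) (hv : vnorm (v' - W *ᵥ v) ≤ ω / 2 * vnorm v) :
    Tracks F₀ u₀ v₀ M ω (m + 1) F' u' v' := by
  obtain ⟨V, hV, h1, h2, h3⟩ := h.near
  have hm' : (m : ℝ) + 1 ≤ M := by exact_mod_cast hm
  have hm0 : (0 : ℝ) ≤ m := m.cast_nonneg
  have hmω : (m : ℝ) * ω ≤ 1 := by nlinarith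
  have hδ : (0 : ℝ) ≤ m * ω := by positivity
  -- the anti-Hermitian part of the conjugate is as small as the imaginary parts of the diagonal
  have anti := norm_conj_entry_sub_le hW h.herm hδ h.im_le
  refine ⟨herm, fun i => ?_, W * V, mul_mem hW hV, ?_, ?_, ?_⟩
  · have e1 := anti i i
    have e2 := hF i i le_rfl
    set z := (W * F * Wᴴ) i i
    have e3 : |z.im| ≤ m * ω := by
      have : z - star z = ((2 * z.im : ℝ) : ℂ) * Complex.I := by
        rw [Complex.star_def, Complex.sub_conj]
      rw [this, norm_mul, Complex.norm_I, mul_one, Complex.norm_real, Real.norm_eq_abs, abs_mul,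
        abs_two] at e1
      linarith
    have e4 := (Complex.abs_im_le_norm (F' i i - z)).trans e2
    rw [Complex.sub_im] at e4
    push_cast
    rw [abs_le] at *
    constructor <;> linarith
  -- above the diagonal compare with the mirror entry, at the cost of the anti-Hermitian part;
  -- this is where the error of one operation grows from `ω` to `3 * M * ω`
  · have e0 : ∀ i j, ‖F' i j - (W * F * Wᴴ) i j‖ ≤ 3 * M * ω := by
      intro i j
      rcases le_or_gt j i with hij | hij
      · refine (hF i j hij).trans ?_
        nlinarith
      · have e1 := anti i j
        have e2 := hF j i hij.le
        rw [← norm_star, star_sub, ← herm j i hij.ne'] at e2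
        have e3 := norm_sub_le_norm_sub_add_norm_sub (F' i j) (star ((W * F * Wᴴ) j i))
          ((W * F * Wᴴ) i j)
        rw [norm_sub_rev (star _)] at e3
        nlinarith
    have e4 : ‖F' - W * F * Wᴴ‖ ≤ n ^ 2 * (3 * M * ω) :=
      opNorm_le_of_entries (by positivity) fun i j => e0 i j
    have e5 : F' - W * V * F₀ * (W * V)ᴴ =
        (F' - W * F * Wᴴ) + W * (F - V * F₀ * Vᴴ) * Wᴴ := by
      simp only [Matrix.conjTranspose_mul, Matrix.mul_sub, Matrix.sub_mul, Matrix.mul_assoc]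
      abel
    rw [e5]
    refine (norm_add_le _ _).trans ?_
    rw [norm_unitary_conj hW]
    push_cast
    linarith
  · push_cast
    rw [add_mul, one_mul]
    exact vnorm_near_trans hW hV hmω hω h2 hu
  · push_cast
    rw [add_mul, one_mul]
    exact vnorm_near_trans hW hV hmω hω h3 hv

theorem Tracks.mono {F₀ : Matrix (Fin n) (Fin n) ℂ} {u₀ v₀ : Fin n → ℂ} {M : ℕ} {ω : ℝ} {m m' : ℕ}
    {F : Matrix (Fin n) (Fin n) ℂ} {u v : Fin n → ℂ} (hω : 0 ≤ ω) (hm : m ≤ m')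
    (h : Tracks F₀ u₀ v₀ M ω m F u v) : Tracks F₀ u₀ v₀ M ω m' F u v := by
  obtain ⟨V, hV, h1, h2, h3⟩ := h.near
  have hm' : (m : ℝ) ≤ m' := by exact_mod_cast hm
  refine ⟨h.herm, fun i => (h.im_le i).trans ?_, V, hV, h1.trans ?_, h2.trans ?_, h3.trans ?_⟩
  · gcongr
  · gcongr
  · exact mul_le_mul_of_nonneg_right (by gcongr) (vnorm_nonneg _)
  · exact mul_le_mul_of_nonneg_right (by gcongr) (vnorm_nonneg _)

theorem Tracks.norm_entry_le {F₀ : Matrix (Fin n) (Fin n) ℂ} {u₀ v₀ : Fin n → ℂ} {M : ℕ} {ω : ℝ}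
    {m : ℕ} {F : Matrix (Fin n) (Fin n) ℂ} {u v : Fin n → ℂ} (h : Tracks F₀ u₀ v₀ M ω m F u v)
    (hω : 0 ≤ ω) (hm : m ≤ M) (hM : 3 * n ^ 2 * M ^ 2 * ω ≤ 1) (i j : Fin n) :
    ‖F i j‖ ≤ ‖F₀‖ + 1 := by
  obtain ⟨V, hV, h1, -, -⟩ := h.near
  refine (_root_.norm_entry_le F i j).trans ?_
  have hm' : (m : ℝ) ≤ M := by exact_mod_cast hm
  have e1 : F = (F - V * F₀ * Vᴴ) + V * F₀ * Vᴴ := by abel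
  have e2 := norm_add_le (F - V * F₀ * Vᴴ) (V * F₀ * Vᴴ)
  rw [← e1, norm_unitary_conj hV] at e2
  have : (m : ℝ) * (n ^ 2 * (3 * M * ω)) ≤ M * (n ^ 2 * (3 * M * ω)) := by gcongr
  nlinarith

/-! ### Exact rotations -/

/-- The exact product `G* w`, with `G` acting on the entries `k, k + 1`. -/
def Rot.vec (G : Rot) (k : ℕ) (w : ℕ → ℂ) : ℕ → ℂ := fun i =>
  if i = k then star G.c * w k + star G.s * w (k + 1)
  else if i = k + 1 then G.c * w (k + 1) - G.s * w k
  else w i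

/-- The exact product `G* M`, with `G` acting on the rows `k, k + 1`. -/
def Rot.rows (G : Rot) (k : ℕ) (M : ℕ → ℕ → ℂ) : ℕ → ℕ → ℂ := fun i j =>
  G.vec k (fun a => M a j) i

/-- The exact product `M G`, with `G` acting on the columns `k, k + 1`. -/
def Rot.cols (G : Rot) (k : ℕ) (M : ℕ → ℕ → ℂ) : ℕ → ℕ → ℂ := fun i j =>
  if j = k then M i k * G.c + M i (k + 1) * G.s
  else if j = k + 1 then M i (k + 1) * star G.c - M i k * star G.s
  else M i j

/-- The leading `n × n` part of an infinite matrix. -/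
def trunc (n : ℕ) (M : ℕ → ℕ → ℂ) : Matrix (Fin n) (Fin n) ℂ := fun i j => M i j

/-- The first `n` entries of a sequence. -/
def truncV (n : ℕ) (w : ℕ → ℂ) : Fin n → ℂ := fun i => w i

/-- The `n × n` matrix `G*`, with `G` acting on the indices `k, k + 1`. -/
def Rot.mat (n : ℕ) (G : Rot) (k : ℕ) : Matrix (Fin n) (Fin n) ℂ := fun i j =>
  G.vec k (fun a => if a = j then 1 else 0) i

theorem Rot.mat_mulVec (G : Rot) {k : ℕ} (hk : k + 1 < n) (w : ℕ → ℂ) :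
    G.mat n k *ᵥ truncV n w = truncV n (G.vec k w) := by
  have key : ∀ a : ℕ, (ha : a < n) →
      ∑ j : Fin n, (if a = (j : ℕ) then (1 : ℂ) else 0) * w j = w a := by
    intro a ha
    rw [Finset.sum_eq_single ⟨a, ha⟩]
    · simp
    · intro b _ hb
      rw [if_neg, zero_mul]
      rintro rfl
      exact hb rfl
    · simp
  ext i
  simp only [Matrix.mulVec, dotProduct, Rot.mat, truncV, Rot.vec]
  split_ifs
  · simp only [add_mul, Finset.sum_add_distrib, mul_assoc, ← Finset.mul_sum]
    rw [key k (by omega), key _ hk]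
  · simp only [sub_mul, Finset.sum_sub_distrib, mul_assoc, ← Finset.mul_sum]
    rw [key k (by omega), key _ hk]
  · exact key i i.2

theorem trunc_rows (G : Rot) {k : ℕ} (hk : k + 1 < n) (M : ℕ → ℕ → ℂ) :
    trunc n (G.rows k M) = G.mat n k * trunc n M := by
  ext i j
  have := congrFun (G.mat_mulVec hk fun a => M a j) i
  exact this.symm

theorem trunc_cols (G : Rot) {k : ℕ} (hk : k + 1 < n) (M : ℕ → ℕ → ℂ) :
    trunc n (G.cols k M) = trunc n M * (G.mat n k)ᴴ := by
  ext i j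
  have := congrArg star (congrFun (G.mat_mulVec hk fun b => star (M i b)) j)
  simp only [truncV, Matrix.mulVec, dotProduct, star_sum, StarMul.star_mul, star_star] at this
  simp only [Matrix.mul_apply, Matrix.conjTranspose_apply, trunc]
  rw [this]
  simp only [Rot.cols, Rot.vec]
  split_ifs <;> simp [mul_comm]

theorem Rot.mat_mem {G : Rot} (hG : G.IsUnitary) {k : ℕ} (hk : k + 1 < n) :
    G.mat n k ∈ Matrix.unitaryGroup (Fin n) ℂ := by
  have hG' : G.c * star G.c + G.s * star G.s = 1 := hG
  rw [Matrix.mem_unitaryGroup_iff', Matrix.star_eq_conjTranspose]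
  have h1 : (G.mat n k)ᴴ = Rot.mat n ⟨star G.c, -G.s⟩ k := by
    ext i j
    simp only [Matrix.conjTranspose_apply, Rot.mat, Rot.vec]
    split_ifs <;> first | omega | simp
  have h2 : ∀ w : ℕ → ℂ, Rot.vec ⟨star G.c, -G.s⟩ k (G.vec k w) = w := by
    intro w
    ext i
    simp only [Rot.vec, star_star, star_neg]
    by_cases h : i = k
    · subst h
      simp only [if_true, Nat.succ_ne_self, if_false]
      linear_combination w i * hG'
    · by_cases h' : i = k + 1
      · subst h'
        simp only [if_true, Nat.succ_ne_self, if_false]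
        linear_combination w (k + 1) * hG'
      · simp only [h, h', if_false]
  rw [h1]
  have h3 : (1 : Matrix (Fin n) (Fin n) ℂ) = trunc n fun i j => if i = j then 1 else 0 := by
    ext i j
    simp [trunc, Matrix.one_apply, Fin.ext_iff]
  rw [← mul_one (G.mat n k), h3, ← trunc_rows G hk, ← trunc_rows _ hk]
  congr 1
  ext i j
  exact congrFun (h2 _) i

end MatrixNorm

/-! ### Matrices represented by generators -/

section Represented

open scoped Matrix Matrix.Norms.L2Operator

/-- The matrix `F = A - u v*` for a matrix `A` with the entries `L` on and below the diagonal;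
above the diagonal `F` is defined by `F i j = conj (F j i)`. -/
def repF (L : ℕ → ℕ → ℂ) (u v : ℕ → ℂ) : ℕ → ℕ → ℂ := fun i j =>
  if j ≤ i then L i j - u i * star (v j) else star (L j i - u j * star (v i))

/-- The matrix `A = F + u v*` with the entries `L` on and below the diagonal. -/
def repA (L : ℕ → ℕ → ℂ) (u v : ℕ → ℂ) : ℕ → ℕ → ℂ := fun i j =>
  repF L u v i j + u i * star (v j)

theorem repA_of_le (L : ℕ → ℕ → ℂ) (u v : ℕ → ℂ) {i j : ℕ} (h : j ≤ i) :
    repA L u v i j = L i j := by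
  simp [repA, repF, h]

theorem repA_of_lt (L : ℕ → ℕ → ℂ) (u v : ℕ → ℂ) {i j : ℕ} (h : i < j) :
    repA L u v i j = star (L j i) - star (u j) * v i + u i * star (v j) := by
  simp [repA, repF, h.not_ge]

theorem repF_herm (L : ℕ → ℕ → ℂ) (u v : ℕ → ℂ) {i j : ℕ} (h : i ≠ j) :
    repF L u v j i = star (repF L u v i j) := by
  rcases h.lt_or_gt with h | h
  · simp [repF, h.le, h.not_ge]
  · simp [repF, h.le, h.not_ge]

/-- `w'` is a computed and `w₁` the exact image of `w` under an operation that acts on the entries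
with indices `p, …, q`; the relative error is at most `η`. -/
def WindowErr (p q : ℕ) (η : ℝ) (w w' w₁ : ℕ → ℂ) : Prop :=
  (∀ i, p ≤ i → i ≤ q → ‖w' i - w₁ i‖ ≤ η * ∑ k ∈ Finset.Icc p q, ‖w k‖) ∧
  (∀ i, p ≤ i → i ≤ q → ‖w₁ i‖ ≤ ∑ k ∈ Finset.Icc p q, ‖w k‖) ∧
  ∀ i, ¬(p ≤ i ∧ i ≤ q) → w' i = w i ∧ w₁ i = w i

theorem card_Icc_le {p q : ℕ} (hq : q ≤ p + 2) : ((Finset.Icc p q).card : ℝ) ≤ 3 := by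
  rw [Nat.card_Icc]
  exact_mod_cast (by omega : q + 1 - p ≤ 3)

theorem sum_Icc_le {p q : ℕ} (hq : q ≤ p + 2) {f : ℕ → ℝ} {c : ℝ} (hc : 0 ≤ c)
    (h : ∀ k, p ≤ k → k ≤ q → f k ≤ c) : ∑ k ∈ Finset.Icc p q, f k ≤ 3 * c := by
  refine (Finset.sum_le_card_nsmul _ _ c fun k hk => ?_).trans ?_
  · rw [Finset.mem_Icc] at hk
    exact h k hk.1 hk.2
  · rw [nsmul_eq_mul]
    exact mul_le_mul_of_nonneg_right (card_Icc_le hq) hc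

theorem WindowErr.vnorm_le {n p q : ℕ} {η : ℝ} {w w' w₁ : ℕ → ℂ} (h : WindowErr p q η w w' w₁)
    (hη : 0 ≤ η) (hq : q ≤ p + 2) (hqn : q < n) :
    vnorm (truncV n w' - truncV n w₁) ≤ 9 * η * vnorm (truncV n w) := by
  have hS : ∑ k ∈ Finset.Icc p q, ‖w k‖ ≤ 3 * vnorm (truncV n w) :=
    sum_Icc_le hq (vnorm_nonneg _) fun k _ hk =>
      norm_apply_le_vnorm (truncV n w) ⟨k, by omega⟩
  set S := ∑ k ∈ Finset.Icc p q, ‖w k‖ with hSdef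
  have hS0 : 0 ≤ S := Finset.sum_nonneg fun k _ => norm_nonneg _
  refine (vnorm_le_sum _).trans ?_
  have h1 : ∑ i : Fin n, ‖(truncV n w' - truncV n w₁) i‖ = ∑ i ∈ Finset.range n, ‖w' i - w₁ i‖ :=
    Fin.sum_univ_eq_sum_range (fun i => ‖w' i - w₁ i‖) n
  have h2 : ∑ i ∈ Finset.Icc p q, ‖w' i - w₁ i‖ = ∑ i ∈ Finset.range n, ‖w' i - w₁ i‖ := by
    refine Finset.sum_subset (fun i hi => ?_) fun i _ hi => ?_
    · rw [Finset.mem_Icc] at hi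
      rw [Finset.mem_range]
      omega
    · rw [Finset.mem_Icc] at hi
      rw [(h.2.2 i hi).1, (h.2.2 i hi).2, sub_self, norm_zero]
  rw [h1, ← h2]
  have h3 : ∑ i ∈ Finset.Icc p q, ‖w' i - w₁ i‖ ≤ 3 * (η * S) :=
    sum_Icc_le hq (by positivity) fun k hk hk' => h.1 k hk hk'
  nlinarith

/-- The change of the rank one part below the diagonal is small as soon as the products
`‖u a‖ * ‖v b‖` are bounded for all `b ≤ a` and near the diagonal. -/
theorem WindowErr.rankOne_le {n p q w : ℕ} {η B : ℝ} {u u' u₁ v v' v₁ : ℕ → ℂ}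
    (hu : WindowErr p q η u u' u₁) (hv : WindowErr p q η v v' v₁) (hη : 0 ≤ η) (hη1 : η ≤ 1)
    (hq : q ≤ p + 2) (hqw : q ≤ p + w) (hqn : q < n) (hB0 : 0 ≤ B)
    (hB : ∀ a b, a < n → b < n → b ≤ a + w → ‖u a‖ * ‖v b‖ ≤ B) {i j : ℕ} (hji : j ≤ i)
    (hi : i < n) : ‖u' i * star (v' j) - u₁ i * star (v₁ j)‖ ≤ 27 * η * B := by
  set S := ∑ k ∈ Finset.Icc p q, ‖u k‖ with hS
  set R := ∑ k ∈ Finset.Icc p q, ‖v k‖ with hR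
  have hS0 : 0 ≤ S := Finset.sum_nonneg fun k _ => norm_nonneg _
  have hR0 : 0 ≤ R := Finset.sum_nonneg fun k _ => norm_nonneg _
  have hSv : ∀ b, b ≤ q → S * ‖v b‖ ≤ 3 * B := by
    intro b hb
    rw [hS, Finset.sum_mul]
    exact sum_Icc_le hq hB0 fun k hk hk' => hB k b (by omega) (by omega) (by omega)
  have hRu : ∀ a, p ≤ a → a < n → ‖u a‖ * R ≤ 3 * B := by
    intro a ha ha'
    rw [hR, Finset.mul_sum]
    exact sum_Icc_le hq hB0 fun k hk hk' => hB a k (by omega) (by omega) (by omega)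
  have hSR : S * R ≤ 9 * B := by
    rw [hR, Finset.mul_sum]
    refine (sum_Icc_le hq (c := 3 * B) (by positivity) fun k hk hk' => hSv k hk').trans ?_
    linarith
  have split : u' i * star (v' j) - u₁ i * star (v₁ j) =
      (u' i - u₁ i) * star (v' j) + u₁ i * star (v' j - v₁ j) := by
    rw [star_sub]
    ring
  rw [split]
  refine (norm_add_le _ _).trans ?_
  rw [norm_mul, norm_mul, norm_star, norm_star]
  have hηB : 0 ≤ η * B := mul_nonneg hη hB0
  by_cases hiW : p ≤ i ∧ i ≤ q
  · have e1 := hu.1 i hiW.1 hiW.2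
    have e2 := hu.2.1 i hiW.1 hiW.2
    by_cases hjW : p ≤ j ∧ j ≤ q
    · have e3 := hv.1 j hjW.1 hjW.2
      have e4 := hv.2.1 j hjW.1 hjW.2
      have e5 : ‖v' j‖ ≤ 2 * R := by
        have := norm_le_norm_add_norm_sub' (v' j) (v₁ j)
        nlinarith
      have e6 : ‖u' i - u₁ i‖ * ‖v' j‖ ≤ (η * S) * (2 * R) :=
        mul_le_mul e1 e5 (norm_nonneg _) (by positivity)
      have e7 : ‖u₁ i‖ * ‖v' j - v₁ j‖ ≤ S * (η * R) :=
        mul_le_mul e2 e3 (norm_nonneg _) hS0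
      have e8 : η * (S * R) ≤ η * (9 * B) := mul_le_mul_of_nonneg_left hSR hη
      nlinarith
    · obtain ⟨e3, e4⟩ := hv.2.2 j hjW
      rw [e3, e4, sub_self, norm_zero, mul_zero, add_zero]
      have e5 := hSv j (by omega)
      have e6 : ‖u' i - u₁ i‖ * ‖v j‖ ≤ (η * S) * ‖v j‖ :=
        mul_le_mul_of_nonneg_right e1 (norm_nonneg _)
      have e8 : η * (S * ‖v j‖) ≤ η * (3 * B) := mul_le_mul_of_nonneg_left e5 hη
      nlinarith
  · obtain ⟨e1, e2⟩ := hu.2.2 i hiW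
    rw [e1, e2, sub_self, norm_zero, zero_mul, zero_add]
    by_cases hjW : p ≤ j ∧ j ≤ q
    · have e3 := hv.1 j hjW.1 hjW.2
      have e5 := hRu i (by omega) hi
      have e7 : ‖u i‖ * ‖v' j - v₁ j‖ ≤ ‖u i‖ * (η * R) :=
        mul_le_mul_of_nonneg_left e3 (norm_nonneg _)
      have e8 : η * (‖u i‖ * R) ≤ η * (3 * B) := mul_le_mul_of_nonneg_left e5 hη
      nlinarith
    · obtain ⟨e3, e4⟩ := hv.2.2 j hjW
      rw [e3, e4, sub_self, norm_zero, mul_zero]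
      nlinarith

/-- `Tracks.step` in terms of the entries of `A` on and below the diagonal: `T` and `R` are the
exact similarity `W` as it acts on infinite matrices and on sequences. -/
theorem Tracks.rotate {n : ℕ} {F₀ : Matrix (Fin n) (Fin n) ℂ} {u₀ v₀ : Fin n → ℂ} {M m : ℕ}
    {ω η B e : ℝ} {L L' : ℕ → ℕ → ℂ} {u v u' v' : ℕ → ℂ} {p q w : ℕ}
    (h : Tracks F₀ u₀ v₀ M ω m (trunc n (repF L u v)) (truncV n u) (truncV n v))
    (hm : m + 1 ≤ M) (hω : 0 ≤ ω) (hMω : M * ω ≤ 1)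
    {W : Matrix (Fin n) (Fin n) ℂ} (hW : W ∈ Matrix.unitaryGroup (Fin n) ℂ)
    {T : (ℕ → ℕ → ℂ) → ℕ → ℕ → ℂ} {R : (ℕ → ℂ) → ℕ → ℂ}
    (hT : ∀ X, trunc n (T X) = W * trunc n X * Wᴴ)
    (hR : ∀ w, truncV n (R w) = W *ᵥ truncV n w)
    (hu : WindowErr p q η u u' (R u)) (hv : WindowErr p q η v v' (R v)) (hη : 0 ≤ η) (hη1 : η ≤ 1)
    (hq : q ≤ p + 2) (hqw : q ≤ p + w) (hqn : q < n) (hB0 : 0 ≤ B)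
    (hB : ∀ a b, a < n → b < n → b ≤ a + w → ‖u a‖ * ‖v b‖ ≤ B)
    (hL : ∀ i j, j ≤ i → i < n → ‖L' i j - T (repA L u v) i j‖ ≤ e)
    (h1 : e + 27 * η * B ≤ ω) (h2 : 18 * η ≤ ω) :
    Tracks F₀ u₀ v₀ M ω (m + 1) (trunc n (repF L' u' v')) (truncV n u') (truncV n v') := by
  have key : ∀ i j : Fin n, (W * trunc n (repF L u v) * Wᴴ) i j =
      T (repA L u v) i j - R u i * star (R v j) := by
    intro i j
    have e1 : trunc n (repF L u v) =
        trunc n (repA L u v) - Matrix.vecMulVec (truncV n u) (star (truncV n v)) := by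
      ext a b
      simp [trunc, repA, Matrix.vecMulVec_apply, truncV]
    rw [e1, Matrix.mul_sub, Matrix.sub_mul, ← hT, Matrix.mul_vecMulVec, Matrix.vecMulVec_mul,
      Matrix.vecMul_conjTranspose, star_star, ← hR, ← hR]
    simp [trunc, Matrix.vecMulVec_apply, truncV]
  refine h.step hm hω hMω hW (fun i j hij => ?_) (fun i j hij => ?_) ?_ ?_
  · exact repF_herm L' u' v' fun h => hij (Fin.ext h)
  · have hij' : (j : ℕ) ≤ i := hij
    rw [key]
    have e1 : trunc n (repF L' u' v') i j = L' i j - u' i * star (v' j) := by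
      simp [trunc, repF, hij']
    have e2 := hL i j hij' i.2
    have e3 := hu.rankOne_le hv hη hη1 hq hqw hqn hB0 hB hij' i.2
    rw [e1]
    have e4 : L' i j - u' i * star (v' j) - (T (repA L u v) i j - R u i * star (R v j)) =
      (L' i j - T (repA L u v) i j) - (u' i * star (v' j) - R u i * star (R v j)) := by ring
    rw [e4]
    refine (norm_sub_le _ _).trans ?_
    linarith
  · rw [← hR]
    have := hu.vnorm_le hη hq hqn
    nlinarith [vnorm_nonneg (truncV n u)]
  · rw [← hR]
    have := hv.vnorm_le hη hq hqn
    nlinarith [vnorm_nonneg (truncV n v)]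

end Represented

/-! ### Computed rotations of vectors and blocks -/

theorem norm_mul_add_mul_le {x y c s : ℂ} (hc : ‖c‖ ≤ 1) (hs : ‖s‖ ≤ 1) :
    ‖x * c + y * s‖ ≤ ‖x‖ + ‖y‖ := by
  refine (norm_add_le _ _).trans (add_le_add ?_ ?_) <;> rw [norm_mul]
  · exact mul_le_of_le_one_right (norm_nonneg _) hc
  · exact mul_le_of_le_one_right (norm_nonneg _) hs

theorem norm_mul_sub_mul_le {x y c s : ℂ} (hc : ‖c‖ ≤ 1) (hs : ‖s‖ ≤ 1) :
    ‖x * c - y * s‖ ≤ ‖x‖ + ‖y‖ := by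
  refine (norm_sub_le _ _).trans (add_le_add ?_ ?_) <;> rw [norm_mul]
  · exact mul_le_of_le_one_right (norm_nonneg _) hc
  · exact mul_le_of_le_one_right (norm_nonneg _) hs

namespace FloatArith

variable {ε : ℝ} (fl : FloatArith ε)

/-- The effect of the errors of the coefficients `c`, `s` on a linear combination; the first bound
absorbs the rounding errors of its evaluation. -/
theorem lin_comb_perturb (h0 : 0 ≤ ε) (h1 : ε ≤ 1 / 1000) {c s c' s' : ℂ} (hc : ‖c - c'‖ ≤ 20 * ε)
    (hs : ‖s - s'‖ ≤ 20 * ε) (hc' : ‖c'‖ ≤ 1) (hs' : ‖s'‖ ≤ 1) (x y : ℂ) :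
    15 * ε * (‖x‖ * ‖c‖ + ‖y‖ * ‖s‖) ≤ 18 * ε * (‖x‖ + ‖y‖) ∧
    ‖x * c + y * s - (x * c' + y * s')‖ ≤ 20 * ε * (‖x‖ + ‖y‖) ∧
    ‖x * c - y * s - (x * c' - y * s')‖ ≤ 20 * ε * (‖x‖ + ‖y‖) := by
  have hx := norm_nonneg x
  have hy := norm_nonneg y
  have e1 : ‖c‖ ≤ 1.02 := by
    have := norm_le_norm_add_norm_sub' c c'
    linarith
  have e2 : ‖s‖ ≤ 1.02 := by
    have := norm_le_norm_add_norm_sub' s s'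
    linarith
  have e3 : ‖x * (c - c')‖ ≤ ‖x‖ * (20 * ε) := by
    rw [norm_mul]
    exact mul_le_mul_of_nonneg_left hc hx
  have e4 : ‖y * (s - s')‖ ≤ ‖y‖ * (20 * ε) := by
    rw [norm_mul]
    exact mul_le_mul_of_nonneg_left hs hy
  refine ⟨?_, ?_, ?_⟩
  · have : ‖x‖ * ‖c‖ + ‖y‖ * ‖s‖ ≤ 1.02 * (‖x‖ + ‖y‖) := by nlinarith
    nlinarith [mul_nonneg h0 (add_nonneg hx hy)]
  · rw [show x * c + y * s - (x * c' + y * s') = x * (c - c') + y * (s - s') by ring]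
    exact (norm_add_le _ _).trans (by linarith)
  · rw [show x * c - y * s - (x * c' - y * s') = x * (c - c') - y * (s - s') by ring]
    exact (norm_sub_le _ _).trans (by linarith)

/-- The four linear combinations that occur in computed rotations, in terms of the exact ones. -/
theorem lin_add_err (h1 : ε ≤ 1 / 1000) {c s c' s' : ℂ} (hc : ‖c - c'‖ ≤ 20 * ε)
    (hs : ‖s - s'‖ ≤ 20 * ε) (hc' : ‖c'‖ ≤ 1) (hs' : ‖s'‖ ≤ 1) (x y : ℂ) :
    ‖fl.cadd (fl.cmul c x) (fl.cmul s y) - (c' * x + s' * y)‖ ≤ 40 * ε * (‖x‖ + ‖y‖) ∧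
    ‖fl.cadd (fl.cmul x c) (fl.cmul y s) - (x * c' + y * s')‖ ≤ 40 * ε * (‖x‖ + ‖y‖) ∧
    ‖fl.csub (fl.cmul c x) (fl.cmul s y) - (c' * x - s' * y)‖ ≤ 40 * ε * (‖x‖ + ‖y‖) ∧
    ‖fl.csub (fl.cmul x c) (fl.cmul y s) - (x * c' - y * s')‖ ≤ 40 * ε * (‖x‖ + ‖y‖) := by
  obtain ⟨e1, e2, e3⟩ := lin_comb_perturb fl.eps_nonneg h1 hc hs hc' hs' x y
  have h0 := mul_nonneg fl.eps_nonneg (add_nonneg (norm_nonneg x) (norm_nonneg y))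
  have hε : ε ≤ 1 / 100 := by linarith
  refine ⟨?_, ?_, ?_, ?_⟩
  · have f1 := fl.cadd_cmul_err hε c x s y
    have f2 := norm_sub_le_norm_sub_add_norm_sub (fl.cadd (fl.cmul c x) (fl.cmul s y))
      (c * x + s * y) (c' * x + s' * y)
    rw [mul_comm c x, mul_comm s y, mul_comm c' x, mul_comm s' y] at *
    rw [mul_comm ‖c‖, mul_comm ‖s‖] at f1
    linarith
  · have f1 := fl.cadd_cmul_err hε x c y s
    have f2 := norm_sub_le_norm_sub_add_norm_sub (fl.cadd (fl.cmul x c) (fl.cmul y s))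
      (x * c + y * s) (x * c' + y * s')
    linarith
  · have f1 := fl.csub_cmul_err hε c x s y
    have f2 := norm_sub_le_norm_sub_add_norm_sub (fl.csub (fl.cmul c x) (fl.cmul s y))
      (c * x - s * y) (c' * x - s' * y)
    rw [mul_comm c x, mul_comm s y, mul_comm c' x, mul_comm s' y] at *
    rw [mul_comm ‖c‖, mul_comm ‖s‖] at f1
    linarith
  · have f1 := fl.csub_cmul_err hε x c y s
    have f2 := norm_sub_le_norm_sub_add_norm_sub (fl.csub (fl.cmul x c) (fl.cmul y s))
      (x * c - y * s) (x * c' - y * s')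
    linarith

end FloatArith

theorem Rot.Near.star_c {G H : Rot} {η : ℝ} (h : Rot.Near η G H) :
    ‖star G.c - star H.c‖ ≤ η := by
  rw [← star_sub, norm_star]
  exact h.1

theorem Rot.Near.star_s {G H : Rot} {η : ℝ} (h : Rot.Near η G H) :
    ‖star G.s - star H.s‖ ≤ η := by
  rw [← star_sub, norm_star]
  exact h.2

theorem Rot.norm_vec_le {H : Rot} (hH : H.IsUnitary) (k : ℕ) (w : ℕ → ℂ) {i : ℕ}
    (hi : i = k ∨ i = k + 1) : ‖H.vec k w i‖ ≤ ‖w k‖ + ‖w (k + 1)‖ := by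
  have hc := hH.norm_c_le
  have hs := hH.norm_s_le
  have hc' : ‖star H.c‖ ≤ 1 := by rwa [norm_star]
  have hs' : ‖star H.s‖ ≤ 1 := by rwa [norm_star]
  rcases hi with rfl | rfl
  · simp only [Rot.vec, if_true]
    rw [mul_comm _ (w i), mul_comm _ (w (i + 1))]
    exact norm_mul_add_mul_le hc' hs'
  · simp only [Rot.vec, Nat.succ_ne_self, if_false, if_true]
    rw [mul_comm _ (w k), mul_comm _ (w (k + 1)), add_comm ‖w k‖]
    exact norm_mul_sub_mul_le hc hs

theorem Rot.vec_of_ne (H : Rot) {k i : ℕ} (w : ℕ → ℂ) (h : i ≠ k) (h' : i ≠ k + 1) :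
    H.vec k w i = w i := by
  simp [Rot.vec, h, h']

theorem Rot.vec_sub (H : Rot) (k : ℕ) (w z : ℕ → ℂ) :
    H.vec k (fun i => w i - z i) = fun i => H.vec k w i - H.vec k z i := by
  ext i
  simp only [Rot.vec]
  split_ifs <;> ring

namespace FloatArith

variable {ε : ℝ} (fl : FloatArith ε)

theorem rotVec_of_ne (G : Rot) {k i : ℕ} (w : ℕ → ℂ) (h : i ≠ k) (h' : i ≠ k + 1) :
    fl.rotVec G k w i = w i := by
  simp [rotVec, h, h']

theorem rotVec_err (h1 : ε ≤ 1 / 1000) {G H : Rot} (hH : H.IsUnitary) (hG : G.Near (20 * ε) H)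
    (k : ℕ) (w : ℕ → ℂ) {i : ℕ} (hi : i = k ∨ i = k + 1) :
    ‖fl.rotVec G k w i - H.vec k w i‖ ≤ 40 * ε * (‖w k‖ + ‖w (k + 1)‖) := by
  have hc := hH.norm_c_le
  have hs := hH.norm_s_le
  have hc' : ‖star H.c‖ ≤ 1 := by rwa [norm_star]
  have hs' : ‖star H.s‖ ≤ 1 := by rwa [norm_star]
  rcases hi with rfl | rfl
  · simp only [rotVec, Rot.vec, if_true]
    exact (fl.lin_add_err h1 hG.star_c hG.star_s hc' hs' _ _).1
  · simp only [rotVec, Rot.vec, Nat.succ_ne_self, if_false, if_true]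
    rw [add_comm ‖w k‖]
    exact (fl.lin_add_err h1 hG.1 hG.2 hc hs _ _).2.2.1

theorem rotVec_windowErr (h1 : ε ≤ 1 / 1000) {G H : Rot} (hH : H.IsUnitary)
    (hG : G.Near (20 * ε) H) (k : ℕ) (w : ℕ → ℂ) :
    WindowErr k (k + 1) (200 * ε) w (fl.rotVec G k w) (H.vec k w) := by
  have h0 := fl.eps_nonneg
  have hS : ∑ a ∈ Finset.Icc k (k + 1), ‖w a‖ = ‖w k‖ + ‖w (k + 1)‖ := by
    rw [Finset.sum_Icc_succ_top (by omega), Finset.Icc_self, Finset.sum_singleton]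
  unfold WindowErr
  rw [hS]
  refine ⟨fun i hi hi' => ?_, fun i hi hi' => ?_, fun i hi => ?_⟩
  · refine (fl.rotVec_err h1 hH hG k w (by omega)).trans ?_
    gcongr
    norm_num
  · exact Rot.norm_vec_le hH k w (by omega)
  · exact ⟨fl.rotVec_of_ne G w (by omega) (by omega), H.vec_of_ne w (by omega) (by omega)⟩

/-- The two rotations of a double-shift step, taken as one operation on three entries. -/
theorem rotVec_rotVec_windowErr (h1 : ε ≤ 1 / 1000) {G₁ G₂ H₁ H₂ : Rot} (hH₁ : H₁.IsUnitary)
    (hG₁ : G₁.Near (20 * ε) H₁) (hH₂ : H₂.IsUnitary) (hG₂ : G₂.Near (20 * ε) H₂) (k : ℕ)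
    (w : ℕ → ℂ) :
    WindowErr k (k + 2) (200 * ε) w (fl.rotVec G₁ k (fl.rotVec G₂ (k + 1) w))
      (H₁.vec k (H₂.vec (k + 1) w)) := by
  have h0 := fl.eps_nonneg
  have hS : ∑ a ∈ Finset.Icc k (k + 2), ‖w a‖ = ‖w k‖ + ‖w (k + 1)‖ + ‖w (k + 2)‖ := by
    rw [Finset.sum_Icc_succ_top (by omega), Finset.sum_Icc_succ_top (by omega), Finset.Icc_self,
      Finset.sum_singleton]
  set y := fl.rotVec G₂ (k + 1) w with hy
  set x := H₂.vec (k + 1) w with hx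
  have yk : y k = w k := fl.rotVec_of_ne G₂ w (by omega) (by omega)
  have xk : x k = w k := H₂.vec_of_ne w (by omega) (by omega)
  have x1 : ‖x (k + 1)‖ ≤ ‖w (k + 1)‖ + ‖w (k + 2)‖ := Rot.norm_vec_le hH₂ (k + 1) w (by omega)
  have x2 : ‖x (k + 2)‖ ≤ ‖w (k + 1)‖ + ‖w (k + 2)‖ := Rot.norm_vec_le hH₂ (k + 1) w (by omega)
  have y1 : ‖y (k + 1) - x (k + 1)‖ ≤ 40 * ε * (‖w (k + 1)‖ + ‖w (k + 2)‖) :=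
    fl.rotVec_err h1 hH₂ hG₂ (k + 1) w (by omega)
  have y2 : ‖y (k + 2) - x (k + 2)‖ ≤ 40 * ε * (‖w (k + 1)‖ + ‖w (k + 2)‖) :=
    fl.rotVec_err h1 hH₂ hG₂ (k + 1) w (by omega)
  have n0 := norm_nonneg (w k)
  have n1 := norm_nonneg (w (k + 1))
  have n2 := norm_nonneg (w (k + 2))
  have m0 := mul_nonneg h0 n0
  have m1 := mul_nonneg h0 n1
  have m2 := mul_nonneg h0 n2
  have y1' : ‖y (k + 1)‖ ≤ 1.04 * (‖w (k + 1)‖ + ‖w (k + 2)‖) := by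
    have := norm_le_norm_add_norm_sub' (y (k + 1)) (x (k + 1))
    nlinarith
  unfold WindowErr
  rw [hS]
  refine ⟨fun i hi hi' => ?_, fun i hi hi' => ?_, fun i hi => ?_⟩
  · by_cases hi2 : i = k + 2
    · subst hi2
      rw [fl.rotVec_of_ne G₁ y (by omega) (by omega), H₁.vec_of_ne x (by omega) (by omega)]
      linarith
    · have e1 := fl.rotVec_err h1 hH₁ hG₁ k y (i := i) (by omega)
      have e2 := Rot.norm_vec_le hH₁ k (fun a => y a - x a) (i := i) (by omega)
      rw [Rot.vec_sub, yk, xk, sub_self, norm_zero, zero_add] at e2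
      rw [yk] at e1
      have e3 := norm_sub_le_norm_sub_add_norm_sub (fl.rotVec G₁ k y i) (H₁.vec k y i)
        (H₁.vec k x i)
      have e4 : 40 * ε * (‖w k‖ + ‖y (k + 1)‖) ≤
          40 * ε * (‖w k‖ + 1.04 * (‖w (k + 1)‖ + ‖w (k + 2)‖)) := by gcongr
      linarith
  · by_cases hi2 : i = k + 2
    · subst hi2
      rw [H₁.vec_of_ne x (by omega) (by omega)]
      linarith
    · have := Rot.norm_vec_le hH₁ k x (i := i) (by omega)
      rw [xk] at this
      linarith
  · rw [fl.rotVec_of_ne G₁ y (by omega) (by omega), H₁.vec_of_ne x (by omega) (by omega), hy, hx]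
    exact ⟨fl.rotVec_of_ne G₂ w (by omega) (by omega), H₂.vec_of_ne w (by omega) (by omega)⟩

/-- In the rows `0, …, r` and the columns `0, …, s` the block `M` equals `X` up to an error `e`,
and the entries of `X` are bounded by `B`. -/
def BlockNear (r s : ℕ) (e B : ℝ) (M X : ℕ → ℕ → ℂ) : Prop :=
  ∀ a b, a ≤ r → b ≤ s → ‖M a b - X a b‖ ≤ e ∧ ‖X a b‖ ≤ B

/-- Each rotation of a block doubles the bounds: an entry of the image is a combination of two
entries with coefficients of modulus at most one. -/
theorem BlockNear.rows {fl : FloatArith ε} (h1 : ε ≤ 1 / 1000) {G H : Rot} (hH : H.IsUnitary)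
    (hG : G.Near (20 * ε) H) {r s k : ℕ} (hk : k + 1 ≤ r) {e B : ℝ} {M X : ℕ → ℕ → ℂ}
    (h : BlockNear r s e B M X) (he : e ≤ B) :
    BlockNear r s (2 * e + 200 * ε * B) (2 * B) (fl.rotRows G k M) (H.rows k X) := by
  intro a b ha hb
  have h0 := fl.eps_nonneg
  obtain ⟨k1, k2⟩ := h k b (by omega) hb
  obtain ⟨l1, l2⟩ := h (k + 1) b hk hb
  obtain ⟨a1, a2⟩ := h a b ha hb
  have he0 := (norm_nonneg _).trans a1
  have hB0 := (norm_nonneg _).trans a2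
  have hεB := mul_nonneg h0 hB0
  simp only [rotRows, Rot.rows]
  by_cases hak : a = k ∨ a = k + 1
  · have e1 := fl.rotVec_err h1 hH hG k (fun a => M a b) hak
    have e2 := Rot.norm_vec_le hH k (fun a => M a b - X a b) hak
    rw [Rot.vec_sub] at e2
    have e3 := norm_sub_le_norm_sub_add_norm_sub (fl.rotVec G k (fun a => M a b) a)
      (H.vec k (fun a => M a b) a) (H.vec k (fun a => X a b) a)
    have e4 := Rot.norm_vec_le hH k (fun a => X a b) hak
    have e5 := norm_le_norm_add_norm_sub' (M k b) (X k b)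
    have e6 := norm_le_norm_add_norm_sub' (M (k + 1) b) (X (k + 1) b)
    have e7 : 40 * ε * (‖M k b‖ + ‖M (k + 1) b‖) ≤ 40 * ε * (4 * B) := by
      gcongr
      linarith
    exact ⟨by linarith, by linarith⟩
  · rw [fl.rotVec_of_ne G _ (by omega) (by omega), H.vec_of_ne _ (by omega) (by omega)]
    exact ⟨by linarith, by linarith⟩

theorem BlockNear.cols {fl : FloatArith ε} (h1 : ε ≤ 1 / 1000) {G H : Rot} (hH : H.IsUnitary)
    (hG : G.Near (20 * ε) H) {r s k : ℕ} (hk : k + 1 ≤ s) {e B : ℝ} {M X : ℕ → ℕ → ℂ}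
    (h : BlockNear r s e B M X) (he : e ≤ B) :
    BlockNear r s (2 * e + 200 * ε * B) (2 * B) (fl.rotCols G k M) (H.cols k X) := by
  intro a b ha hb
  have h0 := fl.eps_nonneg
  obtain ⟨k1, k2⟩ := h a k ha (by omega)
  obtain ⟨l1, l2⟩ := h a (k + 1) ha hk
  obtain ⟨a1, a2⟩ := h a b ha hb
  have he0 := (norm_nonneg _).trans a1
  have hB0 := (norm_nonneg _).trans a2
  have hεB := mul_nonneg h0 hB0
  have hc := hH.norm_c_le
  have hs := hH.norm_s_le
  have hc' : ‖star H.c‖ ≤ 1 := by rwa [norm_star]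
  have hs' : ‖star H.s‖ ≤ 1 := by rwa [norm_star]
  have e5 := norm_le_norm_add_norm_sub' (M a k) (X a k)
  have e6 := norm_le_norm_add_norm_sub' (M a (k + 1)) (X a (k + 1))
  have e7 : 40 * ε * (‖M a k‖ + ‖M a (k + 1)‖) ≤ 40 * ε * (4 * B) := by
    gcongr
    linarith
  simp only [rotCols, Rot.cols]
  split_ifs with hbk hbk'
  · have e1 := (fl.lin_add_err h1 hG.1 hG.2 hc hs (M a k) (M a (k + 1))).2.1
    have e2 := norm_mul_add_mul_le (x := M a k - X a k) (y := M a (k + 1) - X a (k + 1)) hc hs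
    have e3 := norm_add_le (fl.cadd (fl.cmul (M a k) G.c) (fl.cmul (M a (k + 1)) G.s) -
      (M a k * H.c + M a (k + 1) * H.s))
      ((M a k - X a k) * H.c + (M a (k + 1) - X a (k + 1)) * H.s)
    have e4 := norm_mul_add_mul_le (x := X a k) (y := X a (k + 1)) hc hs
    refine ⟨?_, by linarith⟩
    refine le_trans (le_of_eq (congrArg _ ?_)) (e3.trans (by linarith))
    ring
  · have e1 := (fl.lin_add_err h1 hG.star_c hG.star_s hc' hs' (M a (k + 1)) (M a k)).2.2.2
    have e2 := norm_mul_sub_mul_le (x := M a (k + 1) - X a (k + 1)) (y := M a k - X a k) hc' hs'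
    have e3 := norm_add_le
      (fl.csub (fl.cmul (M a (k + 1)) (star G.c)) (fl.cmul (M a k) (star G.s)) -
      (M a (k + 1) * star H.c - M a k * star H.s))
      ((M a (k + 1) - X a (k + 1)) * star H.c - (M a k - X a k) * star H.s)
    have e4 := norm_mul_sub_mul_le (x := X a (k + 1)) (y := X a k) hc' hs'
    refine ⟨?_, by linarith⟩
    refine le_trans (le_of_eq (congrArg _ ?_)) (e3.trans (by linarith))
    ring
  · exact ⟨by linarith, by linarith⟩

end FloatArith

/-! ### One chasing step -/

/-- The entries on and below the diagonal of the Hessenberg matrix with generators `g`, carrying a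
bulge with entries `(p + 2, p)`, `(p + 3, p)` and `(p + 3, p + 1)`. -/
def lowEntry (g : Gen) (p : ℕ) (b : FloatArith.Bulge₂) : ℕ → ℕ → ℂ := fun i j =>
  if i = j then g.d j
  else if i = j + 1 then g.β j
  else if i = j + 2 ∧ j = p then b.b₁
  else if i = j + 3 ∧ j = p then b.b₂
  else if i = j + 2 ∧ j = p + 1 then b.b₃
  else 0

/-- The bound `B` for the entries of a represented matrix and for the products of the entries of
`u` and `v`, below the diagonal and in the first `w` superdiagonals. -/
structure Bdd (n w : ℕ) (B : ℝ) (L : ℕ → ℕ → ℂ) (u v : ℕ → ℂ) : Prop where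
  prod : ∀ a b, a < n → b < n → b ≤ a + w → ‖u a‖ * ‖v b‖ ≤ B
  low : ∀ a b, b ≤ a → a < n → ‖L a b‖ ≤ 2 * B

theorem Bdd.upper {n w : ℕ} {B : ℝ} {L : ℕ → ℕ → ℂ} {u v : ℕ → ℂ} (h : Bdd n w B L u v) {a b : ℕ}
    (hab : a < b) (hb : b < n) (hw : b ≤ a + w) : ‖repA L u v a b‖ ≤ 4 * B := by
  rw [repA_of_lt L u v hab]
  have e1 := h.low b a hab.le hb
  have e2 := h.prod b a hb (by omega) (by omega)
  have e3 := h.prod a b (by omega) hb hw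
  refine (norm_add_le _ _).trans ?_
  have e4 := norm_sub_le (star (L b a)) (star (u b) * v a)
  simp only [norm_mul, norm_star] at *
  linarith

theorem Rot.rows_shift (H : Rot) (k i : ℕ) (X : ℕ → ℕ → ℂ) :
    H.rows k (fun a b => X (i + a) (i + b)) = fun a b => H.rows (i + k) X (i + a) (i + b) := by
  ext a b
  simp only [Rot.rows, Rot.vec, Nat.add_left_cancel_iff, add_assoc]

theorem Rot.cols_shift (H : Rot) (k i : ℕ) (X : ℕ → ℕ → ℂ) :
    H.cols k (fun a b => X (i + a) (i + b)) = fun a b => H.cols (i + k) X (i + a) (i + b) := by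
  ext a b
  simp only [Rot.cols, Nat.add_left_cancel_iff, add_assoc]

theorem Rot.vec_congr (H : Rot) {k i : ℕ} {w z : ℕ → ℂ} (h : w k = z k)
    (h' : w (k + 1) = z (k + 1)) (hi : w i = z i) : H.vec k w i = H.vec k z i := by
  simp only [Rot.vec, h, h', hi]

theorem Rot.cols_of_ne (H : Rot) {k j : ℕ} (X : ℕ → ℕ → ℂ) (i : ℕ) (h : j ≠ k) (h' : j ≠ k + 1) :
    H.cols k X i j = X i j := by
  simp [Rot.cols, h, h']

theorem Rot.cols_eq_zero (H : Rot) {k j : ℕ} {X : ℕ → ℕ → ℂ} {i : ℕ} (h : X i k = 0)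
    (h' : X i (k + 1) = 0) (hj : X i j = 0) : H.cols k X i j = 0 := by
  simp only [Rot.cols, h, h', hj]
  split_ifs <;> simp

theorem Rot.vec_eq_zero (H : Rot) {k i : ℕ} {w : ℕ → ℂ} (h : w k = 0)
    (h' : w (k + 1) = 0) (hi : w i = 0) : H.vec k w i = 0 := by
  simp only [Rot.vec, h, h', hi]
  split_ifs <;> simp

namespace FloatArith

variable {ε : ℝ} (fl : FloatArith ε)

theorem superdiag_err (h1 : ε ≤ 1 / 1000) {n w : ℕ} (hw : 1 ≤ w) {B : ℝ} {L : ℕ → ℕ → ℂ} {g : Gen}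
    (hb : Bdd n w B L g.u g.v) {i : ℕ} (hi : i + 1 < n) (hL : L (i + 1) i = g.β i) :
    ‖fl.superdiag g i - repA L g.u g.v i (i + 1)‖ ≤ 80 * ε * B := by
  rw [repA_of_lt _ _ _ (Nat.lt_succ_self i), hL]
  refine (fl.upper_entry_err (by linarith) _ _ _ _ _).trans ?_
  have e1 := hb.low (i + 1) i (by omega) hi
  have e2 := hb.prod (i + 1) i hi (by omega) (by omega)
  have e3 := hb.prod i (i + 1) (by omega) hi (by omega)
  rw [hL] at e1
  simp only [norm_star]
  have h0 := fl.eps_nonneg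
  have : ‖g.β i‖ + ‖g.u (i + 1)‖ * ‖g.v i‖ + ‖g.u i‖ * ‖g.v (i + 1)‖ ≤ 4 * B := by linarith
  have := mul_le_mul_of_nonneg_left this (show 0 ≤ 20 * ε by linarith)
  linarith

theorem superdiag₂_err (h1 : ε ≤ 1 / 1000) {n w : ℕ} (hw : 2 ≤ w) {B : ℝ} {L : ℕ → ℕ → ℂ}
    {g : Gen} (hb : Bdd n w B L g.u g.v) {i : ℕ} (hi : i + 2 < n) :
    ‖fl.superdiag₂ g i (L (i + 2) i) - repA L g.u g.v i (i + 2)‖ ≤ 80 * ε * B := by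
  rw [repA_of_lt _ _ _ (show i < i + 2 by omega)]
  refine (fl.upper_entry_err (by linarith) _ _ _ _ _).trans ?_
  have e1 := hb.low (i + 2) i (by omega) hi
  have e2 := hb.prod (i + 2) i hi (by omega) (by omega)
  have e3 := hb.prod i (i + 2) (by omega) hi (by omega)
  simp only [norm_star]
  have h0 := fl.eps_nonneg
  have : ‖L (i + 2) i‖ + ‖g.u (i + 2)‖ * ‖g.v i‖ + ‖g.u i‖ * ‖g.v (i + 2)‖ ≤ 4 * B := by linarith
  have := mul_le_mul_of_nonneg_left this (show 0 ≤ 20 * ε by linarith)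
  linarith

/-- The block that a single-shift step works on. Its entries on and below the diagonal are exact;
only the superdiagonal entry is recovered from the generators in floating point arithmetic. At the
end of the matrix its last row lies outside, where the generators vanish by `hend`. -/
theorem block₁_near (h1 : ε ≤ 1 / 1000) {n w : ℕ} (hw : 1 ≤ w) {B : ℝ} {L : ℕ → ℕ → ℂ} {g : Gen}
    (hb : Bdd n w B L g.u g.v) {i : ℕ} (hi : i + 1 < n) (hend : i + 2 < n ∨ g.β (i + 1) = 0)
    (hL : ∀ a b, i ≤ b → b ≤ a → L a b = lowEntry g i ⟨0, 0, 0⟩ a b) :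
    BlockNear 2 1 (80 * ε * B) (4 * B) (fl.block₁ g i)
      (fun a b => repA L g.u g.v (i + a) (i + b)) := by
  have h0 := fl.eps_nonneg
  have hB : 0 ≤ B := (by positivity : (0 : ℝ) ≤ ‖g.u i‖ * ‖g.v i‖).trans
    (hb.prod i i (by omega) (by omega) (by omega))
  have hεB : 0 ≤ 80 * ε * B := by positivity
  have exact_entry : ∀ a b : ℕ, b ≤ a → ∀ z : ℂ, lowEntry g i ⟨0, 0, 0⟩ (i + a) (i + b) = z →
      (i + a < n ∨ z = 0) →
      ‖z - repA L g.u g.v (i + a) (i + b)‖ ≤ 80 * ε * B ∧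
        ‖repA L g.u g.v (i + a) (i + b)‖ ≤ 4 * B := by
    intro a b hba z hz hlt
    have e : repA L g.u g.v (i + a) (i + b) = z := by
      rw [repA_of_le _ _ _ (by omega), hL _ _ (by omega) (by omega), hz]
    rw [e, sub_self, norm_zero]
    refine ⟨hεB, ?_⟩
    rcases hlt with hlt | rfl
    · have := hb.low (i + a) (i + b) (by omega) hlt
      rw [hL _ _ (by omega) (by omega), hz] at this
      linarith
    · rw [norm_zero]
      linarith
  intro a b ha hb'
  have hβ : L (i + 1) i = g.β i := by
    rw [hL _ _ le_rfl (by omega)]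
    simp [lowEntry]
  interval_cases b
  · interval_cases a
    · exact exact_entry 0 0 le_rfl _ (by simp [lowEntry, block₁]) (Or.inl (by omega))
    · exact exact_entry 1 0 (by omega) _ (by simp [lowEntry, block₁]) (Or.inl (by omega))
    · exact exact_entry 2 0 (by omega) _ (by simp [lowEntry, block₁]) (Or.inr rfl)
  · interval_cases a
    · exact ⟨fl.superdiag_err h1 hw hb hi hβ, hb.upper (by omega) hi (by omega)⟩
    · exact exact_entry 1 1 le_rfl _ (by simp [lowEntry, block₁]) (Or.inl (by omega))
    · exact exact_entry 2 1 (by omega) _ (by simp [lowEntry, block₁]) hend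

/-- The block that a double-shift step works on. -/
theorem block₂_near (h1 : ε ≤ 1 / 1000) {n w : ℕ} (hw : 2 ≤ w) {B : ℝ} {L : ℕ → ℕ → ℂ} {g : Gen}
    {x : ℂ} (hb : Bdd n w B L g.u g.v) {i : ℕ} (hi : i + 2 < n)
    (hend : i + 3 < n ∨ g.β (i + 2) = 0)
    (hL : ∀ a b, i ≤ b → b ≤ a → L a b = lowEntry g i ⟨x, 0, 0⟩ a b) :
    BlockNear 3 2 (80 * ε * B) (4 * B) (fl.block₂ g i x)
      (fun a b => repA L g.u g.v (i + a) (i + b)) := by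
  have h0 := fl.eps_nonneg
  have hB : 0 ≤ B := (by positivity : (0 : ℝ) ≤ ‖g.u i‖ * ‖g.v i‖).trans
    (hb.prod i i (by omega) (by omega) (by omega))
  have hεB : 0 ≤ 80 * ε * B := by positivity
  have exact_entry : ∀ a b : ℕ, b ≤ a → ∀ z : ℂ, lowEntry g i ⟨x, 0, 0⟩ (i + a) (i + b) = z →
      (i + a < n ∨ z = 0) →
      ‖z - repA L g.u g.v (i + a) (i + b)‖ ≤ 80 * ε * B ∧
        ‖repA L g.u g.v (i + a) (i + b)‖ ≤ 4 * B := by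
    intro a b hba z hz hlt
    have e : repA L g.u g.v (i + a) (i + b) = z := by
      rw [repA_of_le _ _ _ (by omega), hL _ _ (by omega) (by omega), hz]
    rw [e, sub_self, norm_zero]
    refine ⟨hεB, ?_⟩
    rcases hlt with hlt | rfl
    · have := hb.low (i + a) (i + b) (by omega) hlt
      rw [hL _ _ (by omega) (by omega), hz] at this
      linarith
    · rw [norm_zero]
      linarith
  intro a b ha hb'
  have hβ : L (i + 1) i = g.β i := by
    rw [hL _ _ le_rfl (by omega)]
    simp [lowEntry]
  have hβ' : L (i + 1 + 1) (i + 1) = g.β (i + 1) := by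
    rw [hL _ _ (by omega) (by omega)]
    simp [lowEntry]
  have hx : L (i + 2) i = x := by
    rw [hL _ _ le_rfl (by omega)]
    simp [lowEntry]
  interval_cases b
  · interval_cases a
    · exact exact_entry 0 0 le_rfl _ (by simp [lowEntry, block₂]) (Or.inl (by omega))
    · exact exact_entry 1 0 (by omega) _ (by simp [lowEntry, block₂]) (Or.inl (by omega))
    · exact exact_entry 2 0 (by omega) _ (by simp [lowEntry, block₂]) (Or.inl (by omega))
    · exact exact_entry 3 0 (by omega) _ (by simp [lowEntry, block₂]) (Or.inr rfl)
  · interval_cases a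
    · exact ⟨fl.superdiag_err h1 (by omega) hb (by omega) hβ,
        hb.upper (by omega) (by omega) (by omega)⟩
    · exact exact_entry 1 1 le_rfl _ (by simp [lowEntry, block₂]) (Or.inl (by omega))
    · exact exact_entry 2 1 (by omega) _ (by simp [lowEntry, block₂]) (Or.inl (by omega))
    · exact exact_entry 3 1 (by omega) _ (by simp [lowEntry, block₂]) (Or.inr rfl)
  · interval_cases a
    · have := fl.superdiag₂_err h1 hw hb hi
      rw [hx] at this
      exact ⟨this, hb.upper (by omega) hi (by omega)⟩
    · exact ⟨fl.superdiag_err h1 (by omega) hb (i := i + 1) (by omega) hβ',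
        hb.upper (by omega) (by omega) (by omega)⟩
    · exact exact_entry 2 2 le_rfl _ (by simp [lowEntry, block₂]) (Or.inl (by omega))
    · exact exact_entry 3 2 (by omega) _ (by simp [lowEntry, block₂]) hend

/-- The entries on and below the diagonal after a step of the single-shift chasing. The columns to
the left of the block are not computed: the step that annihilates the old bulge there stores the
computed norm and zero, and the hypothesis `hleft` says that this is nearly the exact image. -/
theorem chase₁_lower (h1 : ε ≤ 1 / 1000) {n w : ℕ} (hw : 1 ≤ w) {B e : ℝ} {L : ℕ → ℕ → ℂ}
    {g : Gen} {G H : Rot} (hH : H.IsUnitary) (hG : G.Near (20 * ε) H)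
    (hb : Bdd n w B L g.u g.v) {i : ℕ} (hi : i + 1 < n) (hend : i + 2 < n ∨ g.β (i + 1) = 0)
    (hL : ∀ a b, i ≤ b → b ≤ a → L a b = lowEntry g i ⟨0, 0, 0⟩ a b)
    (hleft : ∀ a b, b < i → b ≤ a → a < n →
      ‖lowEntry g 0 ⟨0, 0, 0⟩ a b - H.vec i (fun x => L x b) a‖ ≤ e)
    (he : 30000 * ε * B ≤ e) {a b : ℕ} (hba : b ≤ a) (ha : a < n) :
    ‖lowEntry (fl.chase₁ G i g).1 i ⟨(fl.chase₁ G i g).2, 0, 0⟩ a b -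
      H.cols i (H.rows i (repA L g.u g.v)) a b‖ ≤ e := by
  have h0 := fl.eps_nonneg
  have hB : 0 ≤ B := (by positivity : (0 : ℝ) ≤ ‖g.u i‖ * ‖g.v i‖).trans
    (hb.prod i i (by omega) (by omega) (by omega))
  have hεB : 0 ≤ ε * B := by positivity
  have he0 : 0 ≤ e := by linarith
  have hM := fl.block₁_near h1 hw hb hi hend hL
  replace hM := hM.rows (fl := fl) h1 hH hG (k := 0) (by norm_num) (by nlinarith)
  replace hM := hM.cols (fl := fl) h1 hH hG (k := 0) (by norm_num) (by nlinarith)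
  rw [Rot.rows_shift, Rot.cols_shift, add_zero] at hM
  rcases lt_or_ge b i with hbi | hbi
  · have e1 : lowEntry (fl.chase₁ G i g).1 i ⟨(fl.chase₁ G i g).2, 0, 0⟩ a b =
        lowEntry g 0 ⟨0, 0, 0⟩ a b := by
      simp [lowEntry, chase₁, Function.update, hbi.ne, (show b ≠ i + 1 by omega)]
    rw [e1, Rot.cols_of_ne _ _ _ (by omega) (by omega)]
    have e2 : H.rows i (repA L g.u g.v) a b = H.vec i (fun x => L x b) a :=
      H.vec_congr (repA_of_le _ _ _ (by omega)) (repA_of_le _ _ _ (by omega))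
        (repA_of_le _ _ _ hba)
    rw [e2]
    exact hleft a b hbi hba ha
  rcases lt_or_ge (i + 1) b with hbi' | hbi'
  · have e1 : lowEntry (fl.chase₁ G i g).1 i ⟨(fl.chase₁ G i g).2, 0, 0⟩ a b = L a b := by
      rw [hL a b hbi hba]
      simp [lowEntry, chase₁, Function.update, hbi'.ne', (show b ≠ i by omega)]
    rw [e1, Rot.cols_of_ne _ _ _ (by omega) (by omega), Rot.rows,
      Rot.vec_of_ne _ _ (by omega) (by omega), repA_of_le _ _ _ hba, sub_self, norm_zero]
    exact he0
  rcases lt_or_ge (i + 2) a with hai | hai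
  · have e1 : lowEntry (fl.chase₁ G i g).1 i ⟨(fl.chase₁ G i g).2, 0, 0⟩ a b = 0 := by
      simp [lowEntry, (show a ≠ b by omega), (show a ≠ b + 1 by omega)]
      omega
    have e2 : ∀ c, i ≤ c → c ≤ i + 1 → H.rows i (repA L g.u g.v) a c = 0 := by
      intro c hc hc'
      rw [Rot.rows, Rot.vec_of_ne _ _ (by omega) (by omega), repA_of_le _ _ _ (by omega),
        hL _ _ hc (by omega)]
      simp [lowEntry, (show a ≠ c by omega), (show a ≠ c + 1 by omega)]
    rw [e1, Rot.cols_eq_zero _ (e2 i (by omega) (by omega)) (e2 (i + 1) (by omega) (by omega))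
      (e2 b hbi hbi'), sub_self, norm_zero]
    exact he0
  obtain ⟨a', rfl⟩ := Nat.exists_eq_add_of_le (hbi.trans hba)
  obtain ⟨b', rfl⟩ := Nat.exists_eq_add_of_le hbi
  have hb1 : b' ≤ 1 := by omega
  have ha2 : a' ≤ 2 := by omega
  have hM' := (hM a' b' ha2 hb1).1
  have e1 : lowEntry (fl.chase₁ G i g).1 i ⟨(fl.chase₁ G i g).2, 0, 0⟩ (i + a') (i + b') =
      fl.rotCols G 0 (fl.rotRows G 0 (fl.block₁ g i)) a' b' := by
    have : b' ≤ a' := by omega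
    interval_cases b' <;> interval_cases a' <;> simp [lowEntry, chase₁, Function.update]
  rw [e1]
  linarith

/-- The entries on and below the diagonal after a step of the double-shift chasing, with the
hypothesis `hleft` as in `chase₁_lower`. -/
theorem chase₂_lower (h1 : ε ≤ 1 / 1000) {n w : ℕ} (hw : 2 ≤ w) {B e : ℝ} {L : ℕ → ℕ → ℂ}
    {g : Gen} {x : ℂ} {G₁ G₂ H₁ H₂ : Rot} (hH₁ : H₁.IsUnitary) (hG₁ : G₁.Near (20 * ε) H₁)
    (hH₂ : H₂.IsUnitary) (hG₂ : G₂.Near (20 * ε) H₂)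
    (hb : Bdd n w B L g.u g.v) {i : ℕ} (hi : i + 2 < n) (hend : i + 3 < n ∨ g.β (i + 2) = 0)
    (hL : ∀ a b, i ≤ b → b ≤ a → L a b = lowEntry g i ⟨x, 0, 0⟩ a b)
    (hleft : ∀ a b, b < i → b ≤ a → a < n →
      ‖lowEntry g 0 ⟨0, 0, 0⟩ a b - H₁.vec i (H₂.vec (i + 1) (fun x => L x b)) a‖ ≤ e)
    (he : 30000 * ε * B ≤ e) {a b : ℕ} (hba : b ≤ a) (ha : a < n) :
    ‖lowEntry (fl.chase₂ G₂ G₁ i x g).1 i (fl.chase₂ G₂ G₁ i x g).2.1 a b -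
      H₁.cols i (H₂.cols (i + 1) (H₁.rows i (H₂.rows (i + 1) (repA L g.u g.v)))) a b‖ ≤ e := by
  have h0 := fl.eps_nonneg
  have hB : 0 ≤ B := (by positivity : (0 : ℝ) ≤ ‖g.u i‖ * ‖g.v i‖).trans
    (hb.prod i i (by omega) (by omega) (by omega))
  have hεB : 0 ≤ ε * B := by positivity
  have he0 : 0 ≤ e := by linarith
  have hM := fl.block₂_near h1 hw hb hi hend hL
  replace hM := hM.rows (fl := fl) h1 hH₂ hG₂ (k := 1) (by norm_num) (by nlinarith)
  replace hM := hM.rows (fl := fl) h1 hH₁ hG₁ (k := 0) (by norm_num) (by nlinarith)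
  replace hM := hM.cols (fl := fl) h1 hH₂ hG₂ (k := 1) (by norm_num) (by nlinarith)
  replace hM := hM.cols (fl := fl) h1 hH₁ hG₁ (k := 0) (by norm_num) (by nlinarith)
  rw [Rot.rows_shift, Rot.rows_shift, Rot.cols_shift, Rot.cols_shift, add_zero] at hM
  rcases lt_or_ge b i with hbi | hbi
  · have e1 : lowEntry (fl.chase₂ G₂ G₁ i x g).1 i (fl.chase₂ G₂ G₁ i x g).2.1 a b =
        lowEntry g 0 ⟨0, 0, 0⟩ a b := by
      simp [lowEntry, chase₂, Function.update, hbi.ne, (show b ≠ i + 1 by omega),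
        (show b ≠ i + 2 by omega)]
    rw [e1, Rot.cols_of_ne _ _ _ (by omega) (by omega), Rot.cols_of_ne _ _ _ (by omega) (by omega)]
    have e2 : ∀ c, i ≤ c ∨ c = a → H₂.rows (i + 1) (repA L g.u g.v) c b =
        H₂.vec (i + 1) (fun x => L x b) c := fun c hc =>
      H₂.vec_congr (repA_of_le _ _ _ (by omega)) (repA_of_le _ _ _ (by omega))
        (repA_of_le _ _ _ (by omega))
    have e3 : H₁.rows i (H₂.rows (i + 1) (repA L g.u g.v)) a b =
        H₁.vec i (H₂.vec (i + 1) (fun x => L x b)) a :=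
      H₁.vec_congr (e2 i (by omega)) (e2 (i + 1) (by omega)) (e2 a (by omega))
    rw [e3]
    exact hleft a b hbi hba ha
  rcases lt_or_ge (i + 2) b with hbi' | hbi'
  · have e1 : lowEntry (fl.chase₂ G₂ G₁ i x g).1 i (fl.chase₂ G₂ G₁ i x g).2.1 a b = L a b := by
      rw [hL a b hbi hba]
      simp [lowEntry, chase₂, Function.update, hbi'.ne', (show b ≠ i by omega),
        (show b ≠ i + 1 by omega)]
    rw [e1, Rot.cols_of_ne _ _ _ (by omega) (by omega), Rot.cols_of_ne _ _ _ (by omega) (by omega),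
      Rot.rows, Rot.vec_of_ne _ _ (by omega) (by omega), Rot.rows,
      Rot.vec_of_ne _ _ (by omega) (by omega), repA_of_le _ _ _ hba, sub_self, norm_zero]
    exact he0
  rcases lt_or_ge (i + 3) a with hai | hai
  · have e1 : lowEntry (fl.chase₂ G₂ G₁ i x g).1 i (fl.chase₂ G₂ G₁ i x g).2.1 a b = 0 := by
      simp only [lowEntry]
      rw [if_neg (by omega), if_neg (by omega), if_neg (by omega), if_neg (by omega),
        if_neg (by omega)]
    have e2 : ∀ c, i ≤ c → c ≤ i + 2 →
        H₁.rows i (H₂.rows (i + 1) (repA L g.u g.v)) a c = 0 := by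
      intro c hc hc'
      rw [Rot.rows, Rot.vec_of_ne _ _ (by omega) (by omega), Rot.rows,
        Rot.vec_of_ne _ _ (by omega) (by omega), repA_of_le _ _ _ (by omega),
        hL _ _ hc (by omega)]
      simp only [lowEntry]
      rw [if_neg (by omega), if_neg (by omega), if_neg (by omega), if_neg (by omega),
        if_neg (by omega)]
    have e3 : ∀ c, i ≤ c → c ≤ i + 2 →
        H₂.cols (i + 1) (H₁.rows i (H₂.rows (i + 1) (repA L g.u g.v))) a c = 0 := fun c hc hc' =>
      Rot.cols_eq_zero _ (e2 (i + 1) (by omega) (by omega)) (e2 (i + 2) (by omega) (by omega))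
        (e2 c hc hc')
    rw [e1, Rot.cols_eq_zero _ (e3 i (by omega) (by omega)) (e3 (i + 1) (by omega) (by omega))
      (e3 b hbi hbi'), sub_self, norm_zero]
    exact he0
  obtain ⟨a', rfl⟩ := Nat.exists_eq_add_of_le (hbi.trans hba)
  obtain ⟨b', rfl⟩ := Nat.exists_eq_add_of_le hbi
  have hb1 : b' ≤ 2 := by omega
  have ha2 : a' ≤ 3 := by omega
  have hM' := (hM a' b' ha2 hb1).1
  have e1 : lowEntry (fl.chase₂ G₂ G₁ i x g).1 i (fl.chase₂ G₂ G₁ i x g).2.1 (i + a') (i + b') =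
      fl.rotCols G₁ 0 (fl.rotCols G₂ 1
        (fl.rotRows G₁ 0 (fl.rotRows G₂ 1 (fl.block₂ g i x)))) a' b' := by
    have : b' ≤ a' := by omega
    interval_cases b' <;> interval_cases a' <;> simp [lowEntry, chase₂, Function.update]
  rw [e1]
  linarith

/-- A rotation does not create a bulge below the last row of a decoupled block. -/
theorem chase₁_end (G : Rot) (i : ℕ) (g : Gen) (h : g.β (i + 1) = 0) :
    (fl.chase₁ G i g).1.β (i + 1) = 0 ∧ (fl.chase₁ G i g).2 = 0 := by
  simp [chase₁, rotCols, rotRows, rotVec, block₁, h, cmul_zero_left, cadd_zero_zero,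
    csub_zero_zero]

theorem chase₂_end (G₂ G₁ : Rot) (i : ℕ) (x : ℂ) (g : Gen) (h : g.β (i + 2) = 0) :
    (fl.chase₂ G₂ G₁ i x g).1.β (i + 2) = 0 ∧ (fl.chase₂ G₂ G₁ i x g).2.1.b₂ = 0 ∧
      (fl.chase₂ G₂ G₁ i x g).2.1.b₃ = 0 := by
  simp [chase₂, rotCols, rotRows, rotVec, block₂, h, cmul_zero_left, cadd_zero_zero,
    csub_zero_zero]

theorem chase₁_β_of_ne (G : Rot) {i k : ℕ} (g : Gen) (h : k ≠ i) (h' : k ≠ i + 1) :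
    (fl.chase₁ G i g).1.β k = g.β k := by
  simp [chase₁, Function.update, h, h']

theorem chase₂_β_of_ne (G₂ G₁ : Rot) {i k : ℕ} (x : ℂ) (g : Gen) (h : k ≠ i) (h' : k ≠ i + 1)
    (h'' : k ≠ i + 2) : (fl.chase₂ G₂ G₁ i x g).1.β k = g.β k := by
  simp [chase₂, Function.update, h, h', h'']

end FloatArith

/-! ### Sweeps -/

/-- The products of entries of `u` and `v` near the diagonal, as they enter `γ_j`, are at most
`Γ`. -/
def NearProd (n j : ℕ) (Γ : ℝ) (u v : ℕ → ℂ) : Prop :=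
  ∀ a b, a < n → b < n → a ≤ b + j + 1 → b ≤ a + j → ‖u a‖ * ‖v b‖ ≤ Γ

theorem NearProd.mono {n j j' : ℕ} {Γ : ℝ} {u v : ℕ → ℂ} (h : NearProd n j Γ u v) (hj : j' ≤ j) :
    NearProd n j' Γ u v := fun a b ha hb h1 h2 => h a b ha hb (by omega) (by omega)

section Budget

open scoped Matrix Matrix.Norms.L2Operator

/-- The sizes that keep the accumulated errors under control: `B` bounds all the relevant products
`‖u a‖ * ‖v b‖`, and `ω` is the local error of one of at most `M` operations. -/
structure ErrorBudget {n : ℕ} (F₀ : Matrix (Fin n) (Fin n) ℂ) (M : ℕ) (ε Γ B ω : ℝ) : Prop where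
  eps_le : ε ≤ 1 / 1000
  one_le : 1 ≤ B
  le_B : ‖F₀‖ + 1 + Γ ≤ B
  le_ω : 40000 * ε * B ≤ ω
  nonneg : 0 ≤ ω
  Γ_nonneg : 0 ≤ Γ
  mul_le : M * ω ≤ 1
  sq_le : 3 * n ^ 2 * M ^ 2 * ω ≤ 1

/-- The state of the iteration: the represented matrix and the vectors `u`, `v` carry the errors of
at most `m` operations. -/
def StateTracks {n : ℕ} (F₀ : Matrix (Fin n) (Fin n) ℂ) (u₀ v₀ : Fin n → ℂ) (M : ℕ) (ω : ℝ) (m : ℕ)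
    (L : ℕ → ℕ → ℂ) (u v : ℕ → ℂ) : Prop :=
  Tracks F₀ u₀ v₀ M ω m (trunc n (repF L u v)) (truncV n u) (truncV n v)

variable {n : ℕ} {F₀ : Matrix (Fin n) (Fin n) ℂ} {u₀ v₀ : Fin n → ℂ} {M : ℕ} {ε Γ B ω : ℝ}

/-- Outside the band of `L` a product `u a * conj (v b)` is, up to its sign, an entry of `F`, hence
bounded by the norm of `F₀`, however large `u` and `v` are. -/
theorem StateTracks.bdd (hE : ErrorBudget F₀ M ε Γ B ω) {m j : ℕ} {L : ℕ → ℕ → ℂ} {u v : ℕ → ℂ}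
    (h : StateTracks F₀ u₀ v₀ M ω m L u v) (hm : m ≤ M) (hΓ : NearProd n j Γ u v)
    (hL : ∀ a b, b + j + 1 < a → L a b = 0) : Bdd n j B L u v := by
  have hF : ∀ a b, b ≤ a → a < n → ‖L a b - u a * star (v b)‖ ≤ ‖F₀‖ + 1 := by
    intro a b hba ha
    have := Tracks.norm_entry_le h hE.nonneg hm hE.sq_le ⟨a, ha⟩ ⟨b, by omega⟩
    simpa [trunc, repF, hba] using this
  have hB := hE.le_B
  have hΓ0 := hE.Γ_nonneg
  have hF0 := norm_nonneg F₀
  have hprod : ∀ a b, a < n → b < n → b ≤ a + j → ‖u a‖ * ‖v b‖ ≤ B ∧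
      (b ≤ a → ‖u a‖ * ‖v b‖ ≤ Γ ∨ L a b = 0) := by
    intro a b ha hb hab
    -- in the band `NearProd` applies; below it `L a b = 0`, so the product is an entry of `F`
    by_cases hn : a ≤ b + j + 1
    · have := hΓ a b ha hb hn hab
      exact ⟨by linarith, fun _ => Or.inl this⟩
    · have e := hL a b (by omega)
      have := hF a b (by omega) ha
      rw [e, zero_sub, norm_neg, norm_mul, norm_star] at this
      exact ⟨by linarith, fun _ => Or.inr e⟩
  refine ⟨fun a b ha hb hab => (hprod a b ha hb hab).1, fun a b hba ha => ?_⟩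
  rcases (hprod a b ha (by omega) (by omega)).2 hba with h' | h'
  · have e1 := hF a b hba ha
    have e2 := norm_le_norm_add_norm_sub' (L a b) (u a * star (v b))
    rw [norm_mul, norm_star] at e2
    have := hE.one_le
    linarith
  · rw [h', norm_zero]
    have := hE.one_le
    linarith

theorem lowEntry_no_bulge (g : Gen) (p q : ℕ) :
    lowEntry g p ⟨0, 0, 0⟩ = lowEntry g q ⟨0, 0, 0⟩ := by
  ext i j
  simp [lowEntry]

theorem lowEntry_band₁ (g : Gen) (p : ℕ) (x : ℂ) (a b : ℕ) (h : b + 1 + 1 < a) :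
    lowEntry g p ⟨x, 0, 0⟩ a b = 0 := by
  simp [lowEntry, (show a ≠ b by omega), (show a ≠ b + 1 by omega), (show a ≠ b + 2 by omega)]

theorem lowEntry_band₂ (g : Gen) (p : ℕ) (x : FloatArith.Bulge₂) (a b : ℕ) (h : b + 2 + 1 < a) :
    lowEntry g p x a b = 0 := by
  simp [lowEntry, (show a ≠ b by omega), (show a ≠ b + 1 by omega), (show a ≠ b + 2 by omega),
    (show a ≠ b + 3 by omega)]

theorem lowEntry_diag (g : Gen) (p : ℕ) (x : FloatArith.Bulge₂) (i : ℕ) :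
    lowEntry g p x i i = g.d i := by
  simp [lowEntry]

theorem lowEntry_subdiag (g : Gen) (p : ℕ) (x : FloatArith.Bulge₂) (i : ℕ) :
    lowEntry g p x (i + 1) i = g.β i := by
  simp [lowEntry]

theorem lowEntry_b₁ (g : Gen) (p : ℕ) (x : FloatArith.Bulge₂) :
    lowEntry g p x (p + 2) p = x.b₁ := by
  simp [lowEntry]

theorem lowEntry_b₂ (g : Gen) (p : ℕ) (x : FloatArith.Bulge₂) :
    lowEntry g p x (p + 3) p = x.b₂ := by
  simp [lowEntry]

theorem lowEntry_of_lt (g : Gen) {p a c : ℕ} (x : FloatArith.Bulge₂) (h : c < p) (h' : c + 1 < a) :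
    lowEntry g p x a c = 0 := by
  simp [lowEntry, (show a ≠ c by omega), (show a ≠ c + 1 by omega), h.ne, (show c ≠ p + 1 by omega)]

theorem lowEntry_zero_bulge (g : Gen) (p : ℕ) {a c : ℕ} (h' : c + 1 < a) :
    lowEntry g p ⟨0, 0, 0⟩ a c = 0 := by
  simp [lowEntry, (show a ≠ c by omega), (show a ≠ c + 1 by omega)]

variable {fl : FloatArith ε}

theorem StateTracks.chase₁ (hE : ErrorBudget F₀ M ε Γ B ω) {m w : ℕ} {L : ℕ → ℕ → ℂ} {g : Gen}
    (h : StateTracks F₀ u₀ v₀ M ω m L g.u g.v) (hm : m + 1 ≤ M) (hw : 1 ≤ w)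
    (hb : Bdd n w B L g.u g.v) {G H : Rot} (hH : H.IsUnitary) (hG : G.Near (20 * ε) H)
    {i : ℕ} (hi : i + 1 < n) (hend : i + 2 < n ∨ g.β (i + 1) = 0)
    (hL : ∀ a b, i ≤ b → b ≤ a → L a b = lowEntry g i ⟨0, 0, 0⟩ a b)
    (hleft : ∀ a b, b < i → b ≤ a → a < n →
      ‖lowEntry g 0 ⟨0, 0, 0⟩ a b - H.vec i (fun x => L x b) a‖ ≤ 30000 * ε * B) :
    StateTracks F₀ u₀ v₀ M ω (m + 1)
      (lowEntry (fl.chase₁ G i g).1 i ⟨(fl.chase₁ G i g).2, 0, 0⟩)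
      (fl.chase₁ G i g).1.u (fl.chase₁ G i g).1.v := by
  have h1 := hE.eps_le
  have h0 := fl.eps_nonneg
  have hB := hE.one_le
  have hω := hE.le_ω
  have hεB : 0 ≤ ε * B := by positivity
  have hεB' : ε ≤ ε * B := le_mul_of_one_le_right h0 hB
  refine Tracks.rotate (η := 200 * ε) (e := 30000 * ε * B) h hm hE.nonneg hE.mul_le
    (Rot.mat_mem hH hi) (T := fun X => H.cols i (H.rows i X)) (R := H.vec i) ?_ ?_
    (fl.rotVec_windowErr h1 hH hG i g.u) (fl.rotVec_windowErr h1 hH hG i g.v) (by linarith)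
    (by linarith) (by omega) (w := w) (by omega) hi (by linarith) hb.prod ?_ (by linarith)
    (by linarith)
  · intro X
    rw [trunc_cols H hi, trunc_rows H hi]
  · intro x
    rw [Rot.mat_mulVec H hi]
  · intro a b hba ha
    exact fl.chase₁_lower h1 hw hH hG hb hi hend hL hleft le_rfl hba ha

theorem StateTracks.chase₂ (hE : ErrorBudget F₀ M ε Γ B ω) {m w : ℕ} {L : ℕ → ℕ → ℂ} {g : Gen}
    {x : ℂ} (h : StateTracks F₀ u₀ v₀ M ω m L g.u g.v) (hm : m + 1 ≤ M) (hw : 2 ≤ w)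
    (hb : Bdd n w B L g.u g.v) {G₁ G₂ H₁ H₂ : Rot} (hH₁ : H₁.IsUnitary)
    (hG₁ : G₁.Near (20 * ε) H₁) (hH₂ : H₂.IsUnitary) (hG₂ : G₂.Near (20 * ε) H₂)
    {i : ℕ} (hi : i + 2 < n) (hend : i + 3 < n ∨ g.β (i + 2) = 0)
    (hL : ∀ a b, i ≤ b → b ≤ a → L a b = lowEntry g i ⟨x, 0, 0⟩ a b)
    (hleft : ∀ a b, b < i → b ≤ a → a < n →
      ‖lowEntry g 0 ⟨0, 0, 0⟩ a b - H₁.vec i (H₂.vec (i + 1) (fun x => L x b)) a‖ ≤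
        30000 * ε * B) :
    StateTracks F₀ u₀ v₀ M ω (m + 1)
      (lowEntry (fl.chase₂ G₂ G₁ i x g).1 i (fl.chase₂ G₂ G₁ i x g).2.1)
      (fl.chase₂ G₂ G₁ i x g).1.u (fl.chase₂ G₂ G₁ i x g).1.v := by
  have h1 := hE.eps_le
  have h0 := fl.eps_nonneg
  have hB := hE.one_le
  have hω := hE.le_ω
  have hεB : 0 ≤ ε * B := by positivity
  have hεB' : ε ≤ ε * B := le_mul_of_one_le_right h0 hB
  have hi' : i + 1 < n := by omega
  refine Tracks.rotate (η := 200 * ε) (e := 30000 * ε * B) h hm hE.nonneg hE.mul_le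
    (mul_mem (Rot.mat_mem hH₁ hi') (Rot.mat_mem hH₂ (k := i + 1) hi))
    (T := fun X => H₁.cols i (H₂.cols (i + 1) (H₁.rows i (H₂.rows (i + 1) X))))
    (R := fun z => H₁.vec i (H₂.vec (i + 1) z)) ?_ ?_
    (fl.rotVec_rotVec_windowErr h1 hH₁ hG₁ hH₂ hG₂ i g.u)
    (fl.rotVec_rotVec_windowErr h1 hH₁ hG₁ hH₂ hG₂ i g.v) (by linarith)
    (by linarith) (by omega) (w := w) (by omega) hi (by linarith) hb.prod ?_ (by linarith)
    (by linarith)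
  · intro X
    rw [trunc_cols H₁ hi', trunc_cols H₂ (k := i + 1) hi, trunc_rows H₁ hi',
      trunc_rows H₂ (k := i + 1) hi, Matrix.conjTranspose_mul]
    simp only [Matrix.mul_assoc]
  · intro z
    rw [← Matrix.mulVec_mulVec, Rot.mat_mulVec H₂ (k := i + 1) hi, Rot.mat_mulVec H₁ hi']
  · intro a b hba ha
    exact fl.chase₂_lower h1 hw hH₁ hG₁ hH₂ hG₂ hb hi hend hL hleft le_rfl hba ha

/-- The chasing of a bulge by single rotations: after the last row of the decoupled block the bulge
has disappeared. -/
theorem StateTracks.loop₁ (hE : ErrorBudget F₀ M ε Γ B ω) : ∀ (k p : ℕ) (g : Gen) (b : ℂ) (m : ℕ),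
    p + 1 + k < n → g.β (p + 1 + k) = 0 → (k = 0 → b = 0) →
    StateTracks F₀ u₀ v₀ M ω m (lowEntry g p ⟨b, 0, 0⟩) g.u g.v →
    NearProd n 1 Γ g.u g.v → (∀ x ∈ (fl.loop₁ k (p + 1) g b).2, NearProd n 1 Γ x.1 x.2) →
    m + (fl.loop₁ k (p + 1) g b).2.length ≤ M →
    StateTracks F₀ u₀ v₀ M ω (m + (fl.loop₁ k (p + 1) g b).2.length)
      (lowEntry (fl.loop₁ k (p + 1) g b).1 0 ⟨0, 0, 0⟩) (fl.loop₁ k (p + 1) g b).1.u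
      (fl.loop₁ k (p + 1) g b).1.v
  | 0, p, g, b, m, _, _, hb, h, _, _, _ => by
    rw [hb rfl, lowEntry_no_bulge g p 0] at h
    exact h
  | k + 1, p, g, b, m, hn, hβ, _, h, hΓ, ht, hm => by
    have h0 := fl.eps_nonneg
    have hεB : 0 ≤ ε * B := mul_nonneg h0 (by linarith [hE.one_le])
    have hpos : (0 : ℝ) ≤ 30000 * ε * B := by linarith
    obtain ⟨H, ρ, hH, hG, hr, hz, hrρ, hρ0, hρ⟩ :=
      fl.givens_spec (by linarith [hE.eps_le]) (g.β p) b
    simp only [FloatArith.loop₁, List.length_cons, List.mem_cons, forall_eq_or_imp,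
      Nat.add_sub_cancel] at ht hm ⊢
    set Gr := fl.givens (g.β p) b
    set g₁ : Gen := { g with β := Function.update g.β p (Gr.2 : ℂ) } with hg₁
    have hb := StateTracks.bdd hE h (by omega) hΓ (lowEntry_band₁ g p b)
    have hβne : ∀ c, c ≠ p → g₁.β c = g.β c := fun c hc => by simp [hg₁, hc]
    have hend : p + 1 + 2 < n ∨ g₁.β (p + 1 + 1) = 0 := by
      rcases Nat.eq_zero_or_pos k with rfl | hk
      · right
        rw [hβne _ (by omega)]
        exact hβ
      · left
        omega
    have key := StateTracks.chase₁ (fl := fl) hE (g := g₁) (L := lowEntry g p ⟨b, 0, 0⟩) h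
      (by omega) le_rfl hb hH hG (i := p + 1) (by omega) hend ?_ ?_
    · have hβ' : (fl.chase₁ Gr.1 (p + 1) g₁).1.β (p + 1 + 1 + k) = 0 ∧
          (k = 0 → (fl.chase₁ Gr.1 (p + 1) g₁).2 = 0) := by
        rcases Nat.eq_zero_or_pos k with rfl | hk
        · have := fl.chase₁_end Gr.1 (p + 1) g₁ (by rw [hβne _ (by omega)]; exact hβ)
          exact ⟨this.1, fun _ => this.2⟩
        · refine ⟨?_, fun h => absurd h (by omega)⟩
          rw [fl.chase₁_β_of_ne _ _ (by omega) (by omega), hβne _ (by omega), add_right_comm]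
          exact hβ
      have ih := StateTracks.loop₁ hE k (p + 1) _ _ (m + 1) (by omega) hβ'.1 hβ'.2 key ht.1 ht.2
        (by omega)
      rw [add_assoc m, add_comm 1] at ih
      exact ih
    · intro a c hc hca
      simp [lowEntry, hg₁, (show c ≠ p by omega)]
    · intro a c hc hca ha
      by_cases hap : p < a
      · rcases (Nat.lt_succ_iff.mp hc).lt_or_eq with hcp | rfl
        · have e1 : ∀ x, p < x → lowEntry g p ⟨b, 0, 0⟩ x c = 0 := fun x hx =>
            lowEntry_of_lt g _ hcp (by omega)
          rw [lowEntry_zero_bulge g₁ 0 (by omega), H.vec_eq_zero (w := fun x => lowEntry g p _ x c)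
            (e1 (p + 1) (by omega)) (e1 (p + 1 + 1) (by omega)) (e1 a hap), sub_self, norm_zero]
          exact hpos
        · have e1 := lowEntry_subdiag g c ⟨b, 0, 0⟩ c
          have e2 : lowEntry g c ⟨b, 0, 0⟩ (c + 1 + 1) c = b := lowEntry_b₁ g c ⟨b, 0, 0⟩
          obtain rfl | rfl | h3 : a = c + 1 ∨ a = c + 1 + 1 ∨ c + 1 + 1 < a := by omega
          · have n1 := hb.low (c + 1) c (by omega) (by omega)
            have n2 := hb.low (c + 1 + 1) c (by omega) (by omega)
            rw [e1] at n1
            rw [e2] at n2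
            have e3 : g₁.β c = Gr.2 := by simp [hg₁]
            simp only [Rot.vec, if_true, e1, e2, lowEntry_subdiag, e3]
            rw [hr, ← Complex.ofReal_sub, Complex.norm_real, Real.norm_eq_abs]
            refine hrρ.trans ?_
            have : 7 * ε * ρ ≤ 7 * ε * (4 * B) := by
              gcongr
              linarith
            linarith
          · simp only [Rot.vec, Nat.succ_ne_self, if_false, if_true, e1, e2]
            rw [hz, lowEntry_zero_bulge g₁ 0 (by omega), sub_self, norm_zero]
            exact hpos
          · rw [H.vec_of_ne _ (by omega) (by omega), lowEntry_zero_bulge g₁ 0 (by omega),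
              lowEntry_band₁ g c b a c (by omega), sub_self, norm_zero]
            exact hpos
      · rw [H.vec_of_ne _ (by omega) (by omega)]
        have : lowEntry g₁ 0 ⟨0, 0, 0⟩ a c = lowEntry g p ⟨b, 0, 0⟩ a c := by
          obtain rfl | rfl | h3 : a = c ∨ a = c + 1 ∨ c + 1 < a := by omega
          · rw [lowEntry_diag, lowEntry_diag]
          · rw [lowEntry_subdiag, lowEntry_subdiag, hβne _ (by omega)]
          · rw [lowEntry_zero_bulge g₁ 0 h3, lowEntry_of_lt g _ (by omega) h3]
        rw [this, sub_self, norm_zero]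
        exact hpos

theorem lowEntry_decoupled {g : Gen} {lo i j : ℕ} (hlo : lo = 0 ∨ g.β (lo - 1) = 0)
    (hi : lo ≤ i) (hj : j < lo) : lowEntry g 0 ⟨0, 0, 0⟩ i j = 0 := by
  by_cases h : i = j + 1
  · subst h
    rcases hlo with rfl | hlo
    · omega
    · rw [lowEntry_subdiag]
      rwa [show lo - 1 = j by omega] at hlo
  · exact lowEntry_zero_bulge g 0 (by omega)

/-- A single-shift sweep counts as many operations as it has rotations. To the left of the
decoupled block the first rotation acts on zeros only. -/
theorem StateTracks.sweep₁ (hE : ErrorBudget F₀ M ε Γ B ω) {lo hi m : ℕ} {σ : ℂ} {g : Gen}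
    (hact : IsActive n g lo hi)
    (h : StateTracks F₀ u₀ v₀ M ω m (lowEntry g 0 ⟨0, 0, 0⟩) g.u g.v)
    (hΓ : NearProd n 1 Γ g.u g.v) (ht : ∀ x ∈ (fl.sweep₁ lo hi σ g).2, NearProd n 1 Γ x.1 x.2)
    (hm : m + (fl.sweep₁ lo hi σ g).2.length ≤ M) :
    StateTracks F₀ u₀ v₀ M ω (m + (fl.sweep₁ lo hi σ g).2.length)
      (lowEntry (fl.sweep₁ lo hi σ g).1 0 ⟨0, 0, 0⟩) (fl.sweep₁ lo hi σ g).1.u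
      (fl.sweep₁ lo hi σ g).1.v := by
  obtain ⟨hlt, hn, hlo, hβ⟩ := hact
  obtain ⟨k, rfl⟩ : ∃ k, hi = lo + 1 + k := ⟨hi - lo - 1, by omega⟩
  have h0 := fl.eps_nonneg
  have hεB : 0 ≤ ε * B := mul_nonneg h0 (by linarith [hE.one_le])
  obtain ⟨H, -, hH, hG, -⟩ :=
    fl.givens_spec (by linarith [hE.eps_le]) (fl.csub (g.d lo) σ) (g.β lo)
  simp only [FloatArith.sweep₁, List.length_cons, List.mem_cons, forall_eq_or_imp,
    show lo + 1 + k - lo - 1 = k by omega] at ht hm ⊢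
  set G := (fl.givens (fl.csub (g.d lo) σ) (g.β lo)).1
  have hb := StateTracks.bdd hE h (by omega) hΓ (lowEntry_band₁ g 0 0)
  have hend : lo + 2 < n ∨ g.β (lo + 1) = 0 := by
    rcases Nat.eq_zero_or_pos k with rfl | hk
    · exact Or.inr hβ
    · exact Or.inl (by omega)
  have key := StateTracks.chase₁ (fl := fl) hE (g := g) h (by omega) le_rfl hb hH hG (i := lo)
    (by omega) hend (fun a c _ _ => by rw [lowEntry_no_bulge g 0 lo]) ?_
  · have hβ' : (fl.chase₁ G lo g).1.β (lo + 1 + k) = 0 ∧ (k = 0 → (fl.chase₁ G lo g).2 = 0) := by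
      rcases Nat.eq_zero_or_pos k with rfl | hk
      · have := fl.chase₁_end G lo g hβ
        exact ⟨this.1, fun _ => this.2⟩
      · refine ⟨?_, fun h => absurd h (by omega)⟩
        rw [fl.chase₁_β_of_ne _ _ (by omega) (by omega)]
        exact hβ
    have ih := StateTracks.loop₁ hE k lo _ _ (m + 1) (by omega) hβ'.1 hβ'.2 key ht.1 ht.2
      (by omega)
    rw [add_assoc m, add_comm 1] at ih
    exact ih
  · intro a c hc hca _
    have hpos : (0 : ℝ) ≤ 30000 * ε * B := by linarith
    by_cases hai : a = lo ∨ a = lo + 1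
    · have e1 : ∀ x, lo ≤ x → lowEntry g 0 ⟨0, 0, 0⟩ x c = 0 := fun x hx =>
        lowEntry_decoupled hlo hx hc
      rw [H.vec_eq_zero (w := fun x => lowEntry g 0 _ x c) (e1 lo le_rfl) (e1 (lo + 1) (by omega))
        (e1 a (by omega)), e1 a (by omega), sub_self, norm_zero]
      exact hpos
    · rw [H.vec_of_ne _ (by omega) (by omega), sub_self, norm_zero]
      exact hpos

end Budget

/-! ### Double-shift sweeps -/

section DoubleShift

variable {n : ℕ} {F₀ : Matrix (Fin n) (Fin n) ℂ} {u₀ v₀ : Fin n → ℂ} {M : ℕ} {ε Γ B ω : ℝ}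
  {fl : FloatArith ε}

theorem FloatArith.chase₂_mem (G₂ G₁ : Rot) (i : ℕ) (x : ℂ) (g : Gen) :
    ((fl.chase₂ G₂ G₁ i x g).1.u, (fl.chase₂ G₂ G₁ i x g).1.v) ∈ (fl.chase₂ G₂ G₁ i x g).2.2 := by
  simp [chase₂]

/-- The chasing of a bulge by pairs of rotations, followed by the single rotation that removes the
bulge at the bottom of the decoupled block. -/
theorem StateTracks.loop₂ (hE : ErrorBudget F₀ M ε Γ B ω) : ∀ (k p : ℕ) (g : Gen)
    (b : FloatArith.Bulge₂) (m : ℕ),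
    p + 1 + k + 1 < n → g.β (p + 1 + k + 1) = 0 → (k = 0 → b.b₂ = 0 ∧ b.b₃ = 0) →
    StateTracks F₀ u₀ v₀ M ω m (lowEntry g p b) g.u g.v →
    NearProd n 2 Γ g.u g.v → (∀ x ∈ (fl.loop₂ k (p + 1) g b).2, NearProd n 2 Γ x.1 x.2) →
    m + (fl.loop₂ k (p + 1) g b).2.length ≤ M →
    StateTracks F₀ u₀ v₀ M ω (m + (fl.loop₂ k (p + 1) g b).2.length)
      (lowEntry (fl.loop₂ k (p + 1) g b).1 0 ⟨0, 0, 0⟩) (fl.loop₂ k (p + 1) g b).1.u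
      (fl.loop₂ k (p + 1) g b).1.v
  | 0, p, g, b, m, hn, hβ, hb, h, hΓ, ht, hm => by
    obtain ⟨b₁, b₂, b₃⟩ := b
    obtain ⟨rfl, rfl⟩ := hb rfl
    exact StateTracks.loop₁ hE 1 p g b₁ m hn hβ (fun h => absurd h one_ne_zero) h
      (hΓ.mono one_le_two) (fun x hx => (ht x hx).mono one_le_two) hm
  | k + 1, p, g, b, m, hn, hβ, _, h, hΓ, ht, hm => by
    have h0 := fl.eps_nonneg
    have h1 := hE.eps_le
    have hεB : 0 ≤ ε * B := mul_nonneg h0 (by linarith [hE.one_le])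
    have hpos : (0 : ℝ) ≤ 30000 * ε * B := by linarith
    obtain ⟨H₂, ρ₂, hH₂, hG₂, hr₂, hz₂, hrρ₂, hρ₂0, hρ₂⟩ :=
      fl.givens_spec (by linarith) b.b₁ b.b₂
    obtain ⟨H₁, ρ₁, hH₁, hG₁, hr₁, hz₁, hrρ₁, hρ₁0, hρ₁⟩ :=
      fl.givens_spec (by linarith) (g.β p) ((fl.givens b.b₁ b.b₂).2 : ℂ)
    simp only [FloatArith.loop₂, List.length_append, List.mem_append,
      Nat.add_sub_cancel] at ht hm ⊢
    set Gr₂ := fl.givens b.b₁ b.b₂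
    set Gr₁ := fl.givens (g.β p) (Gr₂.2 : ℂ)
    set g₁ : Gen := { g with β := Function.update g.β p (Gr₁.2 : ℂ) } with hg₁
    have hlen : (fl.chase₂ Gr₂.1 Gr₁.1 (p + 1) b.b₃ g₁).2.2.length = 2 := rfl
    rw [hlen] at hm ⊢
    have hb := StateTracks.bdd hE h (by omega) hΓ (lowEntry_band₂ g p b)
    have hβne : ∀ c, c ≠ p → g₁.β c = g.β c := fun c hc => by simp [hg₁, hc]
    have hend : p + 1 + 3 < n ∨ g₁.β (p + 1 + 2) = 0 := by
      rcases Nat.eq_zero_or_pos k with rfl | hk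
      · right
        rw [hβne _ (by omega)]
        exact hβ
      · left
        omega
    have key := StateTracks.chase₂ (fl := fl) hE (g := g₁) (L := lowEntry g p b) (x := b.b₃) h
      (by omega) le_rfl hb hH₁ hG₁ hH₂ hG₂ (i := p + 1) (by omega) hend ?_ ?_
    · have hβ' : (fl.chase₂ Gr₂.1 Gr₁.1 (p + 1) b.b₃ g₁).1.β (p + 1 + 1 + k + 1) = 0 ∧
          (k = 0 → (fl.chase₂ Gr₂.1 Gr₁.1 (p + 1) b.b₃ g₁).2.1.b₂ = 0 ∧
            (fl.chase₂ Gr₂.1 Gr₁.1 (p + 1) b.b₃ g₁).2.1.b₃ = 0) := by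
        rcases Nat.eq_zero_or_pos k with rfl | hk
        · have := fl.chase₂_end Gr₂.1 Gr₁.1 (p + 1) b.b₃ g₁
            (by rw [hβne _ (by omega)]; exact hβ)
          exact ⟨this.1, fun _ => this.2⟩
        · refine ⟨?_, fun h => absurd h (by omega)⟩
          rw [fl.chase₂_β_of_ne _ _ _ _ (by omega) (by omega) (by omega), hβne _ (by omega),
            add_right_comm _ 1 k]
          exact hβ
      have ih := StateTracks.loop₂ hE k (p + 1) _ _ (m + 2) (by omega) hβ'.1 hβ'.2
        (key.mono hE.nonneg (by omega)) (ht _ (Or.inl (fl.chase₂_mem _ _ _ _ _)))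
        (fun x hx => ht x (Or.inr hx)) (by omega)
      rw [add_assoc m] at ih
      exact ih
    · intro a c hc hca
      obtain rfl | rfl | rfl | h3 : a = c ∨ a = c + 1 ∨ a = c + 2 ∨ c + 2 < a := by omega
      · rw [lowEntry_diag, lowEntry_diag]
      · rw [lowEntry_subdiag, lowEntry_subdiag, hβne _ (by omega)]
      · simp [lowEntry, (show c ≠ p by omega)]
      · simp [lowEntry, (show a ≠ c by omega), (show a ≠ c + 1 by omega),
          (show a ≠ c + 2 by omega), (show c ≠ p by omega)]
    · intro a c hc hca ha
      by_cases hap : p < a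
      · rcases (Nat.lt_succ_iff.mp hc).lt_or_eq with hcp | rfl
        · have e1 : ∀ x, p < x → lowEntry g p b x c = 0 := fun x hx =>
            lowEntry_of_lt g _ hcp (by omega)
          have e2 : ∀ x, p < x → H₂.vec (p + 1 + 1) (fun x => lowEntry g p b x c) x = 0 :=
            fun x hx => H₂.vec_eq_zero (w := fun x => lowEntry g p b x c) (e1 _ (by omega))
              (e1 _ (by omega)) (e1 x hx)
          rw [lowEntry_zero_bulge g₁ 0 (by omega), H₁.vec_eq_zero (e2 (p + 1) (by omega))
            (e2 (p + 1 + 1) (by omega)) (e2 a hap), sub_self, norm_zero]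
          exact hpos
        · have l1 := lowEntry_subdiag g c b c
          have l2 : lowEntry g c b (c + 1 + 1) c = b.b₁ := lowEntry_b₁ g c b
          have l3 : lowEntry g c b (c + 1 + 1 + 1) c = b.b₂ := lowEntry_b₂ g c b
          set y := H₂.vec (c + 1 + 1) (fun x => lowEntry g c b x c) with hy
          have y1 : y (c + 1) = g.β c := by
            rw [hy, H₂.vec_of_ne _ (by omega) (by omega), l1]
          have y2 : y (c + 1 + 1) = ρ₂ := by
            simp only [hy, Rot.vec, if_true, l2, l3]
            exact hr₂
          have y3 : y (c + 1 + 1 + 1) = 0 := by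
            simp only [hy, Rot.vec, Nat.succ_ne_self, if_false, if_true, l2, l3]
            exact hz₂
          have hδ : ‖(Gr₂.2 : ℂ) - ρ₂‖ ≤ 7 * ε * ρ₂ := by
            rw [← Complex.ofReal_sub, Complex.norm_real, Real.norm_eq_abs]
            exact hrρ₂
          have n3 : ‖b.b₂‖ ≤ 2 * B := by
            by_cases hn3 : c + 1 + 1 + 1 < n
            · have := hb.low (c + 1 + 1 + 1) c (by omega) hn3
              rwa [l3] at this
            · omega
          have n2 := hb.low (c + 1 + 1) c (by omega) (by omega)
          rw [l2] at n2
          have n4 : 7 * ε * ρ₂ ≤ 7 * ε * (4 * B) := by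
            gcongr
            linarith
          obtain rfl | rfl | h3 : a = c + 1 ∨ a = c + 1 + 1 ∨ c + 1 + 1 < a := by omega
          · have n1 := hb.low (c + 1) c (by omega) (by omega)
            rw [l1] at n1
            have e3 : g₁.β c = Gr₁.2 := by simp [hg₁]
            have e4 : H₁.vec (c + 1) y (c + 1) = ρ₁ - star H₁.s * ((Gr₂.2 : ℂ) - ρ₂) := by
              simp only [Rot.vec, if_true, y1, y2]
              linear_combination hr₁
            have e5 : ‖star H₁.s * ((Gr₂.2 : ℂ) - ρ₂)‖ ≤ 7 * ε * (4 * B) := by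
              rw [norm_mul, norm_star]
              have := mul_le_of_le_one_left (norm_nonneg ((Gr₂.2 : ℂ) - ρ₂)) hH₁.norm_s_le
              linarith
            have e6 : ‖(Gr₂.2 : ℂ)‖ ≤ 5 * B := by
              have e7 := norm_le_norm_add_norm_sub' (Gr₂.2 : ℂ) ρ₂
              have e8 : ‖(ρ₂ : ℂ)‖ = ρ₂ := by
                rw [Complex.norm_real, Real.norm_eq_abs, abs_of_nonneg hρ₂0]
              have e9 : 7 * ε * (4 * B) ≤ B := by nlinarith [hE.one_le]
              linarith
            have e7 : 7 * ε * ρ₁ ≤ 7 * ε * (7 * B) := by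
              gcongr
              linarith
            have e8 : ‖(Gr₁.2 : ℂ) - ρ₁‖ ≤ 7 * ε * (7 * B) := by
              rw [← Complex.ofReal_sub, Complex.norm_real, Real.norm_eq_abs]
              exact hrρ₁.trans e7
            rw [lowEntry_subdiag, e3, e4]
            rw [show (Gr₁.2 : ℂ) - (ρ₁ - star H₁.s * ((Gr₂.2 : ℂ) - ρ₂)) =
              ((Gr₁.2 : ℂ) - ρ₁) + star H₁.s * ((Gr₂.2 : ℂ) - ρ₂) by ring]
            refine (norm_add_le _ _).trans ?_
            linarith
          · have e4 : H₁.vec (c + 1) y (c + 1 + 1) = -(H₁.c * ((Gr₂.2 : ℂ) - ρ₂)) := by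
              simp only [Rot.vec, Nat.succ_ne_self, if_false, if_true, y1, y2]
              linear_combination hz₁
            rw [lowEntry_zero_bulge g₁ 0 (by omega), e4, zero_sub, neg_neg, norm_mul]
            have := mul_le_of_le_one_left (norm_nonneg ((Gr₂.2 : ℂ) - ρ₂)) hH₁.norm_c_le
            linarith
          · rw [H₁.vec_of_ne _ (by omega) (by omega), lowEntry_zero_bulge g₁ 0 (by omega)]
            have : y a = 0 := by
              by_cases ha3 : a = c + 1 + 1 + 1
              · rw [ha3, y3]
              · rw [hy, H₂.vec_of_ne _ (by omega) (by omega), lowEntry_band₂ g c b a c (by omega)]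
            rw [this, sub_self, norm_zero]
            exact hpos
      · rw [H₁.vec_of_ne _ (by omega) (by omega), H₂.vec_of_ne _ (by omega) (by omega)]
        have : lowEntry g₁ 0 ⟨0, 0, 0⟩ a c = lowEntry g p b a c := by
          obtain rfl | rfl | h3 : a = c ∨ a = c + 1 ∨ c + 1 < a := by omega
          · rw [lowEntry_diag, lowEntry_diag]
          · rw [lowEntry_subdiag, lowEntry_subdiag, hβne _ (by omega)]
          · rw [lowEntry_zero_bulge g₁ 0 h3, lowEntry_of_lt g _ (by omega) h3]
        rw [this, sub_self, norm_zero]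
        exact hpos

theorem StateTracks.sweep₂ (hE : ErrorBudget F₀ M ε Γ B ω) {lo hi m : ℕ} {σ : ℂ} {g : Gen}
    (hact : IsActive n g lo hi) (hsize : lo + 2 ≤ hi)
    (h : StateTracks F₀ u₀ v₀ M ω m (lowEntry g 0 ⟨0, 0, 0⟩) g.u g.v)
    (hΓ : NearProd n 2 Γ g.u g.v) (ht : ∀ x ∈ (fl.sweep₂ lo hi σ g).2, NearProd n 2 Γ x.1 x.2)
    (hm : m + (fl.sweep₂ lo hi σ g).2.length ≤ M) :
    StateTracks F₀ u₀ v₀ M ω (m + (fl.sweep₂ lo hi σ g).2.length)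
      (lowEntry (fl.sweep₂ lo hi σ g).1 0 ⟨0, 0, 0⟩) (fl.sweep₂ lo hi σ g).1.u
      (fl.sweep₂ lo hi σ g).1.v := by
  obtain ⟨hlt, hn, hlo, hβ⟩ := hact
  obtain ⟨k, rfl⟩ : ∃ k, hi = lo + 2 + k := ⟨hi - lo - 2, by omega⟩
  have h0 := fl.eps_nonneg
  have hεB : 0 ≤ ε * B := mul_nonneg h0 (by linarith [hE.one_le])
  have hpos : (0 : ℝ) ≤ 30000 * ε * B := by linarith
  have spec := fun x y => fl.givens_spec (by linarith [hE.eps_le]) x y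
  simp only [FloatArith.sweep₂, List.length_append, List.mem_append,
    show lo + 2 + k - lo - 2 = k by omega] at ht hm ⊢
  obtain ⟨H₂, -, hH₂, hG₂, -⟩ := spec
    (fl.cmul (g.β lo) (fl.csub (fl.cadd (g.d lo) (g.d (lo + 1))) (fl.mul 2 σ.re : ℝ)))
    (fl.cmul (g.β lo) (g.β (lo + 1)))
  set Gr₂ := fl.givens
    (fl.cmul (g.β lo) (fl.csub (fl.cadd (g.d lo) (g.d (lo + 1))) (fl.mul 2 σ.re : ℝ)))
    (fl.cmul (g.β lo) (g.β (lo + 1)))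
  obtain ⟨H₁, -, hH₁, hG₁, -⟩ := spec (fl.cadd
    (fl.csub (fl.cadd (fl.cmul (g.d lo) (g.d lo)) (fl.cmul (fl.superdiag g lo) (g.β lo)))
      (fl.cmul (fl.mul 2 σ.re : ℝ) (g.d lo))) (fl.cabsSq σ : ℝ)) (Gr₂.2 : ℂ)
  set Gr₁ := fl.givens (fl.cadd
    (fl.csub (fl.cadd (fl.cmul (g.d lo) (g.d lo)) (fl.cmul (fl.superdiag g lo) (g.β lo)))
      (fl.cmul (fl.mul 2 σ.re : ℝ) (g.d lo))) (fl.cabsSq σ : ℝ)) (Gr₂.2 : ℂ)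
  have hlen : (fl.chase₂ Gr₂.1 Gr₁.1 lo 0 g).2.2.length = 2 := rfl
  rw [hlen] at hm ⊢
  have hb := StateTracks.bdd hE h (by omega) hΓ (lowEntry_band₂ g 0 _)
  have hend : lo + 3 < n ∨ g.β (lo + 2) = 0 := by
    rcases Nat.eq_zero_or_pos k with rfl | hk
    · exact Or.inr hβ
    · exact Or.inl (by omega)
  have key := StateTracks.chase₂ (fl := fl) hE (g := g) (x := 0) h (by omega) le_rfl hb hH₁ hG₁
    hH₂ hG₂ (i := lo) (by omega) hend (fun a c _ _ => by rw [lowEntry_no_bulge g 0 lo]) ?_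
  · have hβ' : (fl.chase₂ Gr₂.1 Gr₁.1 lo 0 g).1.β (lo + 1 + k + 1) = 0 ∧
        (k = 0 → (fl.chase₂ Gr₂.1 Gr₁.1 lo 0 g).2.1.b₂ = 0 ∧
          (fl.chase₂ Gr₂.1 Gr₁.1 lo 0 g).2.1.b₃ = 0) := by
      rcases Nat.eq_zero_or_pos k with rfl | hk
      · have := fl.chase₂_end Gr₂.1 Gr₁.1 lo 0 g hβ
        exact ⟨this.1, fun _ => this.2⟩
      · refine ⟨?_, fun h => absurd h (by omega)⟩
        rw [fl.chase₂_β_of_ne _ _ _ _ (by omega) (by omega) (by omega), add_right_comm _ k 1]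
        exact hβ
    -- a pair of rotations is one operation, but it may be counted as two
    have ih := StateTracks.loop₂ hE k lo _ _ (m + 2) (by omega) hβ'.1 hβ'.2
      (key.mono hE.nonneg (by omega)) (ht _ (Or.inl (fl.chase₂_mem _ _ _ _ _)))
      (fun x hx => ht x (Or.inr hx)) (by omega)
    rw [add_assoc m] at ih
    exact ih
  · intro a c hc hca _
    by_cases hai : lo ≤ a ∧ a ≤ lo + 2
    · have e1 : ∀ x, lo ≤ x → lowEntry g 0 ⟨0, 0, 0⟩ x c = 0 := fun x hx =>
        lowEntry_decoupled hlo hx hc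
      have e2 : ∀ x, lo ≤ x → H₂.vec (lo + 1) (fun x => lowEntry g 0 ⟨0, 0, 0⟩ x c) x = 0 :=
        fun x hx => H₂.vec_eq_zero (w := fun x => lowEntry g 0 ⟨0, 0, 0⟩ x c) (e1 _ (by omega))
          (e1 _ (by omega)) (e1 x hx)
      rw [H₁.vec_eq_zero (e2 lo le_rfl) (e2 (lo + 1) (by omega))
        (e2 a (by omega)), e1 a (by omega), sub_self, norm_zero]
      exact hpos
    · rw [H₁.vec_of_ne _ (by omega) (by omega), H₂.vec_of_ne _ (by omega) (by omega), sub_self,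
        norm_zero]
      exact hpos

theorem FloatArith.length_sweep_pos {kind : ShiftKind} {g : Gen}
    {e : Gen × List ((ℕ → ℂ) × (ℕ → ℂ))} (h : fl.QRSweep n g e kind) : 1 ≤ e.2.length := by
  cases kind with
  | single =>
    obtain ⟨lo, hi, σ, -, rfl⟩ := h
    simp [sweep₁]
  | double =>
    obtain ⟨lo, hi, σ, -, ⟨-, rfl⟩ | ⟨-, rfl⟩⟩ := h
    · simp [sweep₁]
    · simp only [sweep₂, chase₂, List.length_append, List.length_cons]
      omega

theorem StateTracks.sweep (hE : ErrorBudget F₀ M ε Γ B ω) {kind : ShiftKind} {m : ℕ} {g : Gen}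
    {e : Gen × List ((ℕ → ℂ) × (ℕ → ℂ))} (hs : fl.QRSweep n g e kind)
    (h : StateTracks F₀ u₀ v₀ M ω m (lowEntry g 0 ⟨0, 0, 0⟩) g.u g.v)
    (hΓ : NearProd n kind.index Γ g.u g.v) (ht : ∀ x ∈ e.2, NearProd n kind.index Γ x.1 x.2)
    (hm : m + e.2.length ≤ M) :
    StateTracks F₀ u₀ v₀ M ω (m + e.2.length) (lowEntry e.1 0 ⟨0, 0, 0⟩) e.1.u e.1.v := by
  cases kind with
  | single =>
    obtain ⟨lo, hi, σ, hact, rfl⟩ := hs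
    exact StateTracks.sweep₁ hE hact h hΓ ht hm
  | double =>
    obtain ⟨lo, hi, σ, hact, ⟨-, rfl⟩ | ⟨hsize, rfl⟩⟩ := hs
    · exact StateTracks.sweep₁ hE hact h (hΓ.mono one_le_two)
        (fun x hx => (ht x hx).mono one_le_two) hm
    · exact StateTracks.sweep₂ hE hact hsize h hΓ ht hm

/-! ### Deflations and complete runs -/

/-- The computed deflation criterion implies the exact one up to a factor of two. -/
theorem FloatArith.norm_le_of_negligible (h1 : ε ≤ 1 / 1000) {x y z : ℂ}
    (h : fl.cabs x ≤ fl.mul ε (fl.add (fl.cabs y) (fl.cabs z))) :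
    ‖x‖ ≤ 2 * ε * (‖y‖ + ‖z‖) := by
  have h0 := fl.eps_nonneg
  have e1 := fl.cabs_err (by linarith) x
  have e2 := fl.cabs_err (by linarith) y
  have e3 := fl.cabs_err (by linarith) z
  have e4 := fl.add_err (fl.cabs y) (fl.cabs z)
  have e5 := fl.mul_err ε (fl.add (fl.cabs y) (fl.cabs z))
  have hx := norm_nonneg x
  have hS : 0 ≤ ‖y‖ + ‖z‖ := by positivity
  set a := fl.cabs y
  set b := fl.cabs z
  set s := fl.add a b
  set S := ‖y‖ + ‖z‖
  have f1 : |a + b| ≤ 1.007 * S := by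
    have := abs_add_le a b
    have ha : |a| ≤ 1.007 * ‖y‖ := by
      rw [abs_le] at *
      constructor <;> nlinarith [norm_nonneg y]
    have hb : |b| ≤ 1.007 * ‖z‖ := by
      rw [abs_le] at *
      constructor <;> nlinarith [norm_nonneg z]
    linarith
  have f2 : |s| ≤ 1.02 * S := by
    have := abs_sub_abs_le_abs_sub s (a + b)
    nlinarith
  have f3 : fl.mul ε s ≤ (1 + ε) * |ε * s| := by
    have := abs_sub_abs_le_abs_sub (fl.mul ε s) (ε * s)
    linarith [le_abs_self (fl.mul ε s)]
  rw [abs_mul, abs_of_nonneg h0] at f3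
  have f4 : ε * |s| ≤ ε * (1.02 * S) := mul_le_mul_of_nonneg_left f2 h0
  have f5 : (1 - 7 * ε) * ‖x‖ ≤ fl.cabs x := by
    rw [abs_le] at e1
    linarith
  have hεS : 0 ≤ ε * S := mul_nonneg h0 hS
  have f6 : (1 + ε) * (ε * |s|) ≤ 1.001 * (ε * (1.02 * S)) :=
    mul_le_mul (by linarith) f4 (mul_nonneg h0 (abs_nonneg _)) (by norm_num)
  nlinarith

/-- A deflation is an operation with the identity as its similarity: it changes only entries of `F`,
by `O(ε B)` because the diagonal entries of `A` are bounded by `2 B`. -/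
theorem StateTracks.deflation (hE : ErrorBudget F₀ M ε Γ B ω) {m j : ℕ} {g g' : Gen}
    (h : StateTracks F₀ u₀ v₀ M ω m (lowEntry g 0 ⟨0, 0, 0⟩) g.u g.v) (hm : m + 1 ≤ M)
    (hj : 1 ≤ j) (hn : 0 < n) (hΓ : NearProd n j Γ g.u g.v) (hd : fl.Deflation g g') :
    StateTracks F₀ u₀ v₀ M ω (m + 1) (lowEntry g' 0 ⟨0, 0, 0⟩) g'.u g'.v := by
  obtain ⟨hd1, hd2, hd3, hd4⟩ := hd
  have h0 := fl.eps_nonneg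
  have hB := hE.one_le
  have hω := hE.le_ω
  have hεB : 0 ≤ ε * B := by positivity
  have hb := StateTracks.bdd hE h (by omega) (hΓ.mono hj) (lowEntry_band₁ g 0 0)
  have hwin : ∀ w : ℕ → ℂ, WindowErr 0 0 0 w w w := fun w => by simp [WindowErr]
  rw [hd2, hd3]
  refine Tracks.rotate (η := 0) (e := 8 * ε * B) (W := 1) (T := id) (R := id) h hm hE.nonneg
    hE.mul_le (one_mem _) (fun X => by simp) (fun w => by simp) (hwin g.u) (hwin g.v) le_rfl
    zero_le_one (by omega) (w := 0) (by omega) hn (by linarith)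
    (fun a b ha hb' hab => hb.prod a b ha hb' (by omega)) ?_ (by linarith) (by linarith)
  intro a b hba ha
  rw [id, repA_of_le _ _ _ hba]
  have hpos : 0 ≤ 8 * ε * B := by linarith
  obtain rfl | rfl | h3 : a = b ∨ a = b + 1 ∨ b + 1 < a := by omega
  · rw [lowEntry_diag, lowEntry_diag, hd1, sub_self, norm_zero]
    exact hpos
  · rw [lowEntry_subdiag, lowEntry_subdiag]
    rcases hd4 b with h4 | ⟨h4, h5⟩
    · rw [h4, sub_self, norm_zero]
      exact hpos
    · rw [h4, zero_sub, norm_neg]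
      refine (fl.norm_le_of_negligible hE.eps_le h5).trans ?_
      have e1 := hb.low b b le_rfl (by omega)
      have e2 := hb.low (b + 1) (b + 1) le_rfl ha
      rw [lowEntry_diag] at e1 e2
      have : 2 * ε * (‖g.d b‖ + ‖g.d (b + 1)‖) ≤ 2 * ε * (4 * B) := by
        gcongr
        linarith
      linarith
  · rw [lowEntry_zero_bulge g' 0 h3, lowEntry_zero_bulge g 0 h3, sub_self, norm_zero]
    exact hpos

theorem ShiftKind.one_le_index (kind : ShiftKind) : 1 ≤ kind.index := by
  cases kind <;> simp [ShiftKind.index]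

theorem FloatArith.loop₁_mem : ∀ (k i : ℕ) (g : Gen) (b : ℂ),
    ((fl.loop₁ k i g b).1.u, (fl.loop₁ k i g b).1.v) ∈ (g.u, g.v) :: (fl.loop₁ k i g b).2
  | 0, i, g, b => by simp [loop₁]
  | k + 1, i, g, b => by
    rw [loop₁]
    exact List.mem_cons_of_mem _ (loop₁_mem k (i + 1) _ _)

theorem FloatArith.loop₂_mem : ∀ (k i : ℕ) (g : Gen) (b : Bulge₂),
    ((fl.loop₂ k i g b).1.u, (fl.loop₂ k i g b).1.v) ∈ (g.u, g.v) :: (fl.loop₂ k i g b).2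
  | 0, i, g, b => fl.loop₁_mem 1 i g b.b₁
  | k + 1, i, g, b => by
    rw [loop₂]
    refine List.mem_cons_of_mem _ (List.mem_append.mpr ?_)
    rcases List.mem_cons.mp (loop₂_mem k (i + 1) _ _) with h | h
    · rw [h]
      exact Or.inl (fl.chase₂_mem _ _ _ _ _)
    · exact Or.inr h

/-- The vectors of the generators after a sweep are among the recorded ones. -/
theorem FloatArith.sweep_mem {kind : ShiftKind} {g : Gen} {e : Gen × List ((ℕ → ℂ) × (ℕ → ℂ))}
    (h : fl.QRSweep n g e kind) : (e.1.u, e.1.v) ∈ e.2 := by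
  have h₁ : ∀ lo hi σ, ((fl.sweep₁ lo hi σ g).1.u, (fl.sweep₁ lo hi σ g).1.v) ∈
      (fl.sweep₁ lo hi σ g).2 := fun lo hi σ => fl.loop₁_mem _ _ _ _
  cases kind with
  | single =>
    obtain ⟨lo, hi, σ, -, rfl⟩ := h
    exact h₁ lo hi σ
  | double =>
    obtain ⟨lo, hi, σ, -, ⟨-, rfl⟩ | ⟨-, rfl⟩⟩ := h
    · exact h₁ lo hi σ
    · refine List.mem_append.mpr ?_
      rcases List.mem_cons.mp (fl.loop₂_mem _ _ _ _) with h | h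
      · refine Or.inl ?_
        simp only [sweep₂]
        rw [h]
        exact fl.chase₂_mem _ _ _ _ _
      · exact Or.inr h

theorem FloatArith.QRRun.mem {kind : ShiftKind} {g₀ g : Gen}
    {t : List ((ℕ → ℂ) × (ℕ → ℂ))} (h : fl.QRRun kind n g₀ g t) : (g.u, g.v) ∈ t := by
  cases h with
  | start => simp
  | step _ _ hs => exact List.mem_append_right _ (fl.sweep_mem hs)

/-- The errors of a run. Each iteration has one deflation and at least one rotation, so that the
number of operations is at most twice the length of the list `t`. -/
theorem FloatArith.QRRun.tracks {kind : ShiftKind} {g₀ g : Gen} {t : List ((ℕ → ℂ) × (ℕ → ℂ))}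
    (hr : fl.QRRun kind n g₀ g t) (hE : ErrorBudget F₀ M ε Γ B ω) (hn : 0 < n)
    (h : StateTracks F₀ u₀ v₀ M ω 1 (lowEntry g₀ 0 ⟨0, 0, 0⟩) g₀.u g₀.v)
    (ht : ∀ x ∈ t, NearProd n kind.index Γ x.1 x.2) (hM : 2 * t.length ≤ M) :
    StateTracks F₀ u₀ v₀ M ω (2 * t.length) (lowEntry g 0 ⟨0, 0, 0⟩) g.u g.v := by
  induction hr with
  | start => exact Tracks.mono hE.nonneg (by simp) h
  | @step g g' t e hr hd hs ih =>
    have hlen := length_sweep_pos hs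
    rw [List.length_append] at hM
    have h1 := ih (fun x hx => ht x (List.mem_append_left _ hx)) (by omega)
    have hΓ : NearProd n kind.index Γ g.u g.v := ht _ (List.mem_append_left _ hr.mem)
    have h2 := h1.deflation hE (by omega) kind.one_le_index hn hΓ hd
    have hΓ' : NearProd n kind.index Γ g'.u g'.v := by
      rw [hd.2.1, hd.2.2.1]
      exact hΓ
    have h3 := h2.sweep hE hs hΓ' (fun x hx => ht x (List.mem_append_right _ hx)) (by omega)
    exact Tracks.mono hE.nonneg (by rw [List.length_append]; omega) h3

/-- The errors of a converged run, whose last deflation is one more operation. -/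
theorem FloatArith.QRConverged.tracks {kind : ShiftKind} {g₀ g : Gen}
    {t : List ((ℕ → ℂ) × (ℕ → ℂ))} (hr : fl.QRConverged kind n g₀ g t)
    (hE : ErrorBudget F₀ M ε Γ B ω) (hn : 0 < n)
    (h : StateTracks F₀ u₀ v₀ M ω 1 (lowEntry g₀ 0 ⟨0, 0, 0⟩) g₀.u g₀.v)
    (ht : ∀ x ∈ t, NearProd n kind.index Γ x.1 x.2) (hM : 2 * t.length + 1 ≤ M) :
    StateTracks F₀ u₀ v₀ M ω (2 * t.length + 1) (lowEntry g 0 ⟨0, 0, 0⟩) g.u g.v := by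
  obtain ⟨g', hr, hd, -⟩ := hr
  exact (hr.tracks hE hn h ht (by omega)).deflation hE hM kind.one_le_index hn (ht _ hr.mem) hd

end DoubleShift

/-! ### Chebyshev expansions and the determinant of the colleague matrix -/

open Polynomial in
theorem exists_chebyshev_expansion : ∀ (n : ℕ) (q : ℂ[X]), q.degree < n →
    ∃ a : ℕ → ℂ, q = ∑ k ∈ Finset.range n, C (a k) * Chebyshev.T ℂ k
  | 0, q, h => ⟨0, by
      rw [Finset.range_zero, Finset.sum_empty]
      exact degree_eq_bot.mp (by simpa using h)⟩
  | n + 1, q, h => by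
    have hdeg : (Chebyshev.T ℂ n).natDegree = n := by simp [Chebyshev.natDegree_T]
    have hlead : (Chebyshev.T ℂ n).coeff n ≠ 0 := by
      have h0 : Chebyshev.T ℂ n ≠ 0 := by
        intro h0
        have := Chebyshev.leadingCoeff_T ℂ n
        rw [h0, leadingCoeff_zero] at this
        exact pow_ne_zero _ two_ne_zero this.symm
      have := leadingCoeff_ne_zero.mpr h0
      rwa [leadingCoeff, hdeg] at this
    set l := (Chebyshev.T ℂ n).coeff n
    have h1 : (q - C (q.coeff n / l) * Chebyshev.T ℂ n).degree < n := by
      rw [degree_lt_iff_coeff_zero] at h ⊢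
      intro m hm
      rw [coeff_sub, coeff_C_mul]
      rcases hm.eq_or_lt with rfl | hm
      · rw [div_mul_cancel₀ _ hlead, sub_self]
      · have hT0 : (Chebyshev.T ℂ n).coeff m = 0 :=
          coeff_eq_zero_of_natDegree_lt (by rw [hdeg]; exact hm)
        have hq0 : q.coeff m = 0 := h m hm
        rw [hq0, hT0, mul_zero, sub_zero]
    obtain ⟨a, ha⟩ := exists_chebyshev_expansion n _ h1
    refine ⟨fun k => if k = n then q.coeff n / l else a k, ?_⟩
    rw [Finset.sum_range_succ]
    simp only [if_true]
    rw [← sub_eq_iff_eq_add, ha]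
    refine Finset.sum_congr rfl fun k hk => ?_
    rw [if_neg (Finset.mem_range.mp hk).ne]

section Colleague

open Polynomial Matrix

theorem colleagueF_apply {n : ℕ} (i j : Fin n) : colleagueF n i j =
    (if (i : ℕ) + 1 = j then (if (i : ℕ) + 2 = n then (Real.sqrt 2 : ℂ) / 2 else 1 / 2) else 0) +
    (if (j : ℕ) + 1 = i then
      (if (j : ℕ) + 2 = n then (Real.sqrt 2 : ℂ) / 2 else 1 / 2) else 0) := by
  have hi := i.2
  have hj := j.2
  unfold colleagueF
  split_ifs <;> first | omega | simp

theorem sum_fin_ite_succ {n : ℕ} (f : Fin n → ℂ) (i : Fin n) (h : (i : ℕ) + 1 < n) (x : ℂ) :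
    ∑ j : Fin n, (if (i : ℕ) + 1 = j then x else 0) * f j = x * f ⟨i + 1, h⟩ := by
  rw [Finset.sum_eq_single ⟨i + 1, h⟩]
  · simp
  · intro b _ hb
    rw [if_neg, zero_mul]
    intro h'
    exact hb (Fin.ext h'.symm)
  · simp

theorem sum_colleagueF_mul {n : ℕ} (f : ℕ → ℂ) (i : Fin n) : ∑ j : Fin n, colleagueF n i j * f j =
    (if (i : ℕ) + 1 < n then
      (if (i : ℕ) + 2 = n then (Real.sqrt 2 : ℂ) / 2 else 1 / 2) * f (i + 1) else 0) +
    (if 0 < (i : ℕ) then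
      (if (i : ℕ) + 1 = n then (Real.sqrt 2 : ℂ) / 2 else 1 / 2) * f (i - 1) else 0) := by
  simp only [colleagueF_apply, add_mul, Finset.sum_add_distrib]
  congr 1
  · by_cases h1 : (i : ℕ) + 1 < n
    · rw [if_pos h1]
      exact sum_fin_ite_succ (fun j => f j) i h1 _
    · rw [if_neg h1]
      refine Finset.sum_eq_zero fun j _ => ?_
      rw [if_neg (by omega), zero_mul]
  · by_cases h1 : 0 < (i : ℕ)
    · rw [if_pos h1, Finset.sum_eq_single ⟨i - 1, by omega⟩]
      · simp only
        rw [if_pos (by omega), show (i : ℕ) - 1 + 2 = i + 1 by omega]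
      · intro b _ hb
        rw [if_neg, zero_mul]
        intro h'
        exact hb (Fin.ext (by simp only; omega))
      · simp
    · rw [if_neg h1]
      refine Finset.sum_eq_zero fun j _ => ?_
      rw [if_neg (by omega), zero_mul]

theorem sqrt_two_mul_self : (Real.sqrt 2 : ℂ) * Real.sqrt 2 = 2 := by
  exact_mod_cast Real.mul_self_sqrt (by norm_num : (0 : ℝ) ≤ 2)

theorem sqrt_two_ne_zero : (Real.sqrt 2 : ℂ) ≠ 0 := fun h => by
  have := sqrt_two_mul_self
  rw [h] at this
  norm_num at this

/-- The vector `(T_{n-1}(z), …, T_1(z), T_0(z) / √2)`. -/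
noncomputable def chebVec (n : ℕ) (z : ℂ) (i : ℕ) : ℂ :=
  (if i + 1 = n then (Real.sqrt 2 : ℂ)⁻¹ else 1) * (Chebyshev.T ℂ ((n - 1 - i : ℕ) : ℤ)).eval z

theorem eval_T_succ_succ (k : ℕ) (z : ℂ) : (Chebyshev.T ℂ ((k + 2 : ℕ) : ℤ)).eval z =
    2 * z * (Chebyshev.T ℂ ((k + 1 : ℕ) : ℤ)).eval z - (Chebyshev.T ℂ (k : ℤ)).eval z := by
  push_cast
  rw [Chebyshev.T_add_two]
  simp

/-- The three-term recurrence of the Chebyshev polynomials, in matrix form. -/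
theorem colleagueF_mulVec_chebVec {l : ℕ} (z : ℂ) (i : Fin (l + 2)) :
    z * chebVec (l + 2) z i - ∑ j : Fin (l + 2), colleagueF (l + 2) i j * chebVec (l + 2) z j =
      if (i : ℕ) = 0 then (Chebyshev.T ℂ ((l + 2 : ℕ) : ℤ)).eval z / 2 else 0 := by
  obtain ⟨i, hi⟩ := i
  have h2 := sqrt_two_mul_self
  have h0 := sqrt_two_ne_zero
  rw [sum_colleagueF_mul]
  simp only
  -- the product of the entry above the diagonal with the next entry of the vector
  have hup : ∀ k, i + 1 + k = l + 1 →
      (if i + 2 = l + 2 then (Real.sqrt 2 : ℂ) / 2 else 1 / 2) * chebVec (l + 2) z (i + 1) =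
        (Chebyshev.T ℂ (k : ℤ)).eval z / 2 := by
    intro k hk
    simp only [chebVec]
    rw [show l + 2 - 1 - (i + 1) = k by omega]
    by_cases h3 : i + 2 = l + 2
    · rw [if_pos h3, if_pos (show i + 1 + 1 = l + 2 by omega)]
      field_simp
    · rw [if_neg h3, if_neg (show ¬ i + 1 + 1 = l + 2 by omega)]
      ring
  rcases Nat.eq_zero_or_pos i with rfl | hpos
  · rw [if_pos (show 0 + 1 < l + 2 by omega), if_neg (show ¬ 0 < 0 by omega), if_pos rfl,
      hup l (by omega), eval_T_succ_succ, chebVec, if_neg (show ¬ 0 + 1 = l + 2 by omega),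
      show l + 2 - 1 - 0 = l + 1 by omega]
    ring
  · rw [if_pos hpos, if_neg (show ¬ i = 0 by omega)]
    rcases (Nat.lt_succ_iff.mp hi).eq_or_lt with rfl | hlt
    · rw [if_neg (show ¬ l + 1 + 1 < l + 2 by omega), if_pos rfl, chebVec, if_pos rfl, chebVec,
        if_neg (show ¬ l + 1 - 1 + 1 = l + 2 by omega),
        show l + 2 - 1 - (l + 1) = 0 by omega, show l + 2 - 1 - (l + 1 - 1) = 1 by omega]
      simp only [Nat.cast_zero, Chebyshev.T_zero, eval_one, Nat.cast_one, Chebyshev.T_one, eval_X]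
      field_simp
      linear_combination -z * h2
    · obtain ⟨k, hk⟩ : ∃ k, i + 1 + k = l + 1 := ⟨l - i, by omega⟩
      have e := eval_T_succ_succ k z
      rw [if_pos (show i + 1 < l + 2 by omega), hup k hk, if_neg (show ¬ i + 1 = l + 2 by omega),
        chebVec, if_neg (show ¬ i + 1 = l + 2 by omega), chebVec,
        if_neg (show ¬ i - 1 + 1 = l + 2 by omega), show l + 2 - 1 - i = k + 1 by omega,
        show l + 2 - 1 - (i - 1) = k + 2 by omega, e]
      ring

theorem eval_chebPoly {n : ℕ} (c : EuclideanSpace ℂ (Fin (n + 1))) (z : ℂ) :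
    (chebPoly c).eval z = ∑ k : Fin (n + 1), c k * (Chebyshev.T ℂ ((k : ℕ) : ℤ)).eval z := by
  simp [chebPoly, eval_finsetSum]

theorem colleagueV_dot_chebVec {l : ℕ} (c : EuclideanSpace ℂ (Fin (l + 2 + 1)))
    (hc : c (Fin.last (l + 2)) = 1) (z : ℂ) :
    ∑ j : Fin (l + 2), star (colleagueV c j) * chebVec (l + 2) z j =
      -((chebPoly c).eval z - (Chebyshev.T ℂ ((l + 2 : ℕ) : ℤ)).eval z) / 2 := by
  have h0 := sqrt_two_ne_zero
  have e0 : (chebPoly c).eval z - (Chebyshev.T ℂ ((l + 2 : ℕ) : ℤ)).eval z =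
      ∑ j : Fin (l + 2), c (Fin.revPerm j).castSucc *
        (Chebyshev.T ℂ (((Fin.revPerm j).castSucc : ℕ) : ℤ)).eval z := by
    rw [eval_chebPoly, Fin.sum_univ_castSucc, hc, one_mul, Fin.val_last, add_sub_cancel_right,
      ← Equiv.sum_comp Fin.revPerm]
  rw [e0, ← Finset.sum_neg_distrib, Finset.sum_div]
  refine Finset.sum_congr rfl fun j _ => ?_
  have e1 : (Fin.castSucc (Fin.revPerm j)) =
      (⟨l + 2 - 1 - (j : ℕ), by omega⟩ : Fin (l + 2 + 1)) := by
    ext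
    simp only [Fin.revPerm_apply, Fin.val_castSucc, Fin.val_rev]
    omega
  rw [e1]
  simp only [colleagueV, chebVec]
  set C := c ⟨l + 2 - 1 - (j : ℕ), by omega⟩
  set τ := (Chebyshev.T ℂ ((l + 2 - 1 - (j : ℕ) : ℕ) : ℤ)).eval z
  have e2 : star (Real.sqrt 2 : ℂ) = (Real.sqrt 2 : ℂ) := Complex.conj_ofReal _
  have e3 : star (2 : ℂ) = 2 := by simp
  split_ifs
  · rw [star_mul', star_div₀, star_neg, star_star, e2, e3]
    field_simp
  · rw [star_mul', star_div₀, star_neg, star_star, star_one, e3]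
    ring

/-- The determinant of `z - C` for the colleague matrix `C`: the vector `chebVec` solves
`(z - C) t = (p(z) / 2) e₁`, and Cramer's rule for its last entry involves a triangular minor. -/
theorem det_sub_colleague {l : ℕ} (c : EuclideanSpace ℂ (Fin (l + 2 + 1)))
    (hc : c (Fin.last (l + 2)) = 1) (z : ℂ) :
    2 ^ (l + 1) * (scalar (Fin (l + 2)) z - colleague c).det = (chebPoly c).eval z := by
  set A := scalar (Fin (l + 2)) z - colleague c with hA
  set t : Fin (l + 2) → ℂ := fun i => chebVec (l + 2) z i with ht
  have h0 := sqrt_two_ne_zero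
  have h2 := sqrt_two_mul_self
  have hAt : A *ᵥ t = ((chebPoly c).eval z / 2) • Pi.single 0 1 := by
    have e1 : A *ᵥ t = z • t - colleagueF (l + 2) *ᵥ t -
        (star (colleagueV c) ⬝ᵥ t) • colleagueU (l + 2) := by
      rw [hA, colleague, sub_mulVec, add_mulVec, vecMulVec_mulVec, scalar_apply]
      simp only [op_smul_eq_smul]
      rw [show diagonal (fun _ : Fin (l + 2) => z) *ᵥ t = z • t by
        ext i
        simp [mulVec_diagonal], sub_sub]
    ext i
    rw [e1]
    simp only [Pi.sub_apply, Pi.smul_apply, smul_eq_mul, mulVec, dotProduct, Pi.star_apply]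
    rw [ht]
    simp only
    rw [colleagueF_mulVec_chebVec, colleagueV_dot_chebVec c hc, colleagueU, Pi.single_apply]
    simp only [Fin.ext_iff, Fin.val_zero]
    split_ifs <;> ring
  -- Cramer's rule for the last entry, which is the constant `1 / √2`
  have hcr : A.det * t (Fin.last (l + 1)) =
      A.adjugate (Fin.last (l + 1)) 0 * ((chebPoly c).eval z / 2) := by
    have e1 : A.adjugate *ᵥ (A *ᵥ t) = A.det • t := by
      rw [mulVec_mulVec, adjugate_mul, smul_mulVec, one_mulVec]
    have e2 := congrFun e1 (Fin.last (l + 1))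
    rw [hAt, mulVec_smul, Pi.smul_apply, Pi.smul_apply, mulVec_single_one, smul_eq_mul,
      smul_eq_mul] at e2
    rw [← e2, mul_comm]
    rfl
  have hU : ∀ i : Fin (l + 1), colleagueU (l + 2) i.succ = 0 := fun i => by simp [colleagueU]
  have hsub : ∀ i j : Fin (l + 1), A i.succ j.castSucc =
      if i = j then z * 0 - colleagueF (l + 2) i.succ j.castSucc else A i.succ j.castSucc := by
    intro i j
    split_ifs with hij
    · have : i.succ ≠ j.castSucc := by
        rw [hij, Ne, Fin.ext_iff]
        simp
      rw [hA, colleague]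
      simp [vecMulVec_apply, hU, this]
    · rfl
  -- without its first row and last column `A` is upper triangular, with the negatives of the
  -- subdiagonal entries of `F` on the diagonal
  have hminor : (A.submatrix (Fin.succAbove 0) (Fin.last (l + 1)).succAbove).det =
      (-(1 / 2)) ^ l * (-((Real.sqrt 2 : ℂ) / 2)) := by
    rw [det_of_isUpperTriangular]
    · rw [Fin.prod_univ_castSucc]
      simp only [submatrix_apply, Fin.succAbove_zero, Fin.succAbove_last]
      rw [hsub, if_pos rfl, colleagueF_apply]
      congr 1
      · rw [Finset.prod_congr rfl (g := fun _ => -(1 / 2 : ℂ)), Finset.prod_const,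
          Finset.card_univ, Fintype.card_fin]
        intro i _
        have := i.2
        rw [hsub, if_pos rfl, colleagueF_apply]
        simp [(show (i : ℕ) ≠ l by omega)]
        intro h
        omega
      · simp
        omega
    · intro i j hij
      have hij' : (j : ℕ) < i := hij
      simp only [submatrix_apply, Fin.succAbove_zero, Fin.succAbove_last]
      have hne : i.succ ≠ j.castSucc := by
        rw [Ne, Fin.ext_iff, Fin.val_succ, Fin.val_castSucc]
        omega
      rw [hA, colleague]
      simp only [Matrix.sub_apply, Matrix.add_apply, vecMulVec_apply, hU, zero_mul, add_zero,
        scalar_apply, diagonal_apply_ne _ hne, colleagueF_apply, Fin.val_succ, Fin.val_castSucc]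
      rw [if_neg (by omega), if_neg (by omega)]
      simp
  rw [adjugate_fin_succ_eq_det_submatrix, hminor] at hcr
  have ht' : t (Fin.last (l + 1)) = (Real.sqrt 2 : ℂ)⁻¹ := by
    simp [ht, chebVec]
  rw [ht'] at hcr
  have h3 : A.det = (-1) ^ (l + 1) * ((-(1 / 2)) ^ l * (-1 / 2)) * (chebPoly c).eval z := by
    have e1 : A.det = A.det * (Real.sqrt 2 : ℂ)⁻¹ * Real.sqrt 2 := by
      field_simp
    rw [e1, hcr]
    simp only [Fin.val_last, Fin.val_zero, zero_add]
    linear_combination (-1) ^ (l + 1) * (-(1 / 2)) ^ l * (-(1 / 2)) * (chebPoly c).eval z / 2 * h2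
  rw [h3, ← mul_assoc]
  have e4 : (2 : ℂ) ^ (l + 1) * ((-1) ^ (l + 1) * ((-(1 / 2)) ^ l * (-1 / 2))) =
      (2 * -1 * (-(1 / 2))) ^ l := by
    rw [mul_pow, mul_pow]
    ring
  rw [e4]
  norm_num

/-- The case `p = T_n`, in which the rank-one part vanishes. -/
theorem det_sub_colleagueF {l : ℕ} (z : ℂ) :
    2 ^ (l + 1) * (scalar (Fin (l + 2)) z - colleagueF (l + 2)).det =
      (Chebyshev.T ℂ ((l + 2 : ℕ) : ℤ)).eval z := by
  have h := det_sub_colleague (EuclideanSpace.single (Fin.last (l + 2)) (1 : ℂ)) (by simp) z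
  have e1 : colleague (EuclideanSpace.single (Fin.last (l + 2)) (1 : ℂ)) = colleagueF (l + 2) := by
    have : colleagueV (EuclideanSpace.single (Fin.last (l + 2)) (1 : ℂ)) = 0 := by
      ext i
      have : (⟨l + 2 - 1 - (i : ℕ), by omega⟩ : Fin (l + 2 + 1)) ≠ Fin.last (l + 2) := by
        rw [Ne, Fin.ext_iff, Fin.val_last]
        simp only
        omega
      rw [colleagueV, PiLp.single_apply, if_neg this, star_zero, mul_zero]
      rfl
    rw [colleague, this]
    simp
  rw [e1, eval_chebPoly] at h
  rw [h, Fin.sum_univ_castSucc]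
  simp [Fin.castSucc_ne_last]

end Colleague

/-! ### Recovering Chebyshev coefficients from values on an ellipse -/

theorem sum_rootOfUnity_zpow {N : ℕ} {ξ : ℂ} (hξ : IsPrimitiveRoot ξ N) (d : ℤ) :
    ∑ m ∈ Finset.range N, (ξ ^ d) ^ m = if (N : ℤ) ∣ d then (N : ℂ) else 0 := by
  split_ifs with h
  · rw [(hξ.zpow_eq_one_iff_dvd d).mpr h]
    simp
  · have h1 : ξ ^ d ≠ 1 := fun h' => h ((hξ.zpow_eq_one_iff_dvd d).mp h')
    have h2 : (ξ ^ d) ^ N = 1 := by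
      rw [← zpow_natCast, ← zpow_mul, mul_comm, zpow_mul, zpow_natCast, hξ.pow_eq_one, one_zpow]
    rw [geom_sum_eq h1, h2, sub_self, zero_div]

open Polynomial in
/-- The coefficients of a Chebyshev expansion of length `n`, from bounds at `2 n` points of the
ellipse `cos (ℝ + i τ)`: discrete Fourier inversion. -/
theorem norm_chebyshev_coeff_le {n : ℕ} {a : ℕ → ℂ} {τ K : ℝ} (hτ : 0 ≤ τ)
    (h : ∀ φ : ℝ, ‖(∑ k ∈ Finset.range n, C (a k) * Chebyshev.T ℂ k).eval
      (Complex.cos (φ + τ * Complex.I))‖ ≤ K) {j : ℕ} (hj : j < n) : ‖a j‖ ≤ 2 * K := by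
  have hN : 2 * n ≠ 0 := by omega
  set ξ := Complex.exp (2 * Real.pi * Complex.I / (2 * n : ℕ)) with hξ
  have hprim : IsPrimitiveRoot ξ (2 * n) := Complex.isPrimitiveRoot_exp (2 * n) hN
  have hξ0 : ξ ≠ 0 := Complex.exp_ne_zero _
  set φ : ℕ → ℝ := fun m => 2 * Real.pi * m / (2 * n : ℕ) with hφ
  set r : ℂ := Complex.exp (-τ) with hr
  have hr0 : r ≠ 0 := Complex.exp_ne_zero _
  -- at the points `φ m + i τ` the values of `T_k` are `(ζ ^ k + ζ ^ (-k)) / 2` with `ζ = ξ ^ m * r`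
  have hE : ∀ m : ℕ, Complex.exp ((φ m + τ * Complex.I) * Complex.I) = ξ ^ m * r := by
    intro m
    rw [hξ, hr, ← Complex.exp_nat_mul, ← Complex.exp_add]
    congr 1
    simp only [hφ]
    push_cast
    linear_combination (τ : ℂ) * Complex.I_mul_I
  have hT : ∀ m k : ℕ, (Chebyshev.T ℂ (k : ℤ)).eval (Complex.cos (φ m + τ * Complex.I)) =
      (r ^ k * (ξ ^ (k : ℤ)) ^ m + (r ^ k)⁻¹ * (ξ ^ (-(k : ℤ))) ^ m) / 2 := by
    intro m k
    have e1 : Complex.exp ((k : ℂ) * (φ m + τ * Complex.I) * Complex.I) = (ξ ^ m * r) ^ k := by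
      rw [mul_assoc, Complex.exp_nat_mul, hE]
    rw [Chebyshev.T_complex_cos, Complex.cos]
    push_cast
    rw [e1, neg_mul, Complex.exp_neg, e1, zpow_neg, zpow_natCast, mul_pow, mul_inv, inv_pow,
      ← pow_mul, ← pow_mul, mul_comm m k]
    ring
  -- the frequency `-j` is picked out; `2 * n` points suffice to separate it from all others, except
  -- from `+j` for `j = 0`, and there the two contributions have the same sign
  have hsum : ∑ m ∈ Finset.range (2 * n), (ξ ^ (j : ℤ)) ^ m *
      (∑ k ∈ Finset.range n, C (a k) * Chebyshev.T ℂ k).eval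
        (Complex.cos (φ m + τ * Complex.I)) =
      a j * ((2 * n : ℕ) * ((r ^ j)⁻¹ / 2 + if j = 0 then 1 / 2 else 0)) := by
    simp only [eval_finsetSum, eval_mul, eval_C, hT, Finset.mul_sum]
    rw [Finset.sum_comm, Finset.sum_eq_single j]
    · have e1 : ∀ m, (ξ ^ (j : ℤ)) ^ m * (a j * ((r ^ j * (ξ ^ (j : ℤ)) ^ m +
          (r ^ j)⁻¹ * (ξ ^ (-(j : ℤ))) ^ m) / 2)) =
          a j * (r ^ j / 2) * (ξ ^ ((j : ℤ) + j)) ^ m +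
          a j * ((r ^ j)⁻¹ / 2) * (ξ ^ ((j : ℤ) + -(j : ℤ))) ^ m := by
        intro m
        rw [zpow_add₀ hξ0, zpow_add₀ hξ0, mul_pow, mul_pow]
        ring
      simp only [e1, Finset.sum_add_distrib, ← Finset.mul_sum]
      rw [sum_rootOfUnity_zpow hprim, sum_rootOfUnity_zpow hprim, add_neg_cancel,
        if_pos (dvd_zero _)]
      rcases Nat.eq_zero_or_pos j with rfl | hj0
      · simp
        ring
      · rw [if_neg, if_neg hj0.ne']
        · ring
        · intro hd
          have := Int.le_of_dvd (by omega) hd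
          omega
    · intro k hk hkj
      rw [Finset.mem_range] at hk
      have e1 : ∀ m, (ξ ^ (j : ℤ)) ^ m * (a k * ((r ^ k * (ξ ^ (k : ℤ)) ^ m +
          (r ^ k)⁻¹ * (ξ ^ (-(k : ℤ))) ^ m) / 2)) =
          a k * (r ^ k / 2) * (ξ ^ ((j : ℤ) + k)) ^ m +
          a k * ((r ^ k)⁻¹ / 2) * (ξ ^ ((j : ℤ) + -(k : ℤ))) ^ m := by
        intro m
        rw [zpow_add₀ hξ0, zpow_add₀ hξ0, mul_pow, mul_pow]
        ring
      simp only [e1, Finset.sum_add_distrib, ← Finset.mul_sum]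
      rw [sum_rootOfUnity_zpow hprim, sum_rootOfUnity_zpow hprim, if_neg, if_neg]
      · ring
      · intro hd
        have := Int.eq_zero_of_abs_lt_dvd hd (by rw [abs_lt]; omega)
        omega
      · intro hd
        have := Int.le_of_dvd (by omega) hd
        omega
    · intro hj'
      exact absurd (Finset.mem_range.mpr hj) hj'
  have hξn : ‖ξ‖ = 1 := hprim.norm'_eq_one hN
  have hle : ‖∑ m ∈ Finset.range (2 * n), (ξ ^ (j : ℤ)) ^ m *
      (∑ k ∈ Finset.range n, C (a k) * Chebyshev.T ℂ k).eval
        (Complex.cos (φ m + τ * Complex.I))‖ ≤ (2 * n : ℕ) * K := by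
    refine (norm_sum_le _ _).trans ((Finset.sum_le_card_nsmul _ _ K fun m _ => ?_).trans ?_)
    · rw [norm_mul, norm_pow, norm_zpow, hξn, one_zpow, one_pow, one_mul]
      exact h (φ m)
    · rw [Finset.card_range, nsmul_eq_mul]
  have hrn : 1 / 2 ≤ ‖(r ^ j)⁻¹ / 2 + if j = 0 then (1 / 2 : ℂ) else 0‖ := by
    have hrr : r = (Real.exp (-τ) : ℝ) := by
      rw [hr]
      push_cast
      rfl
    have e1 : (r ^ j)⁻¹ / 2 + (if j = 0 then (1 / 2 : ℂ) else 0) =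
        (((Real.exp (-τ) ^ j)⁻¹ / 2 + if j = 0 then 1 / 2 else 0 : ℝ) : ℂ) := by
      rw [hrr]
      split_ifs <;> push_cast <;> rfl
    rw [e1, Complex.norm_real, Real.norm_eq_abs]
    refine le_trans ?_ (le_abs_self _)
    have e2 : Real.exp (-τ) ^ j ≤ 1 :=
      pow_le_one₀ (Real.exp_pos _).le (Real.exp_le_one_iff.mpr (by linarith))
    have e3 : 1 ≤ (Real.exp (-τ) ^ j)⁻¹ := (one_le_inv₀ (by positivity)).mpr e2
    split_ifs <;> linarith
  rw [hsum, norm_mul, norm_mul, Complex.norm_natCast] at hle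
  have hn0 : (0 : ℝ) < (2 * n : ℕ) := by exact_mod_cast Nat.pos_of_ne_zero hN
  have h1 : ‖a j‖ * (1 / 2) * (2 * n : ℕ) ≤ K * (2 * n : ℕ) := by
    have := mul_le_mul_of_nonneg_left hrn (norm_nonneg (a j))
    nlinarith
  have := le_of_mul_le_mul_right h1 hn0
  linarith

/-! ### The ellipse `cos (ℝ + i τ)` -/

/-- The distance of the ellipse from `[-1, 1]`: the ellipse with foci `±1` and semi-axis `cosh τ` is
the set where the distances from the foci add up to `2 cosh τ`. -/
theorem le_norm_cos_sub_ofReal (φ : ℝ) {τ : ℝ} (hτ : 0 ≤ τ) {r : ℝ} (hr : |r| ≤ 1) :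
    τ ^ 2 / 2 ≤ ‖Complex.cos (φ + τ * Complex.I) - r‖ := by
  set z := Complex.cos (φ + τ * Complex.I) with hz
  have hre : z.re = Real.cos φ * Real.cosh τ := by
    rw [hz, Complex.cos_add_mul_I, ← Complex.ofReal_cos, ← Complex.ofReal_sin,
      ← Complex.ofReal_cosh, ← Complex.ofReal_sinh]
    simp only [Complex.sub_re, Complex.mul_re, Complex.mul_im, Complex.ofReal_re,
      Complex.ofReal_im, Complex.I_re, Complex.I_im]
    ring
  have him : z.im = -(Real.sin φ * Real.sinh τ) := by
    rw [hz, Complex.cos_add_mul_I, ← Complex.ofReal_cos, ← Complex.ofReal_sin,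
      ← Complex.ofReal_cosh, ← Complex.ofReal_sinh]
    simp only [Complex.sub_im, Complex.mul_re, Complex.mul_im, Complex.ofReal_re,
      Complex.ofReal_im, Complex.I_re, Complex.I_im]
    ring
  -- the foci of the ellipse are `±1`
  have hs := Real.sin_sq_add_cos_sq φ
  have hh := Real.cosh_sq τ
  have h1 : Real.cosh τ - Real.cos φ ≤ ‖z - 1‖ := by
    rw [Complex.norm_eq_sqrt_sq_add_sq]
    refine Real.le_sqrt_of_sq_le (le_of_eq ?_)
    simp only [Complex.sub_re, Complex.sub_im, Complex.one_re, Complex.one_im, hre, him]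
    linear_combination (-Real.sinh τ ^ 2) * hs + (1 - Real.cos φ ^ 2) * hh
  have h2 : Real.cosh τ + Real.cos φ ≤ ‖z + 1‖ := by
    rw [Complex.norm_eq_sqrt_sq_add_sq]
    refine Real.le_sqrt_of_sq_le (le_of_eq ?_)
    simp only [Complex.add_re, Complex.add_im, Complex.one_re, Complex.one_im, hre, him]
    linear_combination (-Real.sinh τ ^ 2) * hs + (1 - Real.cos φ ^ 2) * hh
  have h3 : ‖z - 1‖ ≤ ‖z - r‖ + (1 - r) := by
    have e1 : z - 1 = (z - r) - ((1 - r : ℝ) : ℂ) := by push_cast; ring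
    rw [e1]
    refine (norm_sub_le _ _).trans ?_
    rw [Complex.norm_real, Real.norm_of_nonneg (by linarith [(abs_le.mp hr).2])]
  have h4 : ‖z + 1‖ ≤ ‖z - r‖ + (1 + r) := by
    have e1 : z + 1 = (z - r) + ((1 + r : ℝ) : ℂ) := by push_cast; ring
    rw [e1]
    refine (norm_add_le _ _).trans ?_
    rw [Complex.norm_real, Real.norm_of_nonneg (by linarith [(abs_le.mp hr).1])]
  have h5 : 1 + τ ^ 2 / 2 ≤ Real.cosh τ := by
    have e1 : Real.cosh τ = Real.cosh (τ / 2) ^ 2 + Real.sinh (τ / 2) ^ 2 := by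
      rw [← Real.cosh_two_mul]
      ring_nf
    have e2 := Real.self_le_sinh_iff.mpr (show 0 ≤ τ / 2 by linarith)
    rw [e1, Real.cosh_sq]
    nlinarith
  linarith

theorem norm_cos_le_three (x : ℝ) : ‖Complex.cos (x + Complex.I)‖ ≤ 3 := by
  rw [Complex.cos, norm_div]
  have h1 : ‖Complex.exp ((x + Complex.I) * Complex.I)‖ ≤ 3 := by
    rw [Complex.norm_exp]
    simp
    linarith [Real.exp_le_one_iff.mpr (show (-1 : ℝ) ≤ 0 by norm_num)]
  have h2 : ‖Complex.exp (-(x + Complex.I) * Complex.I)‖ ≤ 3 := by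
    rw [Complex.norm_exp]
    simp
    linarith [Real.exp_one_lt_d9]
  have := norm_add_le (Complex.exp ((x + Complex.I) * Complex.I))
    (Complex.exp (-(x + Complex.I) * Complex.I))
  rw [Complex.norm_ofNat]
  linarith

section Perturbation

open scoped Matrix Matrix.Norms.L2Operator
open Polynomial Matrix

variable {n : ℕ}

/-! ### Perturbation of determinants -/

theorem norm_multiset_prod_one_sub_le (s : Multiset ℂ) {y : ℝ} (hs : ∀ r ∈ s, ‖r‖ ≤ y) :
    ‖(s.map (1 - ·)).prod - 1‖ ≤ Real.exp (s.card * y) - 1 := by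
  induction s using Multiset.induction_on with
  | empty => simp
  | cons r s ih =>
    have h1 := ih fun a ha => hs a (Multiset.mem_cons_of_mem ha)
    have h2 := hs r (Multiset.mem_cons_self _ _)
    rw [Multiset.map_cons, Multiset.prod_cons, Multiset.card_cons]
    set p := (s.map (1 - ·)).prod
    have e1 : (1 - r) * p - 1 = (1 - r) * (p - 1) - r := by ring
    have h3 : ‖1 - r‖ ≤ 1 + y := (norm_sub_le _ _).trans (by rw [norm_one]; linarith)
    have h4 : 1 + y ≤ Real.exp y := by linarith [Real.add_one_le_exp y]
    have h5 : ‖(1 - r) * (p - 1)‖ ≤ (1 + y) * (Real.exp (s.card * y) - 1) := by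
      rw [norm_mul]
      exact mul_le_mul h3 h1 (norm_nonneg _) ((norm_nonneg _).trans h3)
    have h6 : Real.exp ((s.card + 1 : ℕ) * y) = Real.exp y * Real.exp (s.card * y) := by
      rw [← Real.exp_add]
      push_cast
      ring_nf
    rw [e1, h6]
    refine (norm_sub_le _ _).trans ?_
    have h7 := mul_le_mul_of_nonneg_right h4 (Real.exp_pos (s.card * y)).le
    linarith

/-- The determinant of `1 - Y` is a product of factors `1 - r` over the eigenvalues `r` of `Y`. -/
theorem norm_det_one_sub_sub_one_le (Y : Matrix (Fin n) (Fin n) ℂ) (h : n * ‖Y‖ ≤ 1) :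
    ‖(1 - Y).det - 1‖ ≤ 2 * (n * ‖Y‖) := by
  rcases Nat.eq_zero_or_pos n with rfl | hn
  · simp
  have : Nonempty (Fin n) := ⟨⟨0, hn⟩⟩
  have e1 : (1 - Y).det = (Y.charpoly.roots.map (1 - ·)).prod := by
    have := eval_charpoly Y 1
    rw [map_one] at this
    rw [← this, ← (IsAlgClosed.splits Y.charpoly).eval_eq_prod_roots_of_monic (charpoly_monic Y)]
  have e2 : Y.charpoly.roots.card = n := by
    rw [← (IsAlgClosed.splits Y.charpoly).natDegree_eq_card_roots, charpoly_natDegree_eq_dim,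
      Fintype.card_fin]
  have h1 := norm_multiset_prod_one_sub_le Y.charpoly.roots (y := ‖Y‖) fun r hr =>
    spectrum.norm_le_norm_of_mem (mem_spectrum_of_isRoot_charpoly (isRoot_of_mem_roots hr))
  rw [e2] at h1
  rw [e1]
  have h0 : 0 ≤ n * ‖Y‖ := by positivity
  have h2 := Real.abs_exp_sub_one_le (x := n * ‖Y‖) (by rwa [abs_of_nonneg h0])
  rw [abs_of_nonneg h0] at h2
  exact h1.trans ((le_abs_self _).trans h2)

theorem norm_star_dotProduct_le (v w : Fin n → ℂ) : ‖star v ⬝ᵥ w‖ ≤ vnorm v * vnorm w := by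
  rw [dotProduct_comm]
  exact norm_inner_le_norm (𝕜 := ℂ) (WithLp.toLp 2 v) (WithLp.toLp 2 w)

theorem det_sub_vecMulVec {X : Matrix (Fin n) (Fin n) ℂ} (hX : IsUnit X.det) (u w : Fin n → ℂ) :
    (X - vecMulVec u w).det = X.det * (1 - w ⬝ᵥ (X⁻¹ *ᵥ u)) := by
  have e1 : X - vecMulVec u w =
      X * (1 + replicateCol Unit (X⁻¹ *ᵥ u) * replicateRow Unit (-w)) := by
    rw [← vecMulVec_eq Unit, mul_add, mul_one, vecMulVec_neg, mul_neg, mul_vecMulVec,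
      mulVec_mulVec, mul_nonsing_inv X hX, one_mulVec, sub_eq_add_neg]
  rw [e1, det_mul, det_one_add_replicateCol_mul_replicateRow, neg_dotProduct, sub_eq_add_neg]

/-- The determinant of a perturbed rank-one modification, relative to the determinant of the
unmodified matrix. The bound is affine in `vnorm v`: a rank-one term enters the determinant
linearly, however large it is. -/
theorem norm_det_rank_one_perturbation_le {X E : Matrix (Fin n) (Fin n) ℂ} {u u' v v' : Fin n → ℂ}
    {S θ : ℝ} (hn : 0 < n) (hX : IsUnit X.det) (hS : ‖X⁻¹‖ ≤ S) (hθ : 4 * (n * (S * θ)) ≤ 1)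
    (hS0 : 0 ≤ S) (hθ0 : 0 ≤ θ)
    (hE : ‖E‖ ≤ θ) (hu1 : vnorm u ≤ 1) (hu : vnorm (u' - u) ≤ θ) (hθ1 : θ ≤ 1)
    (hv : vnorm (v' - v) ≤ θ * vnorm v) :
    ‖(X - E - vecMulVec u' (star v')).det - (X - vecMulVec u (star v)).det‖ ≤
      ‖X.det‖ * (2 * (n * (S * θ)) * (1 + 8 * S * vnorm v) +
        vnorm v * θ * (6 * S + 2 * S ^ 2)) := by
  have hn1 : (1 : ℝ) ≤ n := by exact_mod_cast hn
  set Y := X⁻¹ * E with hY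
  have hSθ : 0 ≤ S * θ := mul_nonneg hS0 hθ0
  have hYn : ‖Y‖ ≤ S * θ :=
    (norm_mul_le _ _).trans (mul_le_mul hS hE (norm_nonneg _) hS0)
  have hnY : n * ‖Y‖ ≤ n * (S * θ) := mul_le_mul_of_nonneg_left hYn (by positivity)
  have hSθn : S * θ ≤ n * (S * θ) := le_mul_of_one_le_left hSθ hn1
  set D := (1 - Y).det with hDdef
  have hD : ‖D - 1‖ ≤ 2 * (n * (S * θ)) :=
    (norm_det_one_sub_sub_one_le Y (by linarith)).trans (by linarith)
  have hD0 : D ≠ 0 := by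
    intro h0
    rw [h0, zero_sub, norm_neg, norm_one] at hD
    linarith
  have hXE : X - E = X * (1 - Y) := by
    rw [hY, mul_sub, mul_one, ← mul_assoc, mul_nonsing_inv X hX, one_mul]
  have hdet : (X - E).det = X.det * D := by rw [hXE, det_mul]
  have hXEu : IsUnit (X - E).det := by
    rw [hdet]
    exact hX.mul hD0.isUnit
  set R := (X - E)⁻¹ with hR
  -- the resolvent identity
  have hRX : R - X⁻¹ = Y * R := by
    have e1 : X⁻¹ * (X - E) * R = X⁻¹ := by
      rw [mul_assoc, hR, mul_nonsing_inv _ hXEu, mul_one]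
    rw [mul_sub, nonsing_inv_mul X hX, sub_mul, one_mul, ← hY] at e1
    rw [← e1]
    abel
  have hRn : ‖R‖ ≤ 2 * S := by
    have e1 : R = X⁻¹ + Y * R := by rw [← hRX]; abel
    have h1 : ‖R‖ ≤ ‖X⁻¹‖ + ‖Y * R‖ := by
      conv_lhs => rw [e1]
      exact norm_add_le _ _
    have h2 : ‖Y * R‖ ≤ 1 / 2 * ‖R‖ :=
      (norm_mul_le _ _).trans (mul_le_mul_of_nonneg_right (by linarith) (norm_nonneg _))
    linarith
  have hRXn : ‖R - X⁻¹‖ ≤ S * θ * (2 * S) := by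
    rw [hRX]
    exact (norm_mul_le _ _).trans (mul_le_mul hYn hRn (norm_nonneg _) hSθ)
  set ν := vnorm v with hν
  have hν0 : 0 ≤ ν := vnorm_nonneg v
  have hu' : vnorm u' ≤ 2 := by
    have := vnorm_add_le (u' - u) u
    rw [sub_add_cancel] at this
    linarith
  have hv' : vnorm v' ≤ 2 * ν := by
    have := vnorm_add_le (v' - v) v
    rw [sub_add_cancel] at this
    nlinarith
  have hRu' : vnorm (R *ᵥ u') ≤ 2 * S * 2 :=
    (vnorm_mulVec_le _ _).trans (mul_le_mul hRn hu' (vnorm_nonneg _) (by positivity))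
  set a := star v ⬝ᵥ (X⁻¹ *ᵥ u) with ha
  set a' := star v' ⬝ᵥ (R *ᵥ u') with ha'
  have hA : ‖a'‖ ≤ 8 * S * ν := by
    refine (norm_star_dotProduct_le _ _).trans
      ((mul_le_mul hv' hRu' (vnorm_nonneg _) (by positivity)).trans (le_of_eq (by ring)))
  have hAA : ‖a' - a‖ ≤ ν * θ * (6 * S + 2 * S ^ 2) := by
    have e1 : a' - a = star (v' - v) ⬝ᵥ (R *ᵥ u') +
        (star v ⬝ᵥ (R *ᵥ (u' - u)) + star v ⬝ᵥ ((R - X⁻¹) *ᵥ u)) := by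
      rw [ha, ha', star_sub, sub_dotProduct, mulVec_sub, sub_mulVec, dotProduct_sub,
        dotProduct_sub]
      ring
    have h1 : ‖star (v' - v) ⬝ᵥ (R *ᵥ u')‖ ≤ θ * ν * (2 * S * 2) :=
      (norm_star_dotProduct_le _ _).trans (mul_le_mul hv hRu' (vnorm_nonneg _) (by positivity))
    have h2 : ‖star v ⬝ᵥ (R *ᵥ (u' - u))‖ ≤ ν * (2 * S * θ) :=
      (norm_star_dotProduct_le _ _).trans (mul_le_mul_of_nonneg_left
        ((vnorm_mulVec_le _ _).trans (mul_le_mul hRn hu (vnorm_nonneg _) (by positivity))) hν0)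
    have h3 : ‖star v ⬝ᵥ ((R - X⁻¹) *ᵥ u)‖ ≤ ν * (S * θ * (2 * S) * 1) :=
      (norm_star_dotProduct_le _ _).trans (mul_le_mul_of_nonneg_left
        ((vnorm_mulVec_le _ _).trans (mul_le_mul hRXn hu1 (vnorm_nonneg _) (by positivity))) hν0)
    rw [e1]
    refine (norm_add_le _ _).trans ((add_le_add h1 ((norm_add_le _ _).trans
      (add_le_add h2 h3))).trans (le_of_eq (by ring)))
  rw [det_sub_vecMulVec hXEu, det_sub_vecMulVec hX, hdet, ← ha, ← ha']
  have e1 : X.det * D * (1 - a') - X.det * (1 - a) =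
      X.det * ((D - 1) * (1 - a') - (a' - a)) := by ring
  rw [e1, norm_mul]
  refine mul_le_mul_of_nonneg_left ((norm_sub_le _ _).trans (add_le_add ?_ hAA)) (norm_nonneg _)
  rw [norm_mul]
  refine mul_le_mul hD ((norm_sub_le _ _).trans ?_) (norm_nonneg _) (by positivity)
  rw [norm_one]
  linarith

/-! ### The resolvent of the symmetric part of the colleague matrix -/

theorem colleagueF_isHermitian (n : ℕ) : (colleagueF n).IsHermitian := by
  ext i j
  rw [conjTranspose_apply, colleagueF, colleagueF]
  have e2 : star (Real.sqrt 2 : ℂ) = (Real.sqrt 2 : ℂ) := Complex.conj_ofReal _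
  split_ifs <;> first | omega | simp [e2]

/-- The eigenvalues of the symmetric part are zeros of `T_n`, hence in `[-1, 1]`. -/
theorem abs_eigenvalues_colleagueF_le {l : ℕ} (i : Fin (l + 2)) :
    |(colleagueF_isHermitian (l + 2)).eigenvalues i| ≤ 1 := by
  set r := (colleagueF_isHermitian (l + 2)).eigenvalues i with hr
  by_contra hlt
  rw [not_le] at hlt
  have h1 : (r : ℂ) ∈ spectrum ℂ (colleagueF (l + 2)) := by
    rw [(colleagueF_isHermitian (l + 2)).spectrum_eq_image_range]
    exact ⟨r, ⟨i, rfl⟩, rfl⟩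
  have h2 : (colleagueF (l + 2)).charpoly.eval (r : ℂ) = 0 :=
    mem_spectrum_iff_isRoot_charpoly.mp h1
  have h3 := det_sub_colleagueF (l := l) (r : ℂ)
  rw [← eval_charpoly, h2, mul_zero, ← Chebyshev.complex_ofReal_eval_T] at h3
  have h4 := Chebyshev.one_lt_abs_eval_T_real (n := ((l + 2 : ℕ) : ℤ)) (by positivity) hlt
  rw [Complex.ofReal_eq_zero.mp h3.symm, abs_zero] at h4
  linarith

/-- The resolvent of the Hermitian matrix `F`, bounded by the inverse distance to `[-1, 1]`. -/
theorem norm_inv_sub_colleagueF_le {l : ℕ} {z : ℂ} {S : ℝ} (hS : 0 < S)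
    (hz : ∀ r : ℝ, |r| ≤ 1 → S⁻¹ ≤ ‖z - r‖) :
    IsUnit (scalar (Fin (l + 2)) z - colleagueF (l + 2)).det ∧
      ‖(scalar (Fin (l + 2)) z - colleagueF (l + 2))⁻¹‖ ≤ S := by
  have hF := colleagueF_isHermitian (l + 2)
  set lam := hF.eigenvalues with hlam
  have hpos : ∀ i, z - lam i ≠ 0 := fun i h0 => by
    have h1 := hz (lam i) (abs_eigenvalues_colleagueF_le i)
    rw [h0, norm_zero] at h1
    exact absurd (inv_pos.mpr hS) (not_lt.mpr h1)
  set U : Matrix (Fin (l + 2)) (Fin (l + 2)) ℂ := hF.eigenvectorUnitary.1 with hU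
  have hUm : U ∈ Matrix.unitaryGroup (Fin (l + 2)) ℂ := hF.eigenvectorUnitary.2
  have hUU : U * Uᴴ = 1 := Matrix.mem_unitaryGroup_iff.mp hUm
  have hUU' : Uᴴ * U = 1 := Matrix.mem_unitaryGroup_iff'.mp hUm
  have hspec : colleagueF (l + 2) = U * diagonal (fun i => (lam i : ℂ)) * Uᴴ := by
    have := hF.spectral_theorem
    rw [Unitary.conjStarAlgAut_apply] at this
    exact this
  have hX : scalar (Fin (l + 2)) z - colleagueF (l + 2) =
      U * diagonal (fun i => z - lam i) * Uᴴ := by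
    have e1 : diagonal (fun i => z - lam i) =
        scalar (Fin (l + 2)) z - diagonal (fun i => (lam i : ℂ)) := by
      rw [scalar_apply, diagonal_sub]
    rw [e1, mul_sub, sub_mul, ← hspec, scalar_apply, ← smul_one_eq_diagonal, Matrix.mul_smul,
      mul_one, Matrix.smul_mul, hUU]
  set Z := U * diagonal (fun i => (z - lam i)⁻¹) * Uᴴ with hZ
  have hXZ : (scalar (Fin (l + 2)) z - colleagueF (l + 2)) * Z = 1 := by
    have e1 : (scalar (Fin (l + 2)) z - colleagueF (l + 2)) * Z =
        U * (diagonal (fun i => z - lam i) * ((Uᴴ * U) * diagonal (fun i => (z - lam i)⁻¹))) *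
          Uᴴ := by
      rw [hX, hZ]
      simp only [mul_assoc]
    rw [e1, hUU', one_mul, diagonal_mul_diagonal]
    simp only [mul_inv_cancel₀ (hpos _)]
    rw [diagonal_one, mul_one, hUU]
  refine ⟨?_, ?_⟩
  · have := congrArg det hXZ
    rw [det_mul, det_one] at this
    exact IsUnit.of_mul_eq_one _ this
  · rw [inv_eq_right_inv hXZ, hZ, norm_unitary_conj hUm, l2_opNorm_diagonal,
      pi_norm_le_iff_of_nonneg hS.le]
    intro i
    rw [norm_inv]
    exact inv_le_of_inv_le₀ hS (hz (lam i) (abs_eigenvalues_colleagueF_le i))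

end Perturbation

section ColleaguePerturbation

open scoped Matrix Matrix.Norms.L2Operator
open Polynomial Matrix

/-! ### Perturbation of the colleague matrix -/

theorem chebPoly_add {n : ℕ} (c δ : EuclideanSpace ℂ (Fin (n + 1))) :
    chebPoly (c + δ) = chebPoly c + chebPoly δ := by
  simp [chebPoly, add_mul, Finset.sum_add_distrib]

theorem chebPoly_eq_charpoly {l : ℕ} {c : EuclideanSpace ℂ (Fin (l + 2 + 1))}
    (hc : c (Fin.last (l + 2)) = 1) :
    chebPoly c = C (2 ^ (l + 1)) * (colleague c).charpoly :=
  Polynomial.funext fun z => by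
    rw [eval_mul, eval_C, eval_charpoly, det_sub_colleague c hc]

theorem norm_sqrt_two_le : ‖(Real.sqrt 2 : ℂ)‖ ≤ 2 := by
  rw [Complex.norm_real, Real.norm_of_nonneg (Real.sqrt_nonneg 2)]
  exact Real.sqrt_le_iff.mpr (by norm_num)

theorem vnorm_colleagueU {n : ℕ} (hn : 0 < n) : vnorm (colleagueU n) = 1 := by
  have e1 : colleagueU n = Pi.single (⟨0, hn⟩ : Fin n) 1 := by
    ext i
    rw [colleagueU, Pi.single_apply]
    simp only [Fin.ext_iff]
  rw [e1, vnorm_single]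

theorem norm_colleagueV_le {n : ℕ} (c : EuclideanSpace ℂ (Fin (n + 1))) (i : Fin n) :
    ‖colleagueV c i‖ ≤ ‖c‖ := by
  have h2 := norm_sqrt_two_le
  have h1 := PiLp.norm_apply_le c ⟨n - 1 - i, by omega⟩
  have h3 : ‖-(if (i : ℕ) + 1 = n then (Real.sqrt 2 : ℂ) else 1) / 2‖ ≤ 1 := by
    rw [norm_div, norm_neg, Complex.norm_ofNat]
    split_ifs
    · linarith
    · rw [norm_one]
      norm_num
  rw [colleagueV, norm_mul, norm_star]
  exact (mul_le_mul h3 h1 (norm_nonneg _) zero_le_one).trans_eq (one_mul _)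

theorem vnorm_colleagueV_le {n : ℕ} (c : EuclideanSpace ℂ (Fin (n + 1))) :
    vnorm (colleagueV c) ≤ n * ‖c‖ := by
  refine (vnorm_le_sum _).trans ((Finset.sum_le_card_nsmul _ _ ‖c‖ fun i _ =>
    norm_colleagueV_le c i).trans_eq ?_)
  rw [Finset.card_univ, Fintype.card_fin, nsmul_eq_mul]

theorem one_le_norm_of_monic {n : ℕ} {c : EuclideanSpace ℂ (Fin (n + 1))}
    (hc : c (Fin.last n) = 1) : 1 ≤ ‖c‖ := by
  have := PiLp.norm_apply_le c (Fin.last n)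
  rwa [hc, norm_one] at this

/-- On the ellipse with parameter `τ = 1 / n` the polynomial `T_n` is bounded and the resolvent of
the symmetric part is at most `2 n²`, which bounds the change of the characteristic polynomial. -/
theorem norm_eval_charpoly_sub_le {l : ℕ} {c : EuclideanSpace ℂ (Fin (l + 2 + 1))}
    (hc : c (Fin.last (l + 2)) = 1) {θ : ℝ} (hθ0 : 0 ≤ θ) (hθ : 8 * ((l + 2 : ℕ) : ℝ) ^ 3 * θ ≤ 1)
    {E : Matrix (Fin (l + 2)) (Fin (l + 2)) ℂ} {u' v' : Fin (l + 2) → ℂ} (hE : ‖E‖ ≤ θ)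
    (hu : vnorm (u' - colleagueU (l + 2)) ≤ θ)
    (hv : vnorm (v' - colleagueV c) ≤ θ * vnorm (colleagueV c)) (φ : ℝ) :
    ‖(C (2 ^ (l + 1)) * (colleagueF (l + 2) + E + vecMulVec u' (star v')).charpoly -
      chebPoly c).eval (Complex.cos (φ + (((l + 2 : ℕ) : ℝ)⁻¹ : ℝ) * Complex.I))‖ ≤
      600 * ((l + 2 : ℕ) : ℝ) ^ 6 * θ * ‖c‖ := by
  set x : ℝ := ((l + 2 : ℕ) : ℝ) with hx
  have hx1 : 1 ≤ x := by rw [hx]; exact_mod_cast (by omega : 1 ≤ l + 2)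
  have hx0 : 0 < x := by linarith
  set z := Complex.cos (φ + ((x⁻¹ : ℝ) : ℂ) * Complex.I) with hz
  have hS0 : 0 < 2 * x ^ 2 := by positivity
  obtain ⟨hX, hXn⟩ := norm_inv_sub_colleagueF_le (l := l) (z := z) hS0 fun r hr => by
    refine le_of_eq_of_le ?_ (le_norm_cos_sub_ofReal φ (inv_nonneg.mpr hx0.le) hr)
    rw [mul_inv, inv_pow]
    ring
  have hx3 : 1 ≤ x ^ 3 := one_le_pow₀ hx1
  have hθ1 : θ ≤ 1 := by nlinarith
  have hmain := norm_det_rank_one_perturbation_le (u := colleagueU (l + 2)) (by omega) hX hXn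
    (by rw [← hx]; linarith) hS0.le hθ0 hE (vnorm_colleagueU (by omega)).le hu hθ1 hv
  have hT : ‖(2 : ℂ) ^ (l + 1)‖ * ‖(scalar (Fin (l + 2)) z - colleagueF (l + 2)).det‖ ≤ 3 := by
    rw [← norm_mul, det_sub_colleagueF, hz, Chebyshev.T_complex_cos]
    have e1 : (((l + 2 : ℕ) : ℤ) : ℂ) * (φ + ((x⁻¹ : ℝ) : ℂ) * Complex.I) =
        ((x * φ : ℝ) : ℂ) + Complex.I := by
      have hxC : (x : ℂ) ≠ 0 := by exact_mod_cast hx0.ne'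
      have e2 : (((l + 2 : ℕ) : ℤ) : ℂ) = (x : ℂ) := by rw [hx]; push_cast; rfl
      rw [e2]
      push_cast
      field_simp
    rw [e1]
    exact norm_cos_le_three _
  rw [eval_sub, eval_mul, eval_C, eval_charpoly, ← det_sub_colleague c hc, ← mul_sub, norm_mul]
  have e1 : scalar (Fin (l + 2)) z - (colleagueF (l + 2) + E + vecMulVec u' (star v')) =
      scalar (Fin (l + 2)) z - colleagueF (l + 2) - E - vecMulVec u' (star v') := by abel
  have e2 : scalar (Fin (l + 2)) z - colleague c = scalar (Fin (l + 2)) z - colleagueF (l + 2) -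
      vecMulVec (colleagueU (l + 2)) (star (colleagueV c)) := by rw [colleague]; abel
  rw [e1, e2]
  set ν := vnorm (colleagueV c) with hν
  have hν0 : 0 ≤ ν := vnorm_nonneg _
  have hν1 : ν ≤ x * ‖c‖ := vnorm_colleagueV_le c
  have hc1 := one_le_norm_of_monic hc
  set b := 2 * (((l + 2 : ℕ) : ℝ) * (2 * x ^ 2 * θ)) * (1 + 8 * (2 * x ^ 2) * ν) +
        ν * θ * (6 * (2 * x ^ 2) + 2 * (2 * x ^ 2) ^ 2) with hb
  have hb0 : 0 ≤ b := by positivity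
  have hb1 : b ≤ 100 * x ^ 5 * θ * (1 + ν) := by
    have p3 : x ^ 3 ≤ x ^ 5 := pow_le_pow_right₀ hx1 (by norm_num)
    have p2 : x ^ 2 ≤ x ^ 5 := pow_le_pow_right₀ hx1 (by norm_num)
    have p4 : x ^ 4 ≤ x ^ 5 := pow_le_pow_right₀ hx1 (by norm_num)
    have hνθ : 0 ≤ ν * θ := mul_nonneg hν0 hθ0
    have q1 := mul_le_mul_of_nonneg_right p3 hθ0
    have q2 := mul_le_mul_of_nonneg_right p2 hνθ
    have q3 := mul_le_mul_of_nonneg_right p4 hνθ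
    have q4 : 0 ≤ x ^ 5 * θ := by positivity
    have q5 : 0 ≤ x ^ 5 * (ν * θ) := by positivity
    rw [hb, ← hx]
    nlinarith
  have hb2 : 1 + ν ≤ 2 * (x * ‖c‖) := by nlinarith
  have hb3 : b ≤ 200 * x ^ 6 * θ * ‖c‖ := by
    refine hb1.trans ((mul_le_mul_of_nonneg_left hb2 (by positivity)).trans_eq ?_)
    ring
  calc _ ≤ ‖(2 : ℂ) ^ (l + 1)‖ *
        (‖(scalar (Fin (l + 2)) z - colleagueF (l + 2)).det‖ * b) :=
        mul_le_mul_of_nonneg_left hmain (norm_nonneg _)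
    _ = ‖(2 : ℂ) ^ (l + 1)‖ * ‖(scalar (Fin (l + 2)) z - colleagueF (l + 2)).det‖ * b := by ring
    _ ≤ 3 * (200 * x ^ 6 * θ * ‖c‖) := mul_le_mul hT hb3 hb0 (by norm_num)
    _ = _ := by ring

/-- A relative perturbation of the two vectors and a small perturbation of the symmetric part of a
colleague matrix amount to a small change of the polynomial, relative to the norm of its
coefficient vector. -/
theorem exists_chebPoly_perturbation {l : ℕ} {c : EuclideanSpace ℂ (Fin (l + 2 + 1))}
    (hc : c (Fin.last (l + 2)) = 1) {θ : ℝ} (hθ0 : 0 ≤ θ) (hθ : 8 * ((l + 2 : ℕ) : ℝ) ^ 3 * θ ≤ 1)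
    {E : Matrix (Fin (l + 2)) (Fin (l + 2)) ℂ} {u' v' : Fin (l + 2) → ℂ} (hE : ‖E‖ ≤ θ)
    (hu : vnorm (u' - colleagueU (l + 2)) ≤ θ)
    (hv : vnorm (v' - colleagueV c) ≤ θ * vnorm (colleagueV c)) :
    ∃ δ : EuclideanSpace ℂ (Fin (l + 2 + 1)), δ (Fin.last (l + 2)) = 0 ∧
      chebPoly (c + δ) =
        C (2 ^ (l + 1)) * (colleagueF (l + 2) + E + vecMulVec u' (star v')).charpoly ∧
      ‖δ‖ ≤ 1200 * ((l + 2 : ℕ) : ℝ) ^ 7 * θ * ‖c‖ := by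
  set A := colleagueF (l + 2) + E + vecMulVec u' (star v') with hA
  set q := C (2 ^ (l + 1)) * A.charpoly - chebPoly c with hq
  have hdeg : q.degree < (l + 2 : ℕ) := by
    have h1 : (A.charpoly - (colleague c).charpoly).degree < A.charpoly.degree :=
      degree_sub_lt_left (by rw [charpoly_degree_eq_dim, charpoly_degree_eq_dim])
        (charpoly_monic A).ne_zero
        (by rw [(charpoly_monic A).leadingCoeff, (charpoly_monic _).leadingCoeff])
    rw [charpoly_degree_eq_dim, Fintype.card_fin] at h1
    rw [hq, chebPoly_eq_charpoly hc, ← mul_sub, degree_C_mul (pow_ne_zero _ two_ne_zero)]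
    exact h1
  obtain ⟨a, ha⟩ := exists_chebyshev_expansion (l + 2) q hdeg
  have hbound : ∀ j, j < l + 2 → ‖a j‖ ≤ 2 * (600 * ((l + 2 : ℕ) : ℝ) ^ 6 * θ * ‖c‖) := by
    intro j hj
    refine norm_chebyshev_coeff_le (τ := ((l + 2 : ℕ) : ℝ)⁻¹) (by positivity) (fun φ => ?_) hj
    rw [← ha, hq]
    exact norm_eval_charpoly_sub_le hc hθ0 hθ hE hu hv φ
  set w : Fin (l + 2 + 1) → ℂ := fun i => if (i : ℕ) < l + 2 then a i else 0 with hw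
  have hlast : w (Fin.last (l + 2)) = 0 := by simp [hw]
  have hcast : ∀ i : Fin (l + 2), w i.castSucc = a i := fun i => by simp [hw]
  refine ⟨WithLp.toLp 2 w, hlast, ?_, ?_⟩
  · have e1 : chebPoly (WithLp.toLp 2 w : EuclideanSpace ℂ (Fin (l + 2 + 1))) = q := by
      rw [chebPoly, Fin.sum_univ_castSucc]
      simp only [hlast, hcast, map_zero, zero_mul, add_zero, Fin.val_castSucc]
      rw [ha, Fin.sum_univ_eq_sum_range (fun k => C (a k) * Chebyshev.T ℂ (k : ℤ))]
    rw [chebPoly_add, e1, hq]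
    ring
  · refine (vnorm_le_sum w).trans ?_
    rw [Fin.sum_univ_castSucc, hlast, norm_zero, add_zero]
    refine (Finset.sum_le_card_nsmul _ _ (2 * (600 * ((l + 2 : ℕ) : ℝ) ^ 6 * θ * ‖c‖))
      fun i _ => ?_).trans_eq ?_
    · rw [hcast]
      exact hbound i i.2
    · rw [Finset.card_univ, Fintype.card_fin, nsmul_eq_mul]
      ring

end ColleaguePerturbation

section Assembly

open scoped Matrix Matrix.Norms.L2Operator
open Polynomial Matrix

/-! ### The amplification factor -/

theorem norm_le_segNorm (w : ℕ → ℂ) {a b i : ℕ} (ha : a ≤ i) (hb : i ≤ b) :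
    ‖w i‖ ≤ segNorm w a b := by
  refine Real.le_sqrt_of_sq_le ?_
  exact Finset.single_le_sum (f := fun i => ‖w i‖ ^ 2) (fun _ _ => by positivity)
    (Finset.mem_Icc.mpr ⟨ha, hb⟩)

/-- The windows in the definition of `γ_j` cover all pairs of indices with `a ≤ b + j + 1` and
`b ≤ a + j`. -/
theorem nearProd_gammaFactor {n j : ℕ} (hj : j < n) (u v : ℕ → ℂ) :
    NearProd n j (gammaFactor n j u v) u v := by
  intro a b ha hb hab hba
  -- the smallest window that contains both entries
  set i := max (a - j - 1) (b - j) with hi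
  have h1 : ‖u a‖ ≤ segNorm u i (min (i + j + 1) (n - 1)) :=
    norm_le_segNorm u (by omega) (by omega)
  have h2 : ‖v b‖ ≤ segNorm v (i - 1) (i + j) := norm_le_segNorm v (by omega) (by omega)
  refine (mul_le_mul h1 h2 (norm_nonneg _) (Real.sqrt_nonneg _)).trans ?_
  exact le_ciSup (f := fun i : Fin (n - j) => segNorm u (i : ℕ) (min ((i : ℕ) + j + 1) (n - 1)) *
    segNorm v ((i : ℕ) - 1) ((i : ℕ) + j)) (Set.finite_range _).bddAbove ⟨i, by omega⟩

theorem nearProd_gammaHat {n j : ℕ} (hj : j < n) {t : List ((ℕ → ℂ) × (ℕ → ℂ))}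
    {x : (ℕ → ℂ) × (ℕ → ℂ)} (hx : x ∈ t) : NearProd n j (max 1 (gammaHat n j t)) x.1 x.2 := by
  obtain ⟨k, rfl⟩ := List.get_of_mem hx
  intro a b ha hb hab hba
  refine (nearProd_gammaFactor hj _ _ a b ha hb hab hba).trans (le_max_of_le_right ?_)
  exact le_ciSup (f := fun k : Fin t.length => gammaFactor n j (t.get k).1 (t.get k).2)
    (Set.finite_range _).bddAbove k

/-! ### The initial and the final state -/

theorem FloatArith.QRRun.start_mem {ε : ℝ} {fl : FloatArith ε} {kind : ShiftKind} {n : ℕ}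
    {g₀ g : Gen} {t : List ((ℕ → ℂ) × (ℕ → ℂ))} (h : fl.QRRun kind n g₀ g t) :
    (g₀.u, g₀.v) ∈ t := by
  induction h with
  | start => exact List.mem_singleton_self _
  | step _ _ _ ih => exact List.mem_append_left _ ih

theorem norm_colleagueF_apply_le {n : ℕ} (i j : Fin n) : ‖colleagueF n i j‖ ≤ 1 := by
  have h2 := norm_sqrt_two_le
  rw [colleagueF]
  split_ifs
  · rw [norm_div, Complex.norm_ofNat]
    linarith
  · norm_num
  · norm_num

theorem norm_colleagueF_le (n : ℕ) : ‖colleagueF n‖ ≤ n ^ 2 :=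
  (opNorm_le_of_entries zero_le_one norm_colleagueF_apply_le).trans_eq (mul_one _)

theorem vnorm_le_of_norm_le {n : ℕ} {w z : Fin n → ℂ} {a : ℝ} (ha : 0 ≤ a)
    (h : ∀ i, ‖w i‖ ≤ a * ‖z i‖) : vnorm w ≤ a * vnorm z := by
  rw [vnorm, vnorm, EuclideanSpace.norm_eq, EuclideanSpace.norm_eq, ← Real.sqrt_sq ha,
    ← Real.sqrt_mul (sq_nonneg a), Finset.mul_sum]
  refine Real.sqrt_le_sqrt (Finset.sum_le_sum fun i _ => ?_)
  rw [← mul_pow]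
  exact pow_le_pow_left₀ (norm_nonneg _) (h i) 2

/-- The rounding of the generators counts as one operation. The only generator at which `v` and
`d` interact is the first diagonal entry, where `‖v 0‖` is bounded by the amplification factor. -/
theorem IsRoundedColleague.stateTracks {n : ℕ} (hn : 0 < n)
    {c : EuclideanSpace ℂ (Fin (n + 1))} {M j : ℕ} {ε Γ B ω : ℝ} {g : Gen}
    (h : IsRoundedColleague ε c g) (hε : 0 ≤ ε)
    (hE : ErrorBudget (colleagueF n) M ε Γ B ω) (hM : 1 ≤ M) (hΓ : NearProd n j Γ g.u g.v) :
    StateTracks (colleagueF n) (colleagueU n) (colleagueV c) M ω 1 (lowEntry g 0 ⟨0, 0, 0⟩)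
      g.u g.v := by
  obtain ⟨hd, hβ, -, hu, hv⟩ := h
  have hε1 := hE.eps_le
  have hB := hE.le_B
  have hB1 := hE.one_le
  have hω := hE.le_ω
  have hF0 := norm_nonneg (colleagueF n)
  have hεω : 2 * ε ≤ ω := by nlinarith
  -- the exact colleague matrix is the state with no errors
  have h0 : Tracks (colleagueF n) (colleagueU n) (colleagueV c) M ω 0 (colleagueF n)
      (colleagueU n) (colleagueV c) := by
    refine ⟨fun i j _ => (congrFun₂ (colleagueF_isHermitian n) j i).symm, fun i => ?_, 1,
      one_mem _, ?_, ?_, ?_⟩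
    · simp [colleagueF]
    · simp
    · simp [vnorm]
    · simp [vnorm]
  refine h0.step hM hE.nonneg hE.mul_le (W := 1) (one_mem _)
    (fun i j hij => repF_herm _ _ _ fun h => hij (Fin.ext h)) (fun i k hki => ?_) ?_ ?_
  · rw [one_mul, conjTranspose_one, mul_one]
    have hki' : (k : ℕ) ≤ i := hki
    simp only [trunc, repF]
    rw [if_pos hki']
    -- in the rows below the first one `u` vanishes, even after rounding, so that `F` and `A` agree
    rcases Nat.eq_zero_or_pos (i : ℕ) with hi | hi
    · have hi0 : i = ⟨0, hn⟩ := Fin.ext hi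
      have hk0 : k = ⟨0, hn⟩ := Fin.ext (by simp only; omega)
      subst hi0 hk0
      have e1 : colleague c ⟨0, hn⟩ ⟨0, hn⟩ = star (colleagueV c ⟨0, hn⟩) := by
        simp [colleague, colleagueF, colleagueU, vecMulVec_apply]
      have e2 := hd ⟨0, hn⟩
      have e3 := hu ⟨0, hn⟩
      have e4 := hv ⟨0, hn⟩
      have e5 := hΓ 0 0 hn hn (by omega) (by omega)
      rw [e1, norm_star] at e2
      simp only [colleagueU, if_true, norm_one, mul_one] at e2 e3 e4
      rw [lowEntry_diag, show colleagueF n ⟨0, hn⟩ ⟨0, hn⟩ = 0 by simp [colleagueF], sub_zero]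
      simp only at *
      set x := colleagueV c ⟨0, hn⟩
      have f1 : 1 - ε ≤ ‖g.u 0‖ := by
        have := norm_sub_norm_le 1 (g.u 0)
        rw [norm_one, norm_sub_rev] at this
        linarith
      have f2 : (1 - ε) * ‖x‖ ≤ ‖g.v 0‖ := by
        have := norm_sub_norm_le x (g.v 0)
        rw [norm_sub_rev] at this
        linarith
      have f3 : ‖g.v 0‖ ≤ (1 + ε) * ‖x‖ := by
        have := norm_sub_norm_le (g.v 0) x
        linarith
      have hx0 := norm_nonneg x
      -- `‖u 0‖` is about one, so that `‖v 0‖` is about `‖u 0‖ * ‖v 0‖ ≤ Γ`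
      have f4 : ‖x‖ ≤ 2 * Γ := by
        have p1 : (1 - ε) * ((1 - ε) * ‖x‖) ≤ ‖g.u 0‖ * ‖g.v 0‖ :=
          mul_le_mul f1 f2 (mul_nonneg (by linarith) hx0) (norm_nonneg _)
        nlinarith [mul_nonneg hε hx0]
      have f5 : g.d 0 - g.u 0 * star (g.v 0) =
          (g.d 0 - star x) - ((g.u 0 - 1) * star (g.v 0) + star (g.v 0 - x)) := by
        rw [star_sub]
        ring
      have f6 : ‖(g.u 0 - 1) * star (g.v 0)‖ ≤ ε * ((1 + ε) * ‖x‖) := by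
        rw [norm_mul, norm_star]
        exact mul_le_mul e3 f3 (norm_nonneg _) hε
      rw [f5]
      refine (norm_sub_le _ _).trans ?_
      have f7 := norm_add_le ((g.u 0 - 1) * star (g.v 0)) (star (g.v 0 - x))
      rw [norm_star] at f7
      have f8 : ε * ‖x‖ ≤ ε * (2 * Γ) := mul_le_mul_of_nonneg_left f4 hε
      have f9 : ε * Γ ≤ ε * B := mul_le_mul_of_nonneg_left (by linarith) hε
      nlinarith [mul_nonneg hε hx0, hE.Γ_nonneg]
    · have hui : colleagueU n i = 0 := if_neg hi.ne'
      have e1 := hu i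
      rw [hui, norm_zero, mul_zero, sub_zero, norm_le_zero_iff] at e1
      have hC : ∀ k : Fin n, colleague c i k = colleagueF n i k := fun k => by
        rw [colleague, Matrix.add_apply, vecMulVec_apply, hui, zero_mul, add_zero]
      rw [e1, zero_mul, sub_zero]
      rcases hki'.eq_or_lt with hik | hik
      · have hik : k = i := Fin.ext hik
        subst hik
        have e2 := hd k
        have hF : colleagueF n k k = 0 := by simp [colleagueF]
        rw [hC, hF, norm_zero, mul_zero] at e2
        rw [lowEntry_diag, hF]
        exact e2.trans hE.nonneg
      · rcases (Nat.succ_le_of_lt hik).eq_or_lt with hik' | hik'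
        · have e2 := hβ i k hik'
          rw [hC] at e2
          rw [← hik', lowEntry_subdiag]
          refine e2.trans ?_
          have := mul_le_mul_of_nonneg_left (norm_colleagueF_apply_le i k) hε
          linarith
        · have hF : colleagueF n i k = 0 := if_neg (by omega)
          rw [lowEntry_zero_bulge g 0 hik', hF, sub_zero, norm_zero]
          exact hE.nonneg
  · rw [one_mulVec]
    refine vnorm_le_of_norm_le (by linarith) fun i => (hu i).trans ?_
    exact mul_le_mul_of_nonneg_right (by linarith) (norm_nonneg _)
  · rw [one_mulVec]
    refine vnorm_le_of_norm_le (by linarith) fun i => (hv i).trans ?_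
    exact mul_le_mul_of_nonneg_right (by linarith) (norm_nonneg _)

/-- A state with zero subdiagonal is upper triangular, and undoing the accumulated similarity turns
its errors into a perturbation of the initial matrix. -/
theorem StateTracks.exists_charpoly_eq {n : ℕ} {F₀ : Matrix (Fin n) (Fin n) ℂ}
    {u₀ v₀ : Fin n → ℂ} {M m : ℕ} {ω : ℝ} {g : Gen}
    (h : StateTracks F₀ u₀ v₀ M ω m (lowEntry g 0 ⟨0, 0, 0⟩) g.u g.v)
    (hβ : ∀ i, i + 1 < n → g.β i = 0) :
    ∃ (E : Matrix (Fin n) (Fin n) ℂ) (u v : Fin n → ℂ), ‖E‖ ≤ m * (n ^ 2 * (3 * M * ω)) ∧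
      vnorm (u - u₀) ≤ m * ω * vnorm u₀ ∧ vnorm (v - v₀) ≤ m * ω * vnorm v₀ ∧
      (F₀ + E + vecMulVec u (star v)).charpoly = ∏ i : Fin n, (X - C (g.d i)) := by
  obtain ⟨V, hV, h1, h2, h3⟩ := h.near
  set F := trunc n (repF (lowEntry g 0 ⟨0, 0, 0⟩) g.u g.v) with hF
  have hVV : V * Vᴴ = 1 := Matrix.mem_unitaryGroup_iff.mp hV
  have hVV' : Vᴴ * V = 1 := Matrix.mem_unitaryGroup_iff'.mp hV
  have hV' : Vᴴ ∈ Matrix.unitaryGroup (Fin n) ℂ := Unitary.star_mem hV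
  have hvec : ∀ w w₀ : Fin n → ℂ, vnorm (Vᴴ *ᵥ w - w₀) ≤ vnorm (w - V *ᵥ w₀) := fun w w₀ => by
    have e1 : Vᴴ *ᵥ w - w₀ = Vᴴ *ᵥ (w - V *ᵥ w₀) := by
      rw [mulVec_sub, mulVec_mulVec, hVV', one_mulVec]
    rw [e1]
    exact vnorm_unitary_mulVec_le hV' _
  refine ⟨Vᴴ * (F - V * F₀ * Vᴴ) * V, Vᴴ *ᵥ truncV n g.u, Vᴴ *ᵥ truncV n g.v, ?_,
    (hvec _ _).trans h2, (hvec _ _).trans h3, ?_⟩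
  · have := norm_unitary_conj hV' (F - V * F₀ * Vᴴ)
    rw [conjTranspose_conjTranspose] at this
    rwa [this]
  · have e1 : F₀ + Vᴴ * (F - V * F₀ * Vᴴ) * V +
        vecMulVec (Vᴴ *ᵥ truncV n g.u) (star (Vᴴ *ᵥ truncV n g.v)) =
        Vᴴ * ((F + vecMulVec (truncV n g.u) (star (truncV n g.v))) * V) := by
      have e2 : Vᴴ * (V * F₀ * Vᴴ) * V = F₀ := by
        calc _ = (Vᴴ * V) * F₀ * (Vᴴ * V) := by simp only [mul_assoc]
          _ = F₀ := by rw [hVV', one_mul, mul_one]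
      rw [star_mulVec, conjTranspose_conjTranspose, ← mul_vecMulVec, ← vecMulVec_mul, mul_sub,
        sub_mul, e2, add_mul, mul_add, add_sub_cancel]
      simp only [mul_assoc]
    have e3 : F + vecMulVec (truncV n g.u) (star (truncV n g.v)) =
        trunc n (repA (lowEntry g 0 ⟨0, 0, 0⟩) g.u g.v) := by
      ext i k
      rfl
    rw [e1, charpoly_mul_comm, mul_assoc, hVV, mul_one, e3, charpoly_of_isUpperTriangular]
    · refine Finset.prod_congr rfl fun i _ => ?_
      rw [trunc, repA_of_le _ _ _ le_rfl, lowEntry_diag]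
    · intro i k hik
      have hik' : (k : ℕ) < i := hik
      rw [trunc, repA_of_le _ _ _ hik'.le]
      rcases (Nat.succ_le_of_lt hik').eq_or_lt with e | e
      · have e' : (k : ℕ) + 1 = i := e
        rw [← e', lowEntry_subdiag]
        exact hβ k (by omega)
      · exact lowEntry_zero_bulge g 0 e

theorem roots_C_mul_prod_X_sub_C {n : ℕ} {a : ℂ} (ha : a ≠ 0) (d : ℕ → ℂ) :
    (C a * ∏ i : Fin n, (X - C (d i))).roots = (Multiset.range n).map d := by
  rw [roots_C_mul _ ha, Fin.prod_univ_eq_prod_range (fun i => X - C (d i))]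
  have e1 : ∏ i ∈ Finset.range n, (X - C (d i)) =
      (((Multiset.range n).map d).map fun x => X - C x).prod := by
    rw [Multiset.map_map]
    rfl
  rw [e1, roots_multiset_prod_X_sub_C]

end Assembly

theorem theorem3p4 (N : Polynomial ℝ) :
    ∃ P : Polynomial ℝ, ∀ (kind : ShiftKind) (n : ℕ) (_ : kind.index < n)
      (c : EuclideanSpace ℂ (Fin (n + 1))) (_ : c (Fin.last n) = 1)
      (ε : ℝ) (fl : FloatArith ε) (g₀ g : Gen) (t : List ((ℕ → ℂ) × (ℕ → ℂ)))
      (_ : IsRoundedColleague ε c g₀)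
      (_ : fl.QRConverged kind n g₀ g t)
      (_ : ((t.length - 1 : ℕ) : ℝ) ≤ N.eval (n : ℝ))
      (_ : P.eval (n : ℝ) * max 1 (gammaHat n kind.index t) * ε ≤ 1),
      ∃ δc : EuclideanSpace ℂ (Fin (n + 1)),
        δc (Fin.last n) = 0 ∧
        (chebPoly (c + δc)).roots = (Multiset.range n).map g.d ∧
        ‖δc‖ ≤ P.eval (n : ℝ) * max 1 (gammaHat n kind.index t) * ‖c‖ * ε := by
  refine ⟨Polynomial.C 300000000 * Polynomial.X ^ 11 * (N ^ 2 + Polynomial.C 4) ^ 2, ?_⟩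
  intro kind n hn c hc ε fl g₀ g t hround hconv hlen hP
  obtain ⟨l, rfl⟩ : ∃ l, n = l + 2 := ⟨n - 2, by have := kind.one_le_index; omega⟩
  set Γ := max 1 (gammaHat (l + 2) kind.index t) with hΓ
  set x : ℝ := ((l + 2 : ℕ) : ℝ) with hx
  -- the number of rotations enters through an upper bound `R` of `2 * t.length + 1`
  set R : ℝ := N.eval x ^ 2 + 4 with hR
  have hPx : (Polynomial.C 300000000 * Polynomial.X ^ 11 *
      (N ^ 2 + Polynomial.C 4) ^ 2 : Polynomial ℝ).eval x = 300000000 * x ^ 11 * R ^ 2 := by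
    simp [hR]
  rw [hPx] at hP ⊢
  have hε : 0 ≤ ε := fl.eps_nonneg
  have hΓ1 : 1 ≤ Γ := le_max_left _ _
  have hx2 : 2 ≤ x := by rw [hx]; exact_mod_cast (by omega : 2 ≤ l + 2)
  have hx1 : 1 ≤ x := by linarith
  have hR4 : 4 ≤ R := by nlinarith [sq_nonneg (N.eval x)]
  have hR0 : 0 ≤ R := by linarith
  have hR2 : R ≤ R ^ 2 := by nlinarith
  set s := Γ * ε with hs
  have hs0 : 0 ≤ s := mul_nonneg (by linarith) hε
  have hεs : ε ≤ s := le_mul_of_one_le_left hε hΓ1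
  have hPs : 300000000 * x ^ 11 * R ^ 2 * s ≤ 1 := by rw [hs, ← mul_assoc]; exact hP
  set M := 2 * t.length + 1 with hM
  have hMR : (M : ℝ) ≤ R := by
    have h1 : (t.length : ℝ) ≤ ((t.length - 1 : ℕ) : ℝ) + 1 := by
      exact_mod_cast (by omega : t.length ≤ t.length - 1 + 1)
    rw [hM, hR]
    push_cast
    nlinarith [sq_nonneg (N.eval x - 1)]
  have hM1 : (1 : ℝ) ≤ M := by exact_mod_cast (by omega : 1 ≤ M)
  have hM0 : (0 : ℝ) ≤ M := by linarith
  -- the total error for the perturbation results: by `B ≤ 2 * x ^ 2 * Γ` the local error is at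
  -- most `80000 * x ^ 2 * s`, and `M` operations amplify it by `3 * x ^ 2 * M ^ 2`
  set θ := 240000 * x ^ 4 * R ^ 2 * s with hθdef
  have hR20 : 0 ≤ R ^ 2 * s := by positivity
  have hx3 : 1 ≤ x ^ 3 := one_le_pow₀ hx1
  have hx4 : 1 ≤ x ^ 4 := one_le_pow₀ hx1
  have hθ0 : 0 ≤ θ := by positivity
  have hθx : 8 * x ^ 3 * θ ≤ 1 := by
    have h1 : x ^ 7 ≤ x ^ 11 := pow_le_pow_right₀ hx1 (by norm_num)
    have h2 := mul_le_mul_of_nonneg_right h1 hR20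
    have h3 : 0 ≤ x ^ 11 * (R ^ 2 * s) := by positivity
    rw [hθdef]
    linarith
  have hθ1 : θ ≤ 1 := by nlinarith
  set B := x ^ 2 + 1 + Γ with hB
  set ω := 40000 * ε * B with hωdef
  have hx22 : 4 ≤ x ^ 2 := by nlinarith
  have hB0 : 0 ≤ B := by positivity
  have hω0 : 0 ≤ ω := by positivity
  have hω : ω ≤ 80000 * x ^ 2 * s := by
    have h1 : B ≤ 2 * x ^ 2 * Γ := by nlinarith
    have h2 := mul_le_mul_of_nonneg_left h1 hε
    rw [hωdef, hs]
    linarith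
  have hMω : M * (x ^ 2 * (3 * M * ω)) ≤ θ := by
    have h1 : (M : ℝ) ^ 2 ≤ R ^ 2 := pow_le_pow_left₀ hM0 hMR 2
    have h2 : (M : ℝ) ^ 2 * ω ≤ R ^ 2 * (80000 * x ^ 2 * s) :=
      mul_le_mul h1 hω hω0 (by positivity)
    have h3 := mul_le_mul_of_nonneg_left h2 (by positivity : 0 ≤ 3 * x ^ 2)
    rw [hθdef]
    linarith
  have hMω' : M * ω ≤ θ := by
    refine le_trans ?_ hMω
    have h1 : 1 ≤ x ^ 2 * (3 * M) := by nlinarith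
    have h2 := mul_le_mul_of_nonneg_right h1 (mul_nonneg hM0 hω0)
    linarith
  have hE : ErrorBudget (colleagueF (l + 2)) M ε Γ B ω :=
    { eps_le := by
        have h1 : 1 ≤ x ^ 11 := one_le_pow₀ hx1
        have h2 : 1 ≤ x ^ 11 * R ^ 2 := one_le_mul_of_one_le_of_one_le h1 (by linarith)
        have h3 := mul_le_mul_of_nonneg_right h2 hs0
        linarith
      one_le := by linarith
      le_B := by
        have := norm_colleagueF_le (l + 2)
        rw [← hx] at this
        linarith
      le_ω := le_rfl
      nonneg := hω0
      Γ_nonneg := by linarith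
      mul_le := hMω'.trans hθ1
      sq_le := by
        rw [← hx]
        linarith }
  have hnear : ∀ y ∈ t, NearProd (l + 2) kind.index Γ y.1 y.2 := fun y hy =>
    nearProd_gammaHat hn hy
  have hstart : NearProd (l + 2) kind.index Γ g₀.u g₀.v := by
    obtain ⟨g', hrun, -, -⟩ := hconv
    exact hnear (g₀.u, g₀.v) hrun.start_mem
  have hinit := hround.stateTracks (by omega) hε hE (by omega) hstart
  have hfinal := hconv.tracks hE (by omega) hinit hnear le_rfl
  obtain ⟨-, -, -, hβ⟩ := hconv
  obtain ⟨E, u, v, h1, h2, h3, h4⟩ := hfinal.exists_charpoly_eq hβ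
  rw [← hM] at h1 h2 h3
  rw [vnorm_colleagueU (by omega), mul_one] at h2
  obtain ⟨δ, hδ, hpoly, hnorm⟩ := exists_chebPoly_perturbation hc hθ0 hθx
    (h1.trans hMω) (h2.trans hMω')
    (h3.trans (mul_le_mul_of_nonneg_right hMω' (vnorm_nonneg _)))
  refine ⟨δ, hδ, ?_, hnorm.trans ?_⟩
  · rw [hpoly, h4, roots_C_mul_prod_X_sub_C (pow_ne_zero _ two_ne_zero)]
  · rw [← hx, hθdef, hs]
    have h5 : 0 ≤ x ^ 11 * R ^ 2 * (Γ * ε) * ‖c‖ := by positivity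
    linarith
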